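/- **Setup.** Throughout $\operatorname{Im}\tau>0$, $q=e^{2\pi i\tau}$ and $q^x=e^{2\pi i\tau x}$. For integers $0\le s\le m$ put $$\Phi_1^{[m;s]}(\tau,z_1,z_2)=\sum_{j\in\mathbb Z}\frac{e^{2\pi i(m+1)j(z_1+z_2)}e^{-2\pi i s z_1}q^{j^2(m+1)-js}}{1-e^{2\pi i z_1}q^j},$$ $$\Phi^{[m;s]}(\tau,z_1,z_2,t)=e^{2\pi i(m+1)t}\bigl(\Phi_1^{[m;s]}(\tau,z_1,z_2)-\Phi_1^{[m;s]}(\tau,-z_2,-z_1)\bigr),$$ $$\Theta_{j,d}(\tau,z)=\sum_{n\in\mathbb Z}e^{2\pi i d z(n+\frac j{2d})}q^{d(n+\frac j{2d})^2},\qquad E(x)=2\int_0^x e^{-\pi u^2}\,du,$$ $$R_{j;d}(\tau,v)=\sum_{n\equiv -j\,(2d)}\Bigl(\operatorname{sgn}\bigl(n+\tfrac12+j-2d\bigr)-E\Bigl(\bigl(n+2d\tfrac{\operatorname{Im}v}{\operatorname{Im}\tau}\bigr)\sqrt{\tfrac{\operatorname{Im}\tau}{d}}\Bigr)\Bigr)e^{-\frac{\pi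 i n^2}{2d}\tau-2\pi i n v},$$ $$\widetilde\Phi^{[m;s]}(\tau,z_1,z_2,t)=\Phi^{[m;s]}(\tau,z_1,z_2,t)+\tfrac12e^{2\pi i(m+1)t}\sum_{j=-s}^{-s+2m+1}R_{j;m+1}\bigl(\tau,\tfrac{z_1-z_2}2\bigr)\bigl(\Theta_{j,m+1}-\Theta_{-j,m+1}\bigr)(\tau,z_1+z_2).$$ For $\epsilon,\epsilon'\in\{0,\frac12\}$, a positive integer $M$ and $a,b\in\epsilon'+\mathbb Z$ put $$\widetilde\Psi^{[M,m,s;\epsilon]}_{a,b;\epsilon'}(\tau,z_1,z_2,t)=q^{\frac{(m+1)ab}M}e^{\frac{2\pi i(m+1)}M(bz_1+az_2)}\,\widetilde\Phi^{[m;s]}\bigl(M\tau,z_1+a\tau+\epsilon,z_2+b\tau+\epsilon,\tfrac tM\bigr).$$ Let $\eta$ be the Dedekind eta function and $\vartheta_{ab}(\tau,z)=\sum_{n\in\mathbb Z}e^{\pi i\tau(n+\frac a2)^2+2\pi i(n+\frac a2)(z+\frac b2)}$ the four Jacobi theta functions ($a,b\in\{0,1\}$). The $N=2$ (super)denominators are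 $$\overset{2}{R}{}^{(\epsilon)}_{\epsilon'}(\tau,z)=\frac{(-1)^{(1-2\epsilon)(1-2\epsilon')}\eta(\tau)^3}{\vartheta_{1-2\epsilon',1-2\epsilon}(\tau,z)}.$$ The modified characters ($\epsilon=\frac12$) and supercharacters ($\epsilon=0$), in the Neveu–Schwarz ($\epsilon'=\frac12$) and Ramond ($\epsilon'=0$) sectors, of the $N=2$ superconformal modules obtained by quantum Hamiltonian reduction from the principal admissible $\widehat{s\ell}_{2|1}$-modules of level $\frac{m+1}M-1$ associated to $(M,\Lambda_{m;s})$ are the functions $$\widetilde{ch}^{N=2[M,m,s;\epsilon]}_{j,k;\epsilon'}(\tau,z)=\frac{\widetilde\Psi^{[M,m,s;\epsilon]}_{j,k;\epsilon'}(\tau,-z,z,0)}{\overset{2}{R}{}^{(\epsilon)}_{\epsilon'}(\tau,z)},$$ extended by continuity in $z$ to the discrete set $\epsilon+\epsilon'\tau+\mathbb Z+\mathbb Z\tau$ of poles of the denominator. Here $(j,k)\in\Omega^{(M)}_{\epsilon'}$, where $$\Omega^{(M)}_{\epsilon}=\{(j,k)\in(\epsilon+\mathbb Z_{\ge0})^2\mid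 j+k\le M-1,\ j>0\}.$$ **Theorem 2.11.** Let $M\ge2$ and $m\ge0$ be integers with $\gcd(M,2m+2)=1$ if $m>0$, let $c=3\bigl(1-\frac{2m+2}M\bigr)$, let $s\in\mathbb Z$ with $0\le s\le m$, and let $\epsilon,\epsilon'\in\{0,\frac12\}$. Then for all $(j,k)\in\Omega^{(M)}_{\epsilon'}$ the extension by continuity exists, i.e. $\widetilde{ch}^{N=2[M,m,s;\epsilon]}_{j,k;\epsilon'}(\tau,z)$ is a continuous function of $z\in\mathbb C$, and for all $\tau$ with $\operatorname{Im}\tau>0$ and all $z\in\mathbb C$ $$\widetilde{ch}^{N=2[M,m,s;\epsilon]}_{j,k;\epsilon'}\Bigl(-\frac1\tau,\frac z\tau\Bigr)=e^{\frac{\pi i c}{3\tau}z^2}\sum_{(a,b)\in\Omega^{(M)}_\epsilon}S^{[M,m,\epsilon,\epsilon']}_{(j,k),(a,b)}\,\widetilde{ch}^{N=2[M,m,s;\epsilon']}_{a,b;\epsilon}(\tau,z),$$ where $$S^{[M,m,\epsilon,\epsilon']}_{(j,k),(a,b)}=(-i)^{(1-2\epsilon)(1-2\epsilon')}\,\frac2M\,e^{\frac{\pi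 i(m+1)}M(j-k)(a-b)}\sin\Bigl(\frac{m+1}M(j+k)(a+b)\pi\Bigr),$$ and $$\widetilde{ch}^{N=2[M,m,s;\epsilon]}_{j,k;\epsilon'}(\tau+1,z)=e^{\frac{2\pi i(m+1)}Mjk-\frac{\pi i\epsilon'}2}\,\widetilde{ch}^{N=2[M,m,s;|\epsilon-\epsilon'|]}_{j,k;\epsilon'}(\tau,z).$$ -/

import Mathlib

open Complex Topology Filter
open scoped Real

noncomputable section

namespace KacWakimoto

/-- The nome `q ^ x = e ^ (2 π i τ x)` for an arbitrary (complex) exponent `x`. -/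
def qPow (τ x : ℂ) : ℂ := cexp (2 * π * I * τ * x)

/-- The function `Φ₁^{[m;s]}(τ, z₁, z₂)`; it has simple poles at `z₁ ∈ ℤ + τ ℤ`. -/
def Phi₁ (m s : ℕ) (τ z₁ z₂ : ℂ) : ℂ :=
  ∑' j : ℤ,
    cexp (2 * π * I * ((m : ℂ) + 1) * j * (z₁ + z₂)) * cexp (-(2 * π * I * s * z₁)) *
        qPow τ ((j : ℂ) ^ 2 * ((m : ℂ) + 1) - j * s) /
      (1 - cexp (2 * π * I * z₁) * qPow τ j)

/-- The numerator `Φ^{[m;s]}(τ, z₁, z₂, t)` of the supercharacter of the integrable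
`sl(2|1)^`-module `L(Λ_{m;s})`. -/
def Phi (m s : ℕ) (τ z₁ z₂ t : ℂ) : ℂ :=
  cexp (2 * π * I * ((m : ℂ) + 1) * t) * (Phi₁ m s τ z₁ z₂ - Phi₁ m s τ (-z₂) (-z₁))

/-- The theta function `Θ_{j,d}(τ, z) = Θ_{j,d}(τ, z, 0)` of degree `d`. -/
def Theta (j : ℤ) (d : ℕ) (τ z : ℂ) : ℂ :=
  ∑' n : ℤ,
    cexp (2 * π * I * d * z * ((n : ℂ) + j / (2 * d))) *
      qPow τ ((d : ℂ) * ((n : ℂ) + j / (2 * d)) ^ 2)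

/-- `E(x) = 2 ∫₀ˣ e ^ (-π u²) du`. -/
def Efun (x : ℝ) : ℝ := 2 * ∫ u in (0 : ℝ)..x, Real.exp (-π * u ^ 2)

/-- The summand with index `n` of the (modified) Zwegers function `R_{j;d}(τ, v)`. -/
def RTerm (j : ℤ) (d : ℕ) (τ v : ℂ) (n : ℤ) : ℂ :=
  ((Real.sign ((n : ℝ) + 1 / 2 + j - 2 * d) -
      Efun (((n : ℝ) + 2 * d * (v.im / τ.im)) * √(τ.im / d)) : ℝ) : ℂ) *
    cexp (-(π * I * (n : ℂ) ^ 2 / (2 * d) * τ) - 2 * π * I * n * v)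

/-- The (modified) Zwegers function `R_{j;d}(τ, v)`, with `d = m + 1`: the sum of `RTerm` over
all integers `n ≡ -j mod 2d`, which are written as `n = 2 d l - j` with `l ∈ ℤ`. -/
def RZwegers (j : ℤ) (d : ℕ) (τ v : ℂ) : ℂ :=
  ∑' l : ℤ, RTerm j d τ v (2 * d * l - j)

/-- The additive correction `Φ_add^{[m;s]}(τ, z₁, z₂, t)`. -/
def PhiAdd (m s : ℕ) (τ z₁ z₂ t : ℂ) : ℂ :=
  1 / 2 * cexp (2 * π * I * ((m : ℂ) + 1) * t) *
    ∑ j ∈ Finset.Icc (-(s : ℤ)) (-(s : ℤ) + 2 * m + 1),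
      RZwegers j (m + 1) τ ((z₁ - z₂) / 2) *
        (Theta j (m + 1) τ (z₁ + z₂) - Theta (-j) (m + 1) τ (z₁ + z₂))

/-- The modification `Φ~^{[m;s]} = Φ^{[m;s]} + Φ_add^{[m;s]}`. -/
def PhiMod (m s : ℕ) (τ z₁ z₂ t : ℂ) : ℂ :=
  Phi m s τ z₁ z₂ t + PhiAdd m s τ z₁ z₂ t

/-- The modification `Ψ~^{[M,m,s;ε]}_{a,b;ε'}(τ, z₁, z₂, t)`, where `a, b ∈ ε' + ℤ`.
(The formula does not involve `ε'` otherwise.) -/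
def PsiMod (M m s : ℕ) (ε a b : ℝ) (τ z₁ z₂ t : ℂ) : ℂ :=
  qPow τ (((m : ℂ) + 1) * a * b / M) *
    cexp (2 * π * I * ((m : ℂ) + 1) / M * (b * z₁ + a * z₂)) *
    PhiMod m s (M * τ) (z₁ + a * τ + ε) (z₂ + b * τ + ε) (t / M)

/-- Jacobi theta functions with characteristics: for `a, b ∈ {0, 1}` these are the
four standard Jacobi forms `ϑ_{ab}(τ, z)`. -/
def thetaChar (a b : ℝ) (τ z : ℂ) : ℂ :=
  ∑' n : ℤ, cexp (π * I * τ * ((n : ℂ) + a / 2) ^ 2 +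
    2 * π * I * ((n : ℂ) + a / 2) * (z + b / 2))

/-- The normalized denominator (`ε = 1/2`) or superdenominator (`ε = 0`) of the `N = 2`
superconformal algebra, in the Neveu-Schwarz (`ε' = 1/2`) or Ramond (`ε' = 0`) sector:
`(-1)^{(1-2ε)(1-2ε')} η(τ)³ / ϑ_{1-2ε',1-2ε}(τ, z)`. -/
def N2Denom (ε ε' : ℝ) (τ z : ℂ) : ℂ :=
  (-1 : ℂ) ^ (((1 - 2 * ε) * (1 - 2 * ε') : ℝ) : ℂ) * ModularForm.eta τ ^ 3 /
    thetaChar (1 - 2 * ε') (1 - 2 * ε) τ z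

/-- The quotient of `Ψ~^{[M,m,s;ε]}_{j,k;ε'}(τ, -z, z, 0)` by the `N = 2` denominator. -/
def N2Quot (M m s : ℕ) (ε ε' j k : ℝ) (τ z : ℂ) : ℂ :=
  PsiMod M m s ε j k τ (-z) z 0 / N2Denom ε ε' τ z

/-- The coset `ε + ε' τ + ℤ + ℤ τ`: the zeros of `ϑ_{1-2ε',1-2ε}(τ, ·)`, i.e. the poles of the
`N = 2` denominator. For `j, k ∈ ε' + ℤ`, all poles of `z ↦ Ψ~_{j,k;ε'}(τ, -z, z, 0)` lie there. -/
def polarSet (ε ε' : ℝ) (τ : ℂ) : Set ℂ :=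
  {z | ∃ p q : ℤ, z = ε + ε' * τ + p + q * τ}

open Classical in
/-- The modified `N = 2` character (`ε = 1/2`) or supercharacter (`ε = 0`) with index
`[M,m,s;ε]` above and `j,k;ε'` below, in the Neveu-Schwarz (`ε' = 1/2`) or Ramond (`ε' = 0`)
sector. It is the quotient `N2Quot`, extended by continuity in `z` to the discrete set
where numerator and denominator have their poles. -/
def N2ChMod (M m s : ℕ) (ε ε' j k : ℝ) (τ z : ℂ) : ℂ :=
  if z ∈ polarSet ε ε' τ then limUnder (𝓝[≠] z) (N2Quot M m s ε ε' j k τ)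
  else N2Quot M m s ε ε' j k τ z

/-- The index set `Ω_ε^{(M)}` of all `(j, k) ∈ (ε + ℤ_{≥0})²` with `j + k ≤ M - 1` and `j > 0`
(see `mem_Omega`). -/
def Omega (M : ℕ) (ε : ℝ) : Finset (ℝ × ℝ) :=
  ((Finset.range M ×ˢ Finset.range M).image fun n => (ε + (n.1 : ℝ), ε + (n.2 : ℝ))).filter
    fun p => p.1 + p.2 ≤ (M : ℝ) - 1 ∧ 0 < p.1

theorem mem_Omega (M : ℕ) (ε : ℝ) (hε : 0 ≤ ε) (j k : ℝ) :
    (j, k) ∈ Omega M ε ↔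
      (∃ n : ℕ, j = ε + n) ∧ (∃ n : ℕ, k = ε + n) ∧ j + k ≤ (M : ℝ) - 1 ∧ 0 < j := by
  simp only [Omega, Finset.mem_filter, Finset.mem_image, Finset.mem_product, Finset.mem_range,
    Prod.exists, Prod.mk.injEq]
  constructor
  · rintro ⟨⟨a, b, -, rfl, rfl⟩, h⟩
    exact ⟨⟨a, rfl⟩, ⟨b, rfl⟩, h⟩
  · rintro ⟨⟨a, rfl⟩, ⟨b, rfl⟩, h1, h2⟩
    refine ⟨⟨a, b, ⟨?_, ?_⟩, rfl, rfl⟩, h1, h2⟩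
    · have hb : (0 : ℝ) ≤ b := b.cast_nonneg
      have : (a : ℝ) < M := by linarith
      exact_mod_cast this
    · have ha : (0 : ℝ) ≤ a := a.cast_nonneg
      have : (b : ℝ) < M := by linarith
      exact_mod_cast this

/-- The central charge `c = 3 (1 - (2m+2)/M)`. -/
def centralCharge (M m : ℕ) : ℝ := 3 * (1 - (2 * (m : ℝ) + 2) / M)

/-- The matrix entry `S^{[M,m,ε,ε']}_{(j,k),(a,b)}`. -/
def SMatrix (M m : ℕ) (ε ε' j k a b : ℝ) : ℂ :=
  (-I) ^ (((1 - 2 * ε) * (1 - 2 * ε') : ℝ) : ℂ) * (2 / M) *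
    cexp (π * I * ((m : ℂ) + 1) / M * (j - k) * (a - b)) *
    (Real.sin (((m : ℝ) + 1) / M * (j + k) * (a + b) * π) : ℂ)

end KacWakimoto

end

open scoped ComplexConjugate

noncomputable section

namespace KacWakimoto

section

/-! ### Sums over residue classes -/

/-! Put d = m + 1, u = z₁ + z₂ and v = (z₁ - z₂)/2. The characters are quotients of specialisations
of Φ~, and the theorem rests on two identities for Φ~ as a function of (u, v): the inversion law of
weight one (`phiHat_S`), and the change of level (`phiHat_div_eq_levelSum`), which writes Φ~ at
(τ/M, u/M, v/M) as a sum over (a, b) mod M of shifted copies of Φ~ at Mτ.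

Both are proved by one uniqueness argument. Fix u and regard the difference of the two sides as a
function of v. Φ~ is not holomorphic in v, but its ∂̄-derivative comes only from R and is built from
the kernel ∑ⱼ conj Θⱼ(2v) Θⱼ(u) with a Gaussian weight (`hasDbar_phiHat`). This kernel obeys both
laws itself: the inversion because finite Fourier matrices are unitary up to scale
(`weightedKernel_S`), the change of level by regrouping residue classes, which uses that d and M are
coprime (`weightedKernel_div`). Hence the difference is holomorphic off the poles. The residues
cancel, so it extends to an entire function with an integral period that picks up e^{2πiκ(2v+τ)}, κ
> 0, under v ↦ v + τ. This is a section of a line bundle of negative degree, so it vanishes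
(`eq_zero_of_quasiPeriodic`).

The quasi-periodicity of Φ~ relies on its independence of s off the poles (`phiHat_eq_zero_index`):
a shift by τ raises s by d, and the theta functions that appear when s changes in the Appell sums
are cancelled by the jump of R in its index.

Since M(-1/τ) = -1/(τ/M), inversion followed by the change of level gives Ψ~ at -1/τ as a sum over
all (a, b) mod M (`psiHat_neg_inv`). The antisymmetry Ψ~_{-b,-a} = -Ψ~_{a,b} kills the diagonal a +
b ≡ 0 and folds the rest onto Ω, turning pairs of exponentials into sines (`sum_inversionTerm`). The
classical laws of ϑ and η handle the denominators, and τ ↦ τ + 1 leaves Φ~ invariant. For (j, k) in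
Ω one has 0 < j + k < M, which makes the poles of the numerator at most simple; they lie at zeros of
the theta function in the denominator's reciprocal, so the quotient extends continuously. Identities
are proved off the polar set and extended by density. -/

theorem sum_range_affine {M : ℕ} (hM : 0 < M) {f : ℤ → ℂ} (hf : ∀ n, f (n + M) = f n) {c : ℤ}
    (hc : IsCoprime c (M : ℤ)) (e : ℤ) :
    ∑ i ∈ Finset.range M, f (c * i + e) = ∑ i ∈ Finset.range M, f i := by
  have : NeZero M := ⟨hM.ne'⟩
  have hper : Function.Periodic f (M : ℤ) := hf
  have hfac : ∀ n : ℤ, f n = f (((n : ZMod M).val : ℕ) : ℤ) := by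
    intro n
    rw [ZMod.val_intCast, Int.emod_def]
    have := hper.sub_zsmul_eq (x := n) (n / M)
    rw [← this]; congr 1; simp [mul_comm]
  have hsum : ∀ g : ZMod M → ℂ, ∑ i ∈ Finset.range M, g (i : ZMod M) = ∑ x : ZMod M, g x := by
    intro g
    refine Finset.sum_bij' (fun i _ => (i : ZMod M)) (fun x _ => x.val) ?_ ?_ ?_ ?_ ?_
    · intros; simp
    · intro x _; simpa using ZMod.val_lt x
    · intro i hi; simpa using ZMod.val_cast_of_lt (Finset.mem_range.1 hi)
    · intro x _; simp
    · intros; rfl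
  have h1 : ∑ i ∈ Finset.range M, f (c * i + e)
      = ∑ x : ZMod M, f ((((c : ZMod M) * x + e : ZMod M).val : ℕ) : ℤ) := by
    rw [← hsum]
    refine Finset.sum_congr rfl fun i _ => ?_
    rw [hfac]; push_cast; rfl
  have h2 : ∑ i ∈ Finset.range M, f i = ∑ x : ZMod M, f ((x.val : ℕ) : ℤ) := by
    rw [← hsum (fun x => f ((x.val : ℕ) : ℤ))]
    refine Finset.sum_congr rfl fun i _ => ?_
    rw [hfac]; push_cast; rfl
  rw [h1, h2]
  -- Coprimality makes multiplication by `c` bijective on `ZMod M`, so the affine map permutes the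
  -- residues through which `f` factors.
  have hu : IsUnit (c : ZMod M) := by
    obtain ⟨a, b, hab⟩ := hc
    refine IsUnit.of_mul_eq_one (a : ZMod M) ?_
    have := congrArg (Int.cast : ℤ → ZMod M) hab
    push_cast at this
    simpa [mul_comm] using this
  obtain ⟨w, hw⟩ := hu
  refine Fintype.sum_bijective (fun x : ZMod M => (c : ZMod M) * x + e) ?_ _ _ (fun _ => rfl)
  rw [← hw]
  exact (AddGroup.addRight_bijective (e : ZMod M)).comp (Units.mulLeft_bijective w)

theorem tsum_eq_sum_residue {M : ℕ} (hM : 0 < M) {f : ℤ → ℂ} (hf : Summable f) :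
    ∑' n, f n = ∑ i ∈ Finset.range M, ∑' n : ℤ, f (M * n + i) := by
  have : NeZero M := ⟨hM.ne'⟩
  have h := (Int.divModEquiv M).symm.tsum_eq f
  have hs : Summable fun p : ℤ × Fin M => f ((Int.divModEquiv M).symm p) :=
    (Int.divModEquiv M).symm.summable_iff.2 hf
  have hs' : Summable fun p : Fin M × ℤ => f ((Int.divModEquiv M).symm p.swap) :=
    (Equiv.prodComm _ _).summable_iff.2 hs
  rw [← h, ← (Equiv.prodComm (Fin M) ℤ).tsum_eq]
  rw [show (∑' c : Fin M × ℤ, f ((Int.divModEquiv M).symm ((Equiv.prodComm (Fin M) ℤ) c))) =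
    ∑' c : Fin M × ℤ, f ((Int.divModEquiv M).symm c.swap) from rfl, hs'.tsum_prod, tsum_fintype,
    Finset.sum_range]
  refine Finset.sum_congr rfl fun i _ => tsum_congr fun n => ?_
  congr 1
  simp [Int.divModEquiv, mul_comm]

theorem injective_affine {M : ℤ} (hM : M ≠ 0) (e : ℤ) :
    Function.Injective (fun n : ℤ => M * n + e) := by
  intro a b h
  exact mul_left_cancel₀ hM (add_right_cancel h)

/-- Residues mod M may be represented by any affine progression with slope prime to M. The slope d =
m + 1 is what the change of level of the theta kernel needs. -/
theorem tsum_eq_sum_affine {M : ℕ} (hM : 0 < M) {f : ℤ → ℂ} (hf : Summable f) {c : ℤ}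
    (hc : IsCoprime c (M : ℤ)) (e : ℤ) :
    ∑' n, f n = ∑ i ∈ Finset.range M, ∑' n : ℤ, f (M * n + (c * i + e)) := by
  rw [tsum_eq_sum_residue hM hf]
  refine (sum_range_affine hM (f := fun i => ∑' n : ℤ, f (M * n + i)) ?_ hc e).symm
  intro i
  rw [← (Equiv.addRight (1 : ℤ)).tsum_eq (fun n : ℤ => f (M * n + i))]
  refine tsum_congr fun n => ?_
  congr 1; simp; ring

/-! ### Theta functions of degree `d` -/

/-- The summand `exp (π i n z + π i n² τ / (2 d))` of the theta functions of degree `d`. -/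
def thetaTerm (d : ℕ) (τ z : ℂ) (n : ℤ) : ℂ :=
  cexp (π * I * n * z + π * I * (n : ℂ) ^ 2 * τ / (2 * d))

variable {d : ℕ} {τ : ℂ}

theorem Theta_eq_tsum (hd : 0 < d) (j : ℤ) (τ z : ℂ) :
    Theta j d τ z = ∑' l : ℤ, thetaTerm d τ z (2 * d * l + j) := by
  have hd' : (d : ℂ) ≠ 0 := by exact_mod_cast hd.ne'
  refine tsum_congr fun l => ?_
  rw [qPow, thetaTerm, ← Complex.exp_add]
  congr 1; push_cast; field_simp

theorem thetaTerm_eq_jacobiTheta₂_term (hd : 0 < d) (τ z : ℂ) (n : ℤ) :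
    thetaTerm d τ z n = jacobiTheta₂_term n (z / 2) (τ / (2 * d)) := by
  have hd' : (d : ℂ) ≠ 0 := by exact_mod_cast hd.ne'
  rw [thetaTerm, jacobiTheta₂_term]; congr 1; field_simp

theorem im_div_two_mul_natCast_pos (hd : 0 < d) (hτ : 0 < τ.im) : 0 < (τ / (2 * d)).im := by
  have : τ / (2 * d) = τ / ((2 * d : ℝ) : ℂ) := by push_cast; rfl
  rw [this, Complex.div_ofReal_im]
  positivity

theorem summable_thetaTerm (hd : 0 < d) (hτ : 0 < τ.im) (z : ℂ) : Summable (thetaTerm d τ z) := by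
  have := (summable_jacobiTheta₂_term_iff (z / 2) (τ / (2 * d))).2 (im_div_two_mul_natCast_pos hd hτ)
  exact this.congr fun n => (thetaTerm_eq_jacobiTheta₂_term hd τ z n).symm

theorem summable_thetaTerm_affine (hd : 0 < d) (hτ : 0 < τ.im) (z : ℂ) (j : ℤ) :
    Summable fun l : ℤ => thetaTerm d τ z (2 * d * l + j) :=
  (summable_thetaTerm hd hτ z).comp_injective (injective_affine (by positivity) j)

/-- Factoring out the l = 0 term leaves a Jacobi theta function of modulus 2dτ, from which
differentiability and the inversion law are inherited. -/
theorem Theta_eq_jacobiTheta₂ (hd : 0 < d) (j : ℤ) (τ z : ℂ) :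
    Theta j d τ z = thetaTerm d τ z j * jacobiTheta₂ (d * z + j * τ) (2 * d * τ) := by
  have hd' : (d : ℂ) ≠ 0 := by exact_mod_cast hd.ne'
  rw [Theta_eq_tsum hd, jacobiTheta₂, ← tsum_mul_left]
  refine tsum_congr fun l => ?_
  rw [thetaTerm, thetaTerm, jacobiTheta₂_term, ← Complex.exp_add]
  congr 1; push_cast; field_simp; ring

theorem differentiable_Theta (hd : 0 < d) (hτ : 0 < τ.im) (j : ℤ) :
    Differentiable ℂ (Theta j d τ) := by
  have h2 : 0 < (2 * (d : ℂ) * τ).im := by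
    have : 2 * (d : ℂ) * τ = ((2 * d : ℝ) : ℂ) * τ := by push_cast; rfl
    rw [this, Complex.im_ofReal_mul]; positivity
  intro z
  have h : Theta j d τ =
      fun z => thetaTerm d τ z j * jacobiTheta₂ (d * z + j * τ) (2 * d * τ) :=
    funext fun z => Theta_eq_jacobiTheta₂ hd j τ z
  rw [h]
  refine DifferentiableAt.mul ?_ ?_
  · unfold thetaTerm; fun_prop
  · exact (differentiableAt_jacobiTheta₂_fst (d * z + j * τ) h2).comp z
      (f := fun z : ℂ => d * z + j * τ) (by fun_prop)

theorem Theta_add_two_mul (hd : 0 < d) (j : ℤ) (τ z : ℂ) :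
    Theta (j + 2 * d) d τ z = Theta j d τ z := by
  rw [Theta_eq_tsum hd, Theta_eq_tsum hd, ← (Equiv.addRight (1 : ℤ)).tsum_eq
    (fun l : ℤ => thetaTerm d τ z (2 * d * l + j))]
  refine tsum_congr fun n => ?_
  congr 1; simp; ring

theorem Theta_neg_right (hd : 0 < d) (j : ℤ) (τ z : ℂ) :
    Theta j d τ (-z) = Theta (-j) d τ z := by
  rw [Theta_eq_tsum hd, Theta_eq_tsum hd, ← (Equiv.neg ℤ).tsum_eq
    (fun l : ℤ => thetaTerm d τ z (2 * d * l + -j))]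
  refine tsum_congr fun n => ?_
  rw [thetaTerm, thetaTerm]
  congr 1; simp; ring

theorem Theta_add_one (hd : 0 < d) (j : ℤ) (τ z : ℂ) :
    Theta j d τ (z + 1) = cexp (π * I * j) * Theta j d τ z := by
  rw [Theta_eq_tsum hd, Theta_eq_tsum hd, ← tsum_mul_left]
  refine tsum_congr fun n => ?_
  rw [thetaTerm, thetaTerm, ← Complex.exp_add]
  refine Complex.exp_eq_exp_iff_exists_int.2 ⟨d * n, ?_⟩
  push_cast; ring

theorem Theta_add_tau (hd : 0 < d) (j : ℤ) (τ z : ℂ) :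
    Theta j d τ (z + τ) =
      cexp (-(π * I * d * τ / 2) - π * I * d * z) * Theta (j + d) d τ z := by
  have hd' : (d : ℂ) ≠ 0 := by exact_mod_cast hd.ne'
  rw [Theta_eq_tsum hd, Theta_eq_tsum hd, ← tsum_mul_left]
  refine tsum_congr fun n => ?_
  rw [thetaTerm, thetaTerm, ← Complex.exp_add]
  congr 1; push_cast; field_simp; ring

theorem Theta_tau_add_one (hd : 0 < d) (j : ℤ) (τ z : ℂ) :
    Theta j d (τ + 1) z = cexp (π * I * (j : ℂ) ^ 2 / (2 * d)) * Theta j d τ z := by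
  have hd' : (d : ℂ) ≠ 0 := by exact_mod_cast hd.ne'
  rw [Theta_eq_tsum hd, Theta_eq_tsum hd, ← tsum_mul_left]
  refine tsum_congr fun n => ?_
  rw [thetaTerm, thetaTerm, ← Complex.exp_add]
  refine Complex.exp_eq_exp_iff_exists_int.2 ⟨d * n ^ 2 + n * j, ?_⟩
  push_cast; field_simp; ring

/-- Poisson summation, in the form of the functional equation of `jacobiTheta₂` at modulus 2dτ,
gives one sum over all integers n. Sorting n mod 2d yields the functions Θ_k with the finite Fourier
coefficients e^{πijk/d}. -/
theorem Theta_S (hd : 0 < d) (hτ : 0 < τ.im) (j : ℤ) (z : ℂ) :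
    Theta j d τ z = 1 / (-I * (2 * d * τ)) ^ (1 / 2 : ℂ) * cexp (-(π * I * d * z ^ 2 / (2 * τ))) *
      ∑ k ∈ Finset.range (2 * d), cexp (π * I * j * k / d) * Theta k d (-1 / τ) (z / τ) := by
  have hd' : (d : ℂ) ≠ 0 := by exact_mod_cast hd.ne'
  have hτ0 : τ ≠ 0 := by rintro rfl; simp at hτ
  have hτ' : 0 < (-1 / τ).im := by
    have := UpperHalfPlane.im_inv_neg_coe_pos ⟨τ, hτ⟩
    simpa [neg_div, inv_neg] using this
  have hs : Summable fun n : ℤ =>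
      cexp (π * I * j * n / d) * thetaTerm d (-1 / τ) (z / τ) n := by
    have h := summable_thetaTerm hd hτ' (z / τ)
    refine Summable.of_norm ?_
    refine h.norm.congr fun n => ?_
    rw [norm_mul]
    have : ‖cexp (π * I * j * n / d)‖ = 1 := by
      rw [show π * I * j * n / d = ((π * j * n / d : ℝ) : ℂ) * I by push_cast; ring]
      exact Complex.norm_exp_ofReal_mul_I _
    rw [this, one_mul]
  have key : jacobiTheta₂ ((d * z + j * τ) / (2 * d * τ)) (-1 / (2 * d * τ)) =
      ∑ k ∈ Finset.range (2 * d), cexp (π * I * j * k / d) * Theta k d (-1 / τ) (z / τ) := by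
    have h1 : jacobiTheta₂ ((d * z + j * τ) / (2 * d * τ)) (-1 / (2 * d * τ)) =
        ∑' n : ℤ, cexp (π * I * j * n / d) * thetaTerm d (-1 / τ) (z / τ) n := by
      refine tsum_congr fun n => ?_
      rw [jacobiTheta₂_term, thetaTerm, ← Complex.exp_add]
      congr 1; field_simp; ring
    rw [h1, tsum_eq_sum_residue (M := 2 * d) (by positivity) hs]
    refine Finset.sum_congr rfl fun k _ => ?_
    rw [Theta_eq_tsum hd, ← tsum_mul_left]
    refine tsum_congr fun n => ?_
    push_cast
    congr 1
    refine Complex.exp_eq_exp_iff_exists_int.2 ⟨j * n, ?_⟩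
    push_cast; field_simp; ring
  rw [Theta_eq_jacobiTheta₂ hd, jacobiTheta₂_functional_equation, key, thetaTerm]
  have : cexp (π * I * j * z + π * I * (j : ℂ) ^ 2 * τ / (2 * d)) *
      cexp (-π * I * (d * z + j * τ) ^ 2 / (2 * d * τ)) = cexp (-(π * I * d * z ^ 2 / (2 * τ))) := by
    rw [← Complex.exp_add]; congr 1; field_simp; ring
  rw [← this]; ring

theorem exists_norm_Theta_le (hd : 0 < d) (τ z : ℂ) : ∃ C, ∀ j : ℤ, ‖Theta j d τ z‖ ≤ C := by
  obtain ⟨C, hC⟩ : ∃ C, ∀ j ∈ Finset.range (2 * d), ‖Theta (j : ℕ) d τ z‖ ≤ C :=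
    ⟨∑ j ∈ Finset.range (2 * d), ‖Theta j d τ z‖, fun j hj =>
      Finset.single_le_sum (f := fun j : ℕ => ‖Theta j d τ z‖) (fun _ _ => norm_nonneg _) hj⟩
  refine ⟨C, fun j => ?_⟩
  have hper : Function.Periodic (fun j : ℤ => Theta j d τ z) (2 * d) :=
    fun j => Theta_add_two_mul hd j τ z
  have h1 : Theta j d τ z = Theta ((j % (2 * d)).toNat : ℤ) d τ z := by
    rw [Int.toNat_of_nonneg (Int.emod_nonneg _ (by positivity)), Int.emod_def]
    have := hper.sub_zsmul_eq (x := j) (j / (2 * d))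
    simp only [smul_eq_mul] at this
    rw [← this]; congr 1; ring
  rw [h1]
  refine hC _ (Finset.mem_range.2 ?_)
  have := Int.emod_lt_of_pos j (b := 2 * d) (by positivity)
  omega

end

section

/-! ### The error function `E` -/

theorem integrable_gaussian_pi : MeasureTheory.Integrable fun u : ℝ => Real.exp (-π * u ^ 2) :=
  integrable_exp_neg_mul_sq Real.pi_pos

theorem hasDerivAt_Efun (x : ℝ) : HasDerivAt Efun (2 * Real.exp (-π * x ^ 2)) x := by
  have hc : Continuous fun u : ℝ => Real.exp (-π * u ^ 2) := by fun_prop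
  exact (hc.integral_hasStrictDerivAt 0 x).hasDerivAt.const_mul 2

theorem Efun_neg (x : ℝ) : Efun (-x) = -Efun x := by
  have h : (∫ u in (0 : ℝ)..(-x), Real.exp (-π * u ^ 2)) =
      -∫ u in (0 : ℝ)..x, Real.exp (-π * u ^ 2) := by
    have := intervalIntegral.integral_comp_neg (a := 0) (b := x)
      (fun u : ℝ => Real.exp (-π * u ^ 2))
    simp only [neg_sq, neg_zero] at this
    rw [this, intervalIntegral.integral_symm]
  rw [Efun, Efun, h]; ring

/-- The half-line Gaussian integral is 1/2, so this is twice the Gaussian tail beyond x. -/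
theorem one_sub_Efun_eq (x : ℝ) :
    1 - Efun x = 2 * ∫ u in Set.Ioi (0 : ℝ), Real.exp (-π * (u + x) ^ 2) := by
  have h1 : (∫ u in Set.Ioi (0 : ℝ), Real.exp (-π * (u + x) ^ 2)) =
      ∫ u in Set.Ioi x, Real.exp (-π * u ^ 2) := by
    have := (MeasureTheory.measurePreserving_add_right MeasureTheory.volume x).setIntegral_preimage_emb
      (measurableEmbedding_addRight x) (fun u : ℝ => Real.exp (-π * u ^ 2)) (Set.Ioi x)
    simpa using this
  have h2 : (∫ u in Set.Ioi (0 : ℝ), Real.exp (-π * u ^ 2)) = 1 / 2 := by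
    rw [integral_gaussian_Ioi, div_self Real.pi_pos.ne', Real.sqrt_one]
  have h3 := intervalIntegral.integral_interval_add_Ioi
    (integrable_gaussian_pi.integrableOn (s := Set.Ioi 0))
    (integrable_gaussian_pi.integrableOn (s := Set.Ioi x))
  rw [h2] at h3
  rw [h1, Efun]; linarith

theorem one_sub_Efun_nonneg (x : ℝ) : 0 ≤ 1 - Efun x := by
  rw [one_sub_Efun_eq]
  have : 0 ≤ ∫ u in Set.Ioi (0 : ℝ), Real.exp (-π * (u + x) ^ 2) :=
    MeasureTheory.integral_nonneg fun u => (Real.exp_pos _).le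
  positivity

theorem one_sub_Efun_le {x : ℝ} (hx : 0 ≤ x) : 1 - Efun x ≤ Real.exp (-π * x ^ 2) := by
  rw [one_sub_Efun_eq]
  have h2 : (∫ u in Set.Ioi (0 : ℝ), Real.exp (-π * u ^ 2)) = 1 / 2 := by
    rw [integral_gaussian_Ioi, div_self Real.pi_pos.ne', Real.sqrt_one]
  have h : (∫ u in Set.Ioi (0 : ℝ), Real.exp (-π * (u + x) ^ 2)) ≤
      ∫ u in Set.Ioi (0 : ℝ), Real.exp (-π * x ^ 2) * Real.exp (-π * u ^ 2) := by
    refine MeasureTheory.setIntegral_mono_on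
      ((integrable_gaussian_pi.comp_add_right x).integrableOn)
      ((integrable_gaussian_pi.const_mul _).integrableOn) measurableSet_Ioi fun u hu => ?_
    rw [← Real.exp_add]
    -- For u, x ≥ 0 one has (u + x)² ≥ u² + x².
    refine Real.exp_le_exp.2 ?_
    have hu' : 0 < u := hu
    nlinarith [mul_nonneg (mul_nonneg Real.pi_pos.le hu'.le) hx]
  rw [MeasureTheory.integral_const_mul, h2] at h
  linarith

theorem abs_one_sub_Efun_le_two (x : ℝ) : |1 - Efun x| ≤ 2 := by
  have h1 := one_sub_Efun_nonneg x
  have h2 := one_sub_Efun_nonneg (-x)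
  rw [Efun_neg] at h2
  rw [abs_le]; constructor <;> linarith

/-- Gaussian decay persists when x is only bounded below: on [-X, 0] the trivial bound 2 is absorbed
by the factor e^{πX²}. -/
theorem abs_one_sub_Efun_le {x X : ℝ} (hx : -X ≤ x) (hX : 0 ≤ X) :
    |1 - Efun x| ≤ 2 * Real.exp (π * X ^ 2) * Real.exp (-π * x ^ 2) := by
  rcases le_or_gt 0 x with h | h
  · rw [abs_of_nonneg (one_sub_Efun_nonneg x)]
    refine (one_sub_Efun_le h).trans ?_
    have : 1 ≤ Real.exp (π * X ^ 2) := Real.one_le_exp (by positivity)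
    nlinarith [Real.exp_pos (-π * x ^ 2)]
  · refine (abs_one_sub_Efun_le_two x).trans ?_
    rw [mul_assoc, ← Real.exp_add]
    have hsq : x ^ 2 ≤ X ^ 2 := by nlinarith
    have : 1 ≤ Real.exp (π * X ^ 2 + -π * x ^ 2) :=
      Real.one_le_exp (by nlinarith [Real.pi_pos])
    linarith

theorem abs_neg_one_sub_Efun_le {x X : ℝ} (hx : x ≤ X) (hX : 0 ≤ X) :
    |-1 - Efun x| ≤ 2 * Real.exp (π * X ^ 2) * Real.exp (-π * x ^ 2) := by
  have h := abs_one_sub_Efun_le (x := -x) (X := X) (by linarith) hX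
  rw [Efun_neg, neg_sq] at h
  rw [show -1 - Efun x = -(1 - -Efun x) by ring, abs_neg]
  exact h

/-! ### Zwegers' function -/

variable {d : ℕ} {τ : ℂ}

/-- The argument of `E` in the summands of Zwegers' function. -/
def errArg (d : ℕ) (τ v : ℂ) (n : ℤ) : ℝ := ((n : ℝ) + 2 * d * (v.im / τ.im)) * √(τ.im / d)

/-- The sign in the summand of `R_{j;d}` with index `n = 2 d l - j`. -/
def indexSign (l : ℤ) : ℝ := if 1 ≤ l then 1 else -1

/-- The exponential in the summands of Zwegers' function. -/
def errExp (d : ℕ) (τ v : ℂ) (n : ℤ) : ℂ :=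
  cexp (-(π * I * (n : ℂ) ^ 2 / (2 * d) * τ) - 2 * π * I * n * v)

/-- At n = 2dl - j the argument of sgn is 2d(l - 1) + 1/2, which is never 0 and is positive exactly
for l ≥ 1. So the sign depends on l alone. -/
theorem RTerm_eq (hd : 0 < d) (j : ℤ) (τ v : ℂ) (l : ℤ) :
    RTerm j d τ v (2 * d * l - j) =
      ((indexSign l - Efun (errArg d τ v (2 * d * l - j)) : ℝ) : ℂ) *
        errExp d τ v (2 * d * l - j) := by
  rw [RTerm, errExp, errArg]
  congr 4
  have hd' : (1 : ℝ) ≤ d := by exact_mod_cast hd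
  push_cast
  rw [indexSign]
  split_ifs with h
  · have : (1 : ℝ) ≤ l := by exact_mod_cast h
    refine Real.sign_of_pos ?_
    nlinarith
  · have : (l : ℝ) ≤ 0 := by exact_mod_cast (by omega : l ≤ 0)
    refine Real.sign_of_neg ?_
    nlinarith

/-- The exponential in R grows like e^{πn² Im τ/(2d)}, while the Gaussian decays at twice that rate.
Expanding the square leaves a convergent theta term and a factor depending only on Im v. -/
theorem norm_exp_gaussian (hd : 0 < d) (hτ : 0 < τ.im) (v : ℂ) (n : ℤ) :
    Real.exp (-π * errArg d τ v n ^ 2) * ‖errExp d τ v n‖ =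
      Real.exp (-(4 * π * d * v.im ^ 2 / τ.im)) * ‖jacobiTheta₂_term n v (τ / (2 * d))‖ := by
  have hd' : (d : ℝ) ≠ 0 := by exact_mod_cast hd.ne'
  rw [norm_jacobiTheta₂_term, errExp, Complex.norm_exp, ← Real.exp_add, ← Real.exp_add, errArg,
    mul_pow, Real.sq_sqrt (by positivity)]
  congr 1
  have h1 : (-(π * I * (n : ℂ) ^ 2 / (2 * d) * τ) - 2 * π * I * n * v).re =
      π * n ^ 2 / (2 * d) * τ.im + 2 * π * n * v.im := by
    have : -(π * I * (n : ℂ) ^ 2 / (2 * d) * τ) - 2 * π * I * n * v =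
      -(((π * n ^ 2 / (2 * d) : ℝ) : ℂ) * (I * τ)) - ((2 * π * n : ℝ) : ℂ) * (I * v) := by
      push_cast; ring
    rw [this]
    simp only [Complex.sub_re, Complex.neg_re, Complex.re_ofReal_mul, Complex.I_mul_re]
    ring
  have h2 : (τ / (2 * d)).im = τ.im / (2 * d) := by
    have : τ / (2 * d) = τ / ((2 * d : ℝ) : ℂ) := by push_cast; rfl
    rw [this, Complex.div_ofReal_im]
  rw [h1, h2]
  field_simp
  ring

/-- The Gaussian trades τ and v for their conjugates in the exponent. This is why ∂̄R is a Gaussian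
times an antiholomorphic theta function. -/
theorem gaussian_mul_errExp (hd : 0 < d) (hτ : 0 < τ.im) (v : ℂ) (n : ℤ) :
    (Real.exp (-π * errArg d τ v n ^ 2) : ℂ) * errExp d τ v n =
      (Real.exp (-(4 * π * d * v.im ^ 2 / τ.im)) : ℂ) *
        (starRingEnd ℂ) (thetaTerm d τ (2 * v) n) := by
  have hd' : (d : ℝ) ≠ 0 := by exact_mod_cast hd.ne'
  have hdc : (d : ℂ) ≠ 0 := by exact_mod_cast hd.ne'
  have hτc : (τ.im : ℂ) ≠ 0 := by exact_mod_cast hτ.ne'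
  rw [thetaTerm, ← Complex.exp_conj, errExp, Complex.ofReal_exp, Complex.ofReal_exp,
    ← Complex.exp_add, ← Complex.exp_add, errArg, mul_pow, Real.sq_sqrt (by positivity)]
  congr 1
  have hv : (starRingEnd ℂ) v = v - 2 * I * v.im := by
    apply Complex.ext <;> simp; ring
  have ht : (starRingEnd ℂ) τ = τ - 2 * I * τ.im := by
    apply Complex.ext <;> simp; ring
  simp only [map_add, map_mul, map_div₀, map_pow, Complex.conj_ofReal, Complex.conj_I, map_ofNat,
    map_natCast, map_intCast, hv, ht]
  push_cast
  field_simp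
  ring_nf
  simp only [Complex.I_sq]
  ring

/-- The argument of E can have the sign opposite to `indexSign` only within [-X, X], where X is
uniform on the strip |Im v| ≤ B. Hence every term has the Gaussian bound, with one constant. -/
theorem abs_indexSign_sub_Efun_le (hd : 0 < d) (hτ : 0 < τ.im) (j : ℤ) (B : ℝ) :
    ∃ C, 0 ≤ C ∧ ∀ v : ℂ, |v.im| ≤ B → ∀ l : ℤ,
      |indexSign l - Efun (errArg d τ v (2 * d * l - j))| ≤
        C * Real.exp (-π * errArg d τ v (2 * d * l - j) ^ 2) := by
  set X : ℝ := (|(j : ℝ)| + 2 * d * (|B| / τ.im)) * √(τ.im / d) with hX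
  have hX0 : 0 ≤ X := by positivity
  refine ⟨2 * Real.exp (π * X ^ 2), by positivity, fun v hv l => ?_⟩
  have hv2 : |v.im / τ.im| ≤ |B| / τ.im := by
    rw [abs_div, abs_of_pos hτ]
    exact div_le_div_of_nonneg_right (hv.trans (le_abs_self B)) hτ.le
  have hd0 : (0 : ℝ) < d := by exact_mod_cast hd
  obtain ⟨hv3, hv4⟩ := abs_le.1 hv2
  obtain ⟨hj1, hj2⟩ := abs_le.1 (le_refl |(j : ℝ)|)
  have hs : 0 ≤ √(τ.im / d) := Real.sqrt_nonneg _
  rw [indexSign]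
  split_ifs with h
  · refine abs_one_sub_Efun_le ?_ hX0
    have : (1 : ℝ) ≤ l := by exact_mod_cast h
    rw [errArg, hX, ← neg_mul]
    refine mul_le_mul_of_nonneg_right ?_ hs
    push_cast
    nlinarith
  · refine abs_neg_one_sub_Efun_le ?_ hX0
    have : (l : ℝ) ≤ 0 := by exact_mod_cast (by omega : l ≤ 0)
    rw [errArg, hX]
    refine mul_le_mul_of_nonneg_right ?_ hs
    push_cast
    nlinarith

theorem gaussian_mul_norm_errExp_le (hd : 0 < d) (hτ : 0 < τ.im) {B : ℝ} {v : ℂ}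
    (hv : |v.im| ≤ B) (n : ℤ) :
    Real.exp (-π * errArg d τ v n ^ 2) * ‖errExp d τ v n‖ ≤
      Real.exp (-π * (τ.im / (2 * d) * n ^ 2 - 2 * B * |n|)) := by
  have h2 : (τ / (2 * d)).im = τ.im / (2 * d) := by
    have : τ / (2 * d) = τ / ((2 * d : ℝ) : ℂ) := by push_cast; rfl
    rw [this, Complex.div_ofReal_im]
  rw [norm_exp_gaussian hd hτ]
  refine (mul_le_of_le_one_left (norm_nonneg _) ?_).trans
    (norm_jacobiTheta₂_term_le (by positivity) hv h2.ge n)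
  rw [Real.exp_le_one_iff, neg_nonpos]
  positivity

/-- Summable majorants for the derivatives of the summands of Zwegers' function. -/
theorem summable_majorant (hd : 0 < d) (hτ : 0 < τ.im) (j : ℤ) (B : ℝ) (k : ℕ) :
    Summable fun l : ℤ => (|((2 * d * l - j : ℤ) : ℝ)| ^ k *
      Real.exp (-π * (τ.im / (2 * d) * ((2 * d * l - j : ℤ) : ℝ) ^ 2 -
        2 * B * |((2 * d * l - j : ℤ) : ℝ)|))) := by
  have h := summable_pow_mul_jacobiTheta₂_term_bound B (T := τ.im / (2 * d)) (by positivity) k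
  have := h.comp_injective (injective_affine (M := 2 * d) (by positivity) (-j))
  refine this.congr fun l => ?_
  simp only [Function.comp]
  push_cast
  rfl

theorem summable_RTerm (hd : 0 < d) (hτ : 0 < τ.im) (j : ℤ) (v : ℂ) :
    Summable fun l : ℤ => RTerm j d τ v (2 * d * l - j) := by
  obtain ⟨C, hC0, hC⟩ := abs_indexSign_sub_Efun_le hd hτ j |v.im|
  refine Summable.of_norm_bounded ((summable_majorant hd hτ j |v.im| 0).mul_left C) fun l => ?_
  rw [RTerm_eq hd, norm_mul, Complex.norm_real, Real.norm_eq_abs, pow_zero, one_mul]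
  refine (mul_le_mul_of_nonneg_right (hC v le_rfl l) (norm_nonneg _)).trans ?_
  rw [mul_assoc]
  refine mul_le_mul_of_nonneg_left ?_ hC0
  have := gaussian_mul_norm_errExp_le hd hτ (le_refl |v.im|) (2 * d * l - j)
  simpa using this

/-- Both series run over the same n ≡ -j mod 2d with the same E. The signs differ only at n = -j,
where they are -1 and +1. -/
theorem RZwegers_sub_add_two_mul (hd : 0 < d) (hτ : 0 < τ.im) (j : ℤ) (v : ℂ) :
    RZwegers j d τ v - RZwegers (j + 2 * d) d τ v =
      -2 * cexp (-(π * I * (j : ℂ) ^ 2 * τ / (2 * d)) + 2 * π * I * j * v) := by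
  have h2 : RZwegers (j + 2 * d) d τ v =
      ∑' l : ℤ, RTerm (j + 2 * d) d τ v (2 * d * (l + 1) - (j + 2 * d)) :=
    ((Equiv.addRight (1 : ℤ)).tsum_eq
      (fun l : ℤ => RTerm (j + 2 * d) d τ v (2 * d * l - (j + 2 * d)))).symm
  have hs2 : Summable fun l : ℤ => RTerm (j + 2 * d) d τ v (2 * d * (l + 1) - (j + 2 * d)) :=
    (Equiv.addRight (1 : ℤ)).summable_iff.2 (summable_RTerm hd hτ (j + 2 * d) v)
  rw [h2, RZwegers, ← (summable_RTerm hd hτ j v).tsum_sub hs2, tsum_eq_single 0]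
  · rw [RTerm_eq hd, RTerm_eq hd, show (2 * d * (0 + 1) - (j + 2 * d) : ℤ) = 2 * d * 0 - j by ring,
      ← sub_mul, ← Complex.ofReal_sub]
    simp only [indexSign, errExp]
    norm_num
    congr 1; ring
  · intro l hl
    rw [RTerm_eq hd, RTerm_eq hd, show (2 * d * (l + 1) - (j + 2 * d) : ℤ) = 2 * d * l - j by ring,
      ← sub_mul, ← Complex.ofReal_sub]
    have : indexSign l = indexSign (l + 1) := by
      simp only [indexSign]
      split_ifs <;> first | rfl | omega
    rw [this]; simp

/-- The index moves by -d here and by +d for Θ under z ↦ z + τ. These agree mod 2d, the period of Θ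
in its index, so products RΘ transform coherently. -/
theorem RZwegers_add_half_tau (hd : 0 < d) (hτ : 0 < τ.im) (j : ℤ) (v : ℂ) :
    RZwegers j d τ (v + τ / 2) =
      cexp (π * I * d * τ / 2 + 2 * π * I * d * v) * RZwegers (j - d) d τ v := by
  have hdc : (d : ℂ) ≠ 0 := by exact_mod_cast hd.ne'
  have hd' : (d : ℝ) ≠ 0 := by exact_mod_cast hd.ne'
  rw [RZwegers, RZwegers, ← tsum_mul_left]
  refine tsum_congr fun l => ?_
  rw [RTerm_eq hd, RTerm_eq hd, mul_left_comm]
  congr 1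
  · congr 3
    have h2 : (v + τ / 2).im = v.im + τ.im / 2 := by
      have : τ / 2 = τ / ((2 : ℝ) : ℂ) := by push_cast; rfl
      rw [Complex.add_im, this, Complex.div_ofReal_im]
    rw [errArg, errArg, h2]
    push_cast
    field_simp
    ring
  · rw [errExp, errExp, ← Complex.exp_add]
    congr 1; push_cast; field_simp; ring

theorem RZwegers_add_half (hd : 0 < d) (j : ℤ) (τ v : ℂ) :
    RZwegers j d τ (v + 1 / 2) = cexp (π * I * j) * RZwegers j d τ v := by
  rw [RZwegers, RZwegers, ← tsum_mul_left]
  refine tsum_congr fun l => ?_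
  rw [RTerm_eq hd, RTerm_eq hd, mul_left_comm]
  congr 1
  · congr 3
    have h2 : (v + 1 / 2).im = v.im := by
      have : (1 / 2 : ℂ) = ((1 / 2 : ℝ) : ℂ) := by push_cast; rfl
      rw [Complex.add_im, this, Complex.ofReal_im, add_zero]
    rw [errArg, errArg, h2]
  · rw [errExp, errExp, ← Complex.exp_add]
    refine Complex.exp_eq_exp_iff_exists_int.2 ⟨-(d * l), ?_⟩
    push_cast; ring

theorem RZwegers_tau_add_one (hd : 0 < d) (j : ℤ) (τ v : ℂ) :
    RZwegers j d (τ + 1) v = cexp (-(π * I * (j : ℂ) ^ 2 / (2 * d))) * RZwegers j d τ v := by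
  have hdc : (d : ℂ) ≠ 0 := by exact_mod_cast hd.ne'
  rw [RZwegers, RZwegers, ← tsum_mul_left]
  refine tsum_congr fun l => ?_
  rw [RTerm_eq hd, RTerm_eq hd, mul_left_comm]
  congr 1
  · congr 3
    simp [errArg]
  · rw [errExp, errExp, ← Complex.exp_add]
    refine Complex.exp_eq_exp_iff_exists_int.2 ⟨-(d * l ^ 2) + l * j, ?_⟩
    push_cast; field_simp; ring

end

section

/-! ### Wirtinger derivatives -/

/-- The real-linear map `w ↦ a w + b conj w`. -/
def wirtingerMap (a b : ℂ) : ℂ →L[ℝ] ℂ :=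
  a • ContinuousLinearMap.id ℝ ℂ + b • (Complex.conjCLE : ℂ →L[ℝ] ℂ)

/-- `f` is real differentiable at `v` with `∂f = a` and `∂̄f = b`. -/
def HasWirtinger (f : ℂ → ℂ) (a b v : ℂ) : Prop := HasFDerivAt (𝕜 := ℝ) f (wirtingerMap a b) v

/-- `f` is real differentiable at `v` with `∂̄f = b`. -/
def HasDbar (f : ℂ → ℂ) (b v : ℂ) : Prop := ∃ a, HasWirtinger f a b v

@[simp] theorem wirtingerMap_apply (a b w : ℂ) : wirtingerMap a b w = a * w + b * conj w := by
  simp [wirtingerMap]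

theorem norm_wirtingerMap_le (a b : ℂ) : ‖wirtingerMap a b‖ ≤ ‖a‖ + ‖b‖ := by
  refine ContinuousLinearMap.opNorm_le_bound _ (by positivity) fun w => ?_
  rw [wirtingerMap_apply, add_mul]
  refine (norm_add_le _ _).trans ?_
  simp

theorem HasDbar.continuousAt {f : ℂ → ℂ} {b v : ℂ} (h : HasDbar f b v) : ContinuousAt f v := by
  obtain ⟨a, h⟩ := h
  exact HasFDerivAt.continuousAt h

theorem _root_.HasDerivAt.hasWirtinger {f : ℂ → ℂ} {a v : ℂ} (h : HasDerivAt f a v) :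
    HasWirtinger f a 0 v := by
  have := h.hasFDerivAt.restrictScalars ℝ
  refine this.congr_fderiv ?_
  ext; simp [mul_comm]

theorem _root_.DifferentiableAt.hasDbar {f : ℂ → ℂ} {v : ℂ} (h : DifferentiableAt ℂ f v) :
    HasDbar f 0 v := ⟨_, h.hasDerivAt.hasWirtinger⟩

theorem HasDbar.differentiableAt {f : ℂ → ℂ} {v : ℂ} (h : HasDbar f 0 v) :
    DifferentiableAt ℂ f v := by
  obtain ⟨a, h⟩ := h
  have h' : HasFDerivAt (𝕜 := ℂ) f (ContinuousLinearMap.toSpanSingleton ℂ a) v := by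
    refine hasFDerivAt_of_restrictScalars ℝ h ?_
    ext; simp [mul_comm]
  exact h'.differentiableAt

theorem HasDbar.add {f g : ℂ → ℂ} {b c v : ℂ} (hf : HasDbar f b v) (hg : HasDbar g c v) :
    HasDbar (fun v => f v + g v) (b + c) v := by
  obtain ⟨a, hf⟩ := hf
  obtain ⟨a', hg⟩ := hg
  refine ⟨a + a', (HasFDerivAt.add hf hg).congr_fderiv ?_⟩
  ext; simp; ring

theorem HasDbar.mul_differentiableAt {f g : ℂ → ℂ} {b v : ℂ} (hf : HasDbar f b v)
    (hg : DifferentiableAt ℂ g v) : HasDbar (fun v => g v * f v) (g v * b) v := by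
  obtain ⟨a, hf⟩ := hf
  have h2 := hg.hasDerivAt.hasWirtinger
  refine ⟨g v * a + f v * deriv g v, (HasFDerivAt.mul h2 hf).congr_fderiv ?_⟩
  ext; simp; ring

theorem HasDbar.const_mul {f : ℂ → ℂ} {b v : ℂ} (hf : HasDbar f b v) (c : ℂ) :
    HasDbar (fun v => c * f v) (c * b) v :=
  hf.mul_differentiableAt (g := fun _ => c) (by fun_prop)

theorem HasDbar.sub {f g : ℂ → ℂ} {b c v : ℂ} (hf : HasDbar f b v) (hg : HasDbar g c v) :
    HasDbar (fun v => f v - g v) (b - c) v := by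
  have := hf.add (hg.const_mul (-1))
  simpa [sub_eq_add_neg] using this

theorem HasDbar.sum {ι : Type*} (s : Finset ι) {f : ι → ℂ → ℂ} {b : ι → ℂ} {v : ℂ}
    (h : ∀ i ∈ s, HasDbar (f i) (b i) v) :
    HasDbar (fun v => ∑ i ∈ s, f i v) (∑ i ∈ s, b i) v := by
  classical
  induction s using Finset.induction_on with
  | empty => simpa using (differentiableAt_const (0 : ℂ)).hasDbar (v := v)
  | insert i s hi ih =>
    simp only [Finset.sum_insert hi]
    exact (h i (Finset.mem_insert_self i s)).add
      (ih fun k hk => h k (Finset.mem_insert_of_mem hk))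

/-- The antilinear part of the derivative sees the conjugate of the slope. This produces the factors
conj(1/τ) and conj(1/M) in the kernel identities. -/
theorem HasDbar.comp_affine {f : ℂ → ℂ} {b v : ℂ} (c e : ℂ) (h : HasDbar f b (c * v + e)) :
    HasDbar (fun v => f (c * v + e)) (conj c * b) v := by
  obtain ⟨a, h⟩ := h
  have h2 : HasWirtinger (fun v => c * v + e) c 0 v := by
    refine HasDerivAt.hasWirtinger ?_
    simpa using ((hasDerivAt_id v).const_mul c).add_const e
  refine ⟨a * c, (HasFDerivAt.comp (g := f) (f := fun v => c * v + e) v h h2).congr_fderiv ?_⟩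
  ext; simp; ring

/-! ### The Wirtinger derivative of Zwegers' function -/

variable {d : ℕ} {τ : ℂ}

/-- Since Im v = (v - conj v)/(2i), its derivatives are ∂ Im v = -i/2 and ∂̄ Im v = i/2. -/
theorem hasWirtinger_ofReal_im {g : ℝ → ℝ} {g' : ℝ} {v : ℂ} (hg : HasDerivAt g g' v.im) :
    HasWirtinger (fun v => (g v.im : ℂ)) (-(I / 2) * g') (I / 2 * g') v := by
  have h1 : HasFDerivAt (𝕜 := ℝ) (fun v : ℂ => v.im) Complex.imCLM v :=
    Complex.imCLM.hasFDerivAt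
  have h2 := hg.comp_hasFDerivAt v h1
  have h3 := (Complex.ofRealCLM.hasFDerivAt (x := g v.im)).comp v h2
  refine h3.congr_fderiv ?_
  apply ContinuousLinearMap.ext
  intro w
  have : (ofRealCLM.comp (g' • imCLM)) w = ((g' * w.im : ℝ) : ℂ) := rfl
  rw [this, wirtingerMap_apply]
  apply Complex.ext <;> simp
  ring

/-- The `∂̄`-derivative of the summands of Zwegers' function. -/
def dbarTerm (d : ℕ) (τ v : ℂ) (n : ℤ) : ℂ :=
  -(2 * I * √(d / τ.im)) * ((Real.exp (-π * errArg d τ v n ^ 2) : ℂ) * errExp d τ v n)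

/-- The `∂`-derivative of the summands of Zwegers' function. -/
def delTerm (j : ℤ) (d : ℕ) (τ v : ℂ) (l : ℤ) : ℂ :=
  -dbarTerm d τ v (2 * d * l - j) +
    ((indexSign l - Efun (errArg d τ v (2 * d * l - j)) : ℝ) : ℂ) *
      (errExp d τ v (2 * d * l - j) * (-(2 * π * I * (2 * d * l - j : ℤ))))

/-- The sign is constant and the exponential is holomorphic in v, so ∂̄ acts only on E, whose
derivative is a Gaussian. -/
theorem hasWirtinger_RTerm (hd : 0 < d) (hτ : 0 < τ.im) (j : ℤ) (l : ℤ) (v : ℂ) :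
    HasWirtinger (fun v => RTerm j d τ v (2 * d * l - j)) (delTerm j d τ v l)
      (dbarTerm d τ v (2 * d * l - j)) v := by
  have hd' : (d : ℝ) ≠ 0 := by exact_mod_cast hd.ne'
  have hfun : (fun v => RTerm j d τ v (2 * d * l - j)) = fun v =>
      ((indexSign l - Efun (errArg d τ v (2 * d * l - j)) : ℝ) : ℂ) *
        errExp d τ v (2 * d * l - j) := funext fun v => RTerm_eq hd j τ v l
  rw [hfun]
  set n : ℤ := 2 * d * l - j with hn
  have h1 : HasDerivAt (fun y : ℝ => indexSign l - Efun (((n : ℝ) + 2 * d * (y / τ.im)) * √(τ.im / d)))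
      (-(2 * Real.exp (-π * errArg d τ v n ^ 2) * ((2 * d * (1 / τ.im)) * √(τ.im / d)))) v.im := by
    refine HasDerivAt.const_sub _ ?_
    refine (hasDerivAt_Efun _).comp v.im (h₂ := Efun) ?_
    exact ((((hasDerivAt_id v.im).div_const τ.im).const_mul (2 * (d : ℝ))).const_add
      (n : ℝ)).mul_const _
  have h2 := hasWirtinger_ofReal_im h1
  have h3 : HasDerivAt (fun v => errExp d τ v n) (errExp d τ v n * (-(2 * π * I * n))) v := by
    unfold errExp
    refine HasDerivAt.cexp ?_
    refine HasDerivAt.const_sub _ ?_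
    simpa using (hasDerivAt_id v).const_mul (2 * π * I * (n : ℂ))
  have hsq : 2 * d * (1 / τ.im) * √(τ.im / d) = 2 * √(d / τ.im) := by
    have : √(τ.im / d) = (τ.im / d) * √(d / τ.im) := by
      rw [Real.sqrt_div hτ.le, Real.sqrt_div (by positivity)]
      have e1 := Real.sq_sqrt hτ.le
      have e2 := Real.sq_sqrt (Nat.cast_nonneg d : (0 : ℝ) ≤ d)
      have hs1 : √τ.im ≠ 0 := (Real.sqrt_pos.2 hτ).ne'
      have hs2 : √(d : ℝ) ≠ 0 := (Real.sqrt_pos.2 (by positivity)).ne'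
      field_simp
      rw [e1, e2, mul_comm]
    rw [this]; field_simp
  refine (HasFDerivAt.mul h2 h3.hasWirtinger).congr_fderiv ?_
  rw [hsq]
  apply ContinuousLinearMap.ext
  intro w
  simp only [add_apply, smul_apply, wirtingerMap_apply,
    delTerm, dbarTerm, ← hn, errArg]
  push_cast
  simp only [smul_eq_mul]
  ring

/-- Termwise differentiation on the unit ball around v, where |Im w| ≤ |Im v| + 1 makes the
majorants uniform. Differentiating the exponential costs one factor n, hence the majorant with
exponent 1. -/
theorem RZwegers_hasWirtinger_aux (hd : 0 < d) (hτ : 0 < τ.im) (j : ℤ) (v : ℂ) :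
    Summable (delTerm j d τ v) ∧ (Summable fun l : ℤ => dbarTerm d τ v (2 * d * l - j)) ∧
    HasFDerivAt (𝕜 := ℝ) (RZwegers j d τ)
      (∑' l : ℤ, wirtingerMap (delTerm j d τ v l) (dbarTerm d τ v (2 * d * l - j))) v := by
  set B : ℝ := |v.im| + 1 with hB
  obtain ⟨C, hC0, hC⟩ := abs_indexSign_sub_Efun_le hd hτ j B
  set c : ℝ := 2 * √(d / τ.im) with hc
  have hc0 : 0 ≤ c := by positivity
  have hdb : ∀ w : ℂ, |w.im| ≤ B → ∀ l : ℤ, ‖dbarTerm d τ w (2 * d * l - j)‖ ≤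
      c * (|((2 * d * l - j : ℤ) : ℝ)| ^ 0 *
      Real.exp (-π * (τ.im / (2 * d) * ((2 * d * l - j : ℤ) : ℝ) ^ 2 -
        2 * B * |((2 * d * l - j : ℤ) : ℝ)|))) := by
    intro w hw l
    have h := gaussian_mul_norm_errExp_le hd hτ hw (2 * d * l - j)
    have hn : ‖dbarTerm d τ w (2 * d * l - j)‖ = c *
        (Real.exp (-π * errArg d τ w (2 * d * l - j) ^ 2) * ‖errExp d τ w (2 * d * l - j)‖) := by
      rw [dbarTerm, norm_mul, norm_mul, Complex.norm_real, Real.norm_of_nonneg (Real.exp_pos _).le,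
        norm_neg, norm_mul, norm_mul, Complex.norm_real, Complex.norm_I,
        Real.norm_of_nonneg (Real.sqrt_nonneg _), hc]
      simp
    rw [hn, pow_zero, one_mul]
    refine mul_le_mul_of_nonneg_left ?_ hc0
    simpa using h
  have hdel : ∀ w : ℂ, |w.im| ≤ B → ∀ l : ℤ, ‖delTerm j d τ w l‖ ≤
      c * (|((2 * d * l - j : ℤ) : ℝ)| ^ 0 *
      Real.exp (-π * (τ.im / (2 * d) * ((2 * d * l - j : ℤ) : ℝ) ^ 2 -
        2 * B * |((2 * d * l - j : ℤ) : ℝ)|))) + C * (2 * π) * (|((2 * d * l - j : ℤ) : ℝ)| ^ 1 *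
      Real.exp (-π * (τ.im / (2 * d) * ((2 * d * l - j : ℤ) : ℝ) ^ 2 -
        2 * B * |((2 * d * l - j : ℤ) : ℝ)|))) := by
    intro w hw l
    rw [delTerm]
    refine (norm_add_le _ _).trans (add_le_add ?_ ?_)
    · rw [norm_neg]; exact hdb w hw l
    · have h := gaussian_mul_norm_errExp_le hd hτ hw (2 * d * l - j)
      have hnn : ‖-(2 * π * I * ((2 * d * l - j : ℤ) : ℂ))‖ =
          2 * π * |((2 * d * l - j : ℤ) : ℝ)| := by
        rw [norm_neg, norm_mul, norm_mul, norm_mul, Complex.norm_I, Complex.norm_intCast,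
          Complex.norm_real, Real.norm_of_nonneg Real.pi_pos.le]
        simp
      rw [norm_mul, norm_mul, hnn, Complex.norm_real, Real.norm_eq_abs, pow_one]
      have h2 := hC w hw l
      set A := |indexSign l - Efun (errArg d τ w (2 * d * l - j))|
      set N := |((2 * d * l - j : ℤ) : ℝ)| with hN
      set e := ‖errExp d τ w (2 * d * l - j)‖
      set g := Real.exp (-π * errArg d τ w (2 * d * l - j) ^ 2)
      have he : 0 ≤ e := norm_nonneg _
      have hN0 : 0 ≤ N := abs_nonneg _
      calc A * (e * (2 * π * N)) ≤ (C * g) * (e * (2 * π * N)) := by gcongr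
        _ = C * (2 * π) * N * (g * e) := by ring
        _ ≤ C * (2 * π) * N * _ := mul_le_mul_of_nonneg_left h (by positivity)
        _ = _ := by rw [hN]; push_cast; ring
  have hs0 := (summable_majorant hd hτ j B 0).mul_left c
  have hs1 := (summable_majorant hd hτ j B 1).mul_left (C * (2 * π))
  have hvB : |v.im| ≤ B := by rw [hB]; linarith
  refine ⟨Summable.of_norm_bounded (hs0.add hs1) (hdel v hvB),
    Summable.of_norm_bounded hs0 (hdb v hvB), ?_⟩
  have himball : ∀ w ∈ Metric.ball v 1, |w.im| ≤ B := by
    intro w hw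
    have h1 : |(w - v).im| ≤ ‖w - v‖ := Complex.abs_im_le_norm _
    rw [Metric.mem_ball, dist_eq_norm] at hw
    rw [Complex.sub_im] at h1
    have := abs_sub_abs_le_abs_sub w.im v.im
    rw [hB]; linarith
  exact hasFDerivAt_tsum_of_isPreconnected ((hs0.add hs1).add hs0) Metric.isOpen_ball
    (convex_ball v 1).isPreconnected
    (fun l w _ => hasWirtinger_RTerm hd hτ j l w)
    (fun l w hw => (norm_wirtingerMap_le _ _).trans
      (add_le_add (hdel w (himball w hw) l) (hdb w (himball w hw) l)))
    (Metric.mem_ball_self one_pos) (summable_RTerm hd hτ j v) (Metric.mem_ball_self one_pos)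

theorem hasDbar_RZwegers (hd : 0 < d) (hτ : 0 < τ.im) (j : ℤ) (v : ℂ) :
    HasDbar (RZwegers j d τ)
      (-(2 * I * √(d / τ.im)) * Real.exp (-(4 * π * d * v.im ^ 2 / τ.im)) *
        conj (Theta (-j) d τ (2 * v))) v := by
  obtain ⟨h1, h2, h3⟩ := RZwegers_hasWirtinger_aux hd hτ j v
  have h4 : HasSum (fun l : ℤ => wirtingerMap (delTerm j d τ v l) (dbarTerm d τ v (2 * d * l - j)))
      (wirtingerMap (∑' l, delTerm j d τ v l) (∑' l : ℤ, dbarTerm d τ v (2 * d * l - j))) :=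
    (h1.hasSum.smul_const _).add (h2.hasSum.smul_const _)
  rw [h4.tsum_eq] at h3
  have h5 : ∑' l : ℤ, dbarTerm d τ v (2 * d * l - j) =
      -(2 * I * √(d / τ.im)) * Real.exp (-(4 * π * d * v.im ^ 2 / τ.im)) *
        conj (Theta (-j) d τ (2 * v)) := by
    rw [Theta_eq_tsum hd, Complex.conj_tsum, ← tsum_mul_left]
    refine tsum_congr fun l => ?_
    rw [dbarTerm, gaussian_mul_errExp hd hτ, ← sub_eq_add_neg, ← mul_assoc]
  rw [h5] at h3
  exact ⟨_, h3⟩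

end

section

/-! ### The period lattice -/

/-- The lattice `ℤ + ℤ τ`. -/
def periodLattice (τ : ℂ) : Set ℂ := {z | ∃ p q : ℤ, z = p + q * τ}

theorem add_mem_periodLattice {τ z w : ℂ} (hz : z ∈ periodLattice τ) (hw : w ∈ periodLattice τ) :
    z + w ∈ periodLattice τ := by
  obtain ⟨p, q, rfl⟩ := hz
  obtain ⟨p', q', rfl⟩ := hw
  exact ⟨p + p', q + q', by push_cast; ring⟩

theorem neg_mem_periodLattice {τ z : ℂ} : -z ∈ periodLattice τ ↔ z ∈ periodLattice τ := by
  constructor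
  · rintro ⟨p, q, h⟩
    exact ⟨-p, -q, by rw [← neg_neg z, h]; push_cast; ring⟩
  · rintro ⟨p, q, rfl⟩
    exact ⟨-p, -q, by push_cast; ring⟩

theorem add_mem_periodLattice_iff {τ z w : ℂ} (hw : w ∈ periodLattice τ) :
    z + w ∈ periodLattice τ ↔ z ∈ periodLattice τ := by
  refine ⟨fun h => ?_, fun h => add_mem_periodLattice h hw⟩
  have := add_mem_periodLattice h (neg_mem_periodLattice.2 hw)
  simpa using this

theorem intCast_mem_periodLattice (τ : ℂ) (n : ℤ) : (n : ℂ) ∈ periodLattice τ := ⟨n, 0, by simp⟩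

theorem one_mem_periodLattice (τ : ℂ) : (1 : ℂ) ∈ periodLattice τ := ⟨1, 0, by simp⟩

theorem self_mem_periodLattice (τ : ℂ) : τ ∈ periodLattice τ := ⟨0, 1, by simp⟩

theorem one_sub_eq_zero_iff {τ z : ℂ} (j : ℤ) :
    1 - cexp (2 * π * I * z) * qPow τ j = 0 ↔ ∃ p : ℤ, z = p - j * τ := by
  rw [qPow, ← Complex.exp_add, sub_eq_zero, eq_comm, Complex.exp_eq_one_iff]
  refine exists_congr fun p => ?_
  constructor
  · intro h
    have h2 : (2 * π * I) * (z + j * τ) = (2 * π * I) * p := by linear_combination h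
    have := mul_left_cancel₀ Complex.two_pi_I_ne_zero h2
    linear_combination this
  · rintro rfl; ring

theorem one_sub_ne_zero {τ z : ℂ} (hz : z ∉ periodLattice τ) (j : ℤ) :
    1 - cexp (2 * π * I * z) * qPow τ j ≠ 0 := by
  intro h
  obtain ⟨p, hp⟩ := (one_sub_eq_zero_iff j).1 h
  exact hz ⟨p, -j, by rw [hp]; push_cast; ring⟩

/-- Discreteness: near z the imaginary part bounds q, and then the real part bounds p. -/
theorem eventually_notMem_periodLattice {τ : ℂ} (hτ : 0 < τ.im) (z : ℂ) :
    ∀ᶠ w in 𝓝[≠] z, w ∉ periodLattice τ := by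
  have hfin : (Metric.ball z 1 ∩ periodLattice τ).Finite := by
    obtain ⟨Q, hQ⟩ := exists_nat_gt ((|z.im| + 1) / τ.im)
    obtain ⟨P, hP⟩ := exists_nat_gt (|z.re| + 1 + Q * |τ.re|)
    refine ((Finset.Icc (-(P : ℤ)) P ×ˢ Finset.Icc (-(Q : ℤ)) Q).finite_toSet.image
      (fun x : ℤ × ℤ => (x.1 : ℂ) + x.2 * τ)).subset ?_
    rintro w ⟨hw, p, q, rfl⟩
    rw [Metric.mem_ball, dist_eq_norm] at hw
    have h1 := (Complex.abs_re_le_norm _).trans_lt hw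
    have h2 := (Complex.abs_im_le_norm _).trans_lt hw
    simp only [Complex.sub_re, Complex.add_re, Complex.intCast_re, Complex.mul_re, Complex.sub_im,
      Complex.add_im, Complex.intCast_im, Complex.mul_im, zero_mul, sub_zero, zero_add,
      add_zero] at h1 h2
    rw [div_lt_iff₀ hτ] at hQ
    have hq : |(q : ℝ)| < Q := by
      have : |(q : ℝ)| * τ.im ≤ |q * τ.im - z.im| + |z.im| := by
        rw [← abs_of_pos hτ, ← abs_mul, abs_of_pos hτ]
        have := abs_add_le (q * τ.im - z.im) z.im
        simpa using this
      by_contra! hcon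
      nlinarith
    have hp : |(p : ℝ)| < P := by
      have e1 : |(p : ℝ)| ≤ |p + q * τ.re - z.re| + |z.re| + |q * τ.re| := by
        have e2 := abs_add_le (p + q * τ.re - z.re) (z.re - q * τ.re)
        have e3 := abs_sub z.re (q * τ.re)
        have e4 : p + q * τ.re - z.re + (z.re - q * τ.re) = p := by ring
        rw [e4] at e2
        linarith
      rw [abs_mul] at e1
      have := mul_le_mul_of_nonneg_right hq.le (abs_nonneg τ.re)
      linarith
    refine ⟨(p, q), ?_, rfl⟩
    have hq' : |q| < (Q : ℤ) := by exact_mod_cast hq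
    have hp' : |p| < (P : ℤ) := by exact_mod_cast hp
    rw [abs_lt] at hq' hp'
    simp only [Finset.coe_product, Set.mem_prod, Finset.coe_Icc, Set.mem_Icc]
    omega
  have h1 : ∀ᶠ w in 𝓝[≠] z, w ∈ Metric.ball z 1 :=
    nhdsWithin_le_nhds (Metric.ball_mem_nhds z one_pos)
  have h2 : ∀ᶠ w in 𝓝[≠] z, w ∉ (Metric.ball z 1 ∩ periodLattice τ) \ {z} :=
    nhdsWithin_le_nhds (((hfin.subset Set.sdiff_subset).isClosed.isOpen_compl).mem_nhds (by simp))
  filter_upwards [h1, h2, self_mem_nhdsWithin] with w hw1 hw2 hw3 hw4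
  exact hw2 ⟨⟨hw1, hw4⟩, hw3⟩

/-! ### Appell-type sums -/

variable {d : ℕ} {τ : ℂ}

theorem norm_exp_mul_qPow (τ z : ℂ) (j : ℤ) :
    ‖cexp (2 * π * I * z) * qPow τ j‖ = Real.exp (-(2 * π) * (z.im + j * τ.im)) := by
  rw [qPow, ← Complex.exp_add, Complex.norm_exp]
  congr 1
  have : 2 * π * I * z + 2 * π * I * τ * j = ((2 * π : ℝ) : ℂ) * (I * (z + (j : ℝ) * τ)) := by
    push_cast; ring
  rw [this, Complex.re_ofReal_mul, Complex.I_mul_re, Complex.add_im, Complex.im_ofReal_mul]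
  ring

/-- The modulus of e^{2πiz}q^j is e^{-2π(Im z + j Im τ)}. Uniformly on the strip it is at least 2
for j very negative and at most 1/2 for j very positive. -/
theorem exists_half_le_norm_one_sub (hτ : 0 < τ.im) (B : ℝ) :
    ∃ J : ℤ, ∀ z : ℂ, |z.im| ≤ B → ∀ j : ℤ, j ∉ Finset.Icc (-J) J →
      1 / 2 ≤ ‖1 - cexp (2 * π * I * z) * qPow τ j‖ := by
  obtain ⟨J, hJ⟩ := exists_nat_gt ((B + 1) / τ.im)
  refine ⟨J, fun z hz j hj => ?_⟩
  rw [div_lt_iff₀ hτ] at hJ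
  have hn := norm_exp_mul_qPow τ z j
  set x := cexp (2 * π * I * z) * qPow τ j
  obtain ⟨hz1, hz2⟩ := abs_le.1 hz
  rw [Finset.mem_Icc, not_and_or, not_le, not_le] at hj
  have hpi := Real.pi_gt_three
  rcases hj with h | h
  · have h' : (j : ℝ) ≤ -J := by exact_mod_cast h.le
    have h3 : (j : ℝ) * τ.im ≤ -J * τ.im := mul_le_mul_of_nonneg_right h' hτ.le
    have h4 : 1 ≤ -(2 * π) * (z.im + j * τ.im) := by nlinarith
    have h5 : 2 ≤ ‖x‖ := by
      rw [hn]
      have := Real.add_one_le_exp (-(2 * π) * (z.im + j * τ.im))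
      linarith
    have := norm_sub_norm_le x 1
    rw [norm_one, norm_sub_rev] at this
    linarith
  · have h' : (J : ℝ) ≤ j := by exact_mod_cast h.le
    have h3 : (J : ℝ) * τ.im ≤ j * τ.im := mul_le_mul_of_nonneg_right h' hτ.le
    have h4 : 1 ≤ (2 * π) * (z.im + j * τ.im) := by nlinarith
    have h5 : ‖x‖ ≤ 1 / 2 := by
      rw [hn, neg_mul, Real.exp_neg, inv_le_comm₀ (Real.exp_pos _) (by norm_num)]
      have := Real.add_one_le_exp (2 * π * (z.im + j * τ.im))
      norm_num; linarith
    have := norm_sub_norm_le 1 x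
    rw [norm_one] at this
    linarith

theorem norm_div_one_sub_le {a x : ℂ} (h : 1 / 2 ≤ ‖1 - x‖) : ‖a / (1 - x)‖ ≤ 2 * ‖a‖ := by
  rw [norm_div, div_le_iff₀ (by linarith)]
  nlinarith [norm_nonneg a]

theorem summable_div_one_sub (hτ : 0 < τ.im) {a : ℤ → ℂ} (ha : Summable a) (z : ℂ) :
    Summable fun j : ℤ => a j / (1 - cexp (2 * π * I * z) * qPow τ j) := by
  obtain ⟨J, hJ⟩ := exists_half_le_norm_one_sub hτ |z.im|
  refine Summable.of_norm_bounded_eventually (ha.norm.mul_left 2) ?_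
  rw [Filter.eventually_cofinite]
  refine (Finset.Icc (-J) J).finite_toSet.subset fun j hj => ?_
  by_contra hcon
  exact hj (norm_div_one_sub_le (hJ z le_rfl j hcon))

/-- Only finitely many denominators can be small; they are split off, and the remaining series
converges uniformly. The alternative `a j = 0` allows a polar term to be deleted, which is how
residues are computed. -/
theorem differentiableAt_tsum_div_one_sub (hτ : 0 < τ.im) {a : ℤ → ℂ → ℂ} {b : ℤ → ℝ} {z₀ : ℂ}
    (ha : ∀ j, Differentiable ℂ (a j)) (hb : Summable b)
    (hab : ∀ z ∈ Metric.ball z₀ 1, ∀ j, ‖a j z‖ ≤ b j)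
    (h0 : ∀ j : ℤ, a j = 0 ∨ 1 - cexp (2 * π * I * z₀) * qPow τ j ≠ 0) :
    DifferentiableAt ℂ
      (fun z => ∑' j : ℤ, a j z / (1 - cexp (2 * π * I * z) * qPow τ j)) z₀ := by
  obtain ⟨J, hJ⟩ := exists_half_le_norm_one_sub hτ (|z₀.im| + 1)
  have him : ∀ z ∈ Metric.ball z₀ 1, |z.im| ≤ |z₀.im| + 1 := by
    intro z hz
    rw [Metric.mem_ball, dist_eq_norm] at hz
    have h1 := (Complex.abs_im_le_norm _).trans_lt hz
    rw [Complex.sub_im] at h1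
    have := abs_sub_abs_le_abs_sub z.im z₀.im
    linarith
  have hball : Metric.ball z₀ 1 ∈ 𝓝 z₀ := Metric.ball_mem_nhds z₀ one_pos
  have hsum : ∀ z ∈ Metric.ball z₀ 1,
      ∑' j : ℤ, a j z / (1 - cexp (2 * π * I * z) * qPow τ j) =
      (∑ j ∈ Finset.Icc (-J) J, a j z / (1 - cexp (2 * π * I * z) * qPow τ j)) +
        ∑' j : {j : ℤ // j ∉ Finset.Icc (-J) J},
          a j z / (1 - cexp (2 * π * I * z) * qPow τ (j : ℤ)) := by
    intro z hz
    exact ((summable_div_one_sub hτ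
      (Summable.of_norm_bounded hb (hab z hz)) z).sum_add_tsum_subtype_compl _).symm
  refine DifferentiableAt.congr_of_eventuallyEq ?_
    (Filter.eventuallyEq_of_mem hball fun z hz => hsum z hz)
  refine DifferentiableAt.add (DifferentiableAt.fun_sum fun j _ => ?_) ?_
  · rcases h0 j with h | h
    · simp [h]
    · refine ((ha j) z₀).div ?_ h
      fun_prop
  · refine (differentiableOn_tsum_of_summable_norm (u := fun j : {j : ℤ // j ∉ Finset.Icc (-J) J} =>
      2 * b j) ((hb.mul_left 2).subtype _) (fun j => ?_) Metric.isOpen_ball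
      fun j z hz => ?_).differentiableAt hball
    · refine ((ha j).differentiableOn).div (by fun_prop) fun z hz h => ?_
      have := hJ z (him z hz) j j.2
      rw [h, norm_zero] at this
      linarith
    · exact (norm_div_one_sub_le (hJ z (him z hz) j j.2)).trans
        (by have := hab z hz j; linarith)

theorem tendsto_residue_div_one_sub {z₀ : ℂ} {j : ℤ} (a : ℂ)
    (h : 1 - cexp (2 * π * I * z₀) * qPow τ j = 0) :
    Tendsto (fun z => (z - z₀) * (a / (1 - cexp (2 * π * I * z) * qPow τ j))) (𝓝[≠] z₀)
      (𝓝 (-(a / (2 * π * I)))) := by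
  have hd : HasDerivAt (fun z => 1 - cexp (2 * π * I * z) * qPow τ j) (-(2 * π * I)) z₀ := by
    have h1 : HasDerivAt (fun z => cexp (2 * π * I * z)) (cexp (2 * π * I * z₀) * (2 * π * I)) z₀ := by
      refine HasDerivAt.cexp ?_
      simpa using (hasDerivAt_id z₀).const_mul (2 * π * I)
    refine ((h1.mul_const (qPow τ j)).const_sub 1).congr_deriv ?_
    linear_combination (2 * π * I) * h
  have h2 := hd.tendsto_slope.inv₀ (neg_ne_zero.2 Complex.two_pi_I_ne_zero)
  have h3 := h2.const_mul a
  refine (h3.congr fun z => ?_).trans (by rw [inv_neg, mul_neg, div_eq_mul_inv])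
  rw [slope_def_field, h, sub_zero, inv_div]
  ring

theorem tendsto_residue_tsum (hτ : 0 < τ.im) {a : ℤ → ℂ} (ha : Summable a) {z₀ : ℂ} {j₀ : ℤ}
    (h : 1 - cexp (2 * π * I * z₀) * qPow τ j₀ = 0) :
    Tendsto (fun z => (z - z₀) * ∑' j : ℤ, a j / (1 - cexp (2 * π * I * z) * qPow τ j)) (𝓝[≠] z₀)
      (𝓝 (-(a j₀ / (2 * π * I)))) := by
  have hdiff : DifferentiableAt ℂ (fun z => ∑' j : ℤ, (Function.update a j₀ 0 j) /
      (1 - cexp (2 * π * I * z) * qPow τ j)) z₀ := by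
    refine differentiableAt_tsum_div_one_sub hτ (a := fun j _ => Function.update a j₀ 0 j)
      (b := fun j => ‖a j‖) (fun j => differentiable_const _) ha.norm (fun z _ j => ?_)
      fun j => ?_
    · by_cases hj : j = j₀
      · subst hj; simp
      · simp [hj]
    · by_cases hj : j = j₀
      · subst hj; left; ext; simp
      · right
        intro hcon
        obtain ⟨p, hp⟩ := (one_sub_eq_zero_iff j₀).1 h
        obtain ⟨p', hp'⟩ := (one_sub_eq_zero_iff j).1 hcon
        have him := congrArg Complex.im (hp.symm.trans hp')
        simp at him
        rcases him with him | him
        · exact hj (by exact_mod_cast him.symm)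
        · exact hτ.ne' him
  have hsplit : ∀ z, ∑' j : ℤ, a j / (1 - cexp (2 * π * I * z) * qPow τ j) =
      a j₀ / (1 - cexp (2 * π * I * z) * qPow τ j₀) + ∑' j : ℤ, (Function.update a j₀ 0 j) /
      (1 - cexp (2 * π * I * z) * qPow τ j) := by
    intro z
    rw [(summable_div_one_sub hτ ha z).tsum_eq_add_tsum_ite j₀]
    congr 1
    refine tsum_congr fun j => ?_
    by_cases hj : j = j₀
    · subst hj; simp
    · simp [hj]
  have h1 := tendsto_residue_div_one_sub (τ := τ) (a j₀) h
  have h2 : Tendsto (fun z => (z - z₀) * ∑' j : ℤ, (Function.update a j₀ 0 j) /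
      (1 - cexp (2 * π * I * z) * qPow τ j)) (𝓝[≠] z₀) (𝓝 0) := by
    have hc : ContinuousAt (fun z => (z - z₀) * ∑' j : ℤ, (Function.update a j₀ 0 j) /
      (1 - cexp (2 * π * I * z) * qPow τ j)) z₀ :=
      ContinuousAt.mul (by fun_prop) hdiff.continuousAt
    have := hc.tendsto.mono_left (nhdsWithin_le_nhds (s := {z₀}ᶜ))
    simpa using this
  have h3 := h1.add h2
  rw [add_zero] at h3
  refine h3.congr fun z => ?_
  rw [hsplit z, mul_add]

end

section

/-! ### The modified function in the variables `u = z₁ + z₂`, `v = (z₁ - z₂) / 2` -/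

variable {d : ℕ} {τ : ℂ}

/-- The numerators of `Φ₁^{[d-1;s]}`, with `u = z₁ + z₂` and `z = z₁`. -/
def appellNum (d s : ℕ) (τ u z : ℂ) (j : ℤ) : ℂ :=
  cexp (2 * π * I * (d * j * u - s * z + (d * (j : ℂ) ^ 2 - j * s) * τ))

/-- The function `Φ₁^{[d-1;s]}`, with `u = z₁ + z₂` and `z = z₁`. -/
def appell (d s : ℕ) (τ u z : ℂ) : ℂ :=
  ∑' j : ℤ, appellNum d s τ u z j / (1 - cexp (2 * π * I * z) * qPow τ j)

/-- The function `Φ~^{[d-1;s]}` at `t = 0`, with `u = z₁ + z₂` and `v = (z₁ - z₂) / 2`. -/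
def phiHat (d s : ℕ) (τ u v : ℂ) : ℂ :=
  appell d s τ u (v + u / 2) - appell d s τ (-u) (v - u / 2) +
    1 / 2 * ∑ j ∈ Finset.range (2 * d), RZwegers (j - s) d τ v *
      (Theta (j - s) d τ u - Theta (-(j - s)) d τ u)

theorem Phi₁_eq_appell (m s : ℕ) (τ z₁ z₂ : ℂ) :
    Phi₁ m s τ z₁ z₂ = appell (m + 1) s τ (z₁ + z₂) z₁ := by
  refine tsum_congr fun j => ?_
  congr 1
  rw [appellNum, qPow, ← Complex.exp_add, ← Complex.exp_add]
  congr 1; push_cast; ring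

theorem PhiMod_eq_phiHat (m s : ℕ) (τ z₁ z₂ : ℂ) :
    PhiMod m s τ z₁ z₂ 0 = phiHat (m + 1) s τ (z₁ + z₂) ((z₁ - z₂) / 2) := by
  rw [PhiMod, Phi, PhiAdd, phiHat, mul_zero, Complex.exp_zero, one_mul, mul_one, Phi₁_eq_appell,
    Phi₁_eq_appell]
  have e1 : z₁ = (z₁ - z₂) / 2 + (z₁ + z₂) / 2 := by ring
  have e2 : -z₂ = (z₁ - z₂) / 2 - (z₁ + z₂) / 2 := by ring
  have e3 : -z₂ + -z₁ = -(z₁ + z₂) := by ring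
  rw [← e1, ← e2, e3]
  congr 2
  · refine Finset.sum_bij' (fun (j : ℤ) _ => (j + s).toNat) (fun (i : ℕ) _ => (i : ℤ) - s)
      ?_ ?_ ?_ ?_ ?_
    · intro j hj
      simp only [Finset.mem_Icc, Finset.mem_range] at hj ⊢
      omega
    · intro i hi
      simp only [Finset.mem_Icc, Finset.mem_range] at hi ⊢
      omega
    · intro j hj
      simp only [Finset.mem_Icc] at hj ⊢
      omega
    · intro i hi
      simp
    · intro j hj
      have : (((j + s).toNat : ℕ) : ℤ) - s = j := by
        simp only [Finset.mem_Icc] at hj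
        omega
      rw [this]

/-! ### Independence of s -/

theorem appellNum_eq (hd : 0 < d) (s : ℕ) (τ u z : ℂ) (j : ℤ) :
    appellNum d s τ u z j =
      cexp (2 * π * I * s * (u / 2 - z) - π * I * (s : ℂ) ^ 2 * τ / (2 * d)) *
        thetaTerm d τ u (2 * d * j + -s) := by
  have hdc : (d : ℂ) ≠ 0 := by exact_mod_cast hd.ne'
  rw [appellNum, thetaTerm, ← Complex.exp_add]
  congr 1; push_cast; field_simp; ring

theorem summable_appellNum (hd : 0 < d) (hτ : 0 < τ.im) (s : ℕ) (u z : ℂ) :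
    Summable (appellNum d s τ u z) := by
  refine ((summable_thetaTerm_affine hd hτ u (-s)).mul_left
    (cexp (2 * π * I * s * (u / 2 - z) - π * I * (s : ℂ) ^ 2 * τ / (2 * d)))).congr fun j => ?_
  rw [appellNum_eq hd]

theorem tsum_appellNum (hd : 0 < d) (s : ℕ) (τ u z : ℂ) :
    ∑' j, appellNum d s τ u z j =
      cexp (2 * π * I * s * (u / 2 - z) - π * I * (s : ℂ) ^ 2 * τ / (2 * d)) *
        Theta (-s) d τ u := by
  rw [Theta_eq_tsum hd, ← tsum_mul_left]
  exact tsum_congr fun j => appellNum_eq hd s τ u z j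

/-- With x = e^{2πiz}q^j, the numerator for s is x times the one for s + 1. So (x - 1)/(1 - x) = -1
cancels the denominator and leaves a pure theta series. -/
theorem appell_sub_succ (hd : 0 < d) (hτ : 0 < τ.im) (s : ℕ) (u : ℂ) {z : ℂ}
    (hz : z ∉ periodLattice τ) :
    appell d s τ u z - appell d (s + 1) τ u z =
      -(cexp (2 * π * I * (s + 1 : ℕ) * (u / 2 - z) -
        π * I * ((s + 1 : ℕ) : ℂ) ^ 2 * τ / (2 * d)) * Theta (-(s + 1 : ℕ)) d τ u) := by
  rw [← tsum_appellNum hd, appell, appell,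
    ← (summable_div_one_sub hτ (summable_appellNum hd hτ s u z) z).tsum_sub
      (summable_div_one_sub hτ (summable_appellNum hd hτ (s + 1) u z) z), ← tsum_neg]
  refine tsum_congr fun j => ?_
  have h0 := one_sub_ne_zero hz j
  have hnum : appellNum d s τ u z j =
      appellNum d (s + 1) τ u z j * (cexp (2 * π * I * z) * qPow τ j) := by
    rw [appellNum, appellNum, qPow, ← Complex.exp_add, ← Complex.exp_add]
    congr 1; push_cast; ring
  rw [hnum]
  field_simp
  ring

/-- Passing from s to s + 1 slides the summation window of the correction by one, exchanging the
index 2d - n for -n, where n = s + 1. Θ is 2d-periodic in its index while R jumps by an exponential,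
and this jump cancels the theta functions coming from the two Appell sums. -/
theorem phiHat_succ (hd : 0 < d) (hτ : 0 < τ.im) (s : ℕ) {u v : ℂ}
    (h1 : v + u / 2 ∉ periodLattice τ) (h2 : v - u / 2 ∉ periodLattice τ) :
    phiHat d (s + 1) τ u v = phiHat d s τ u v := by
  have e1 := appell_sub_succ hd hτ s u h1
  have e2 := appell_sub_succ hd hτ s (-u) h2
  rw [Theta_neg_right hd, neg_neg] at e2
  have hsum : ∀ s' : ℕ, ∑ j ∈ Finset.range (2 * d), RZwegers (j - s') d τ v *
      (Theta (j - s') d τ u - Theta (-(j - s')) d τ u) =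
      ∑ j ∈ Finset.range (2 * d), (fun i : ℤ => RZwegers (i - s') d τ v *
      (Theta (i - s') d τ u - Theta (-(i - s')) d τ u)) (j : ℤ) := fun _ => rfl
  set f : ℤ → ℂ := fun i => RZwegers i d τ v * (Theta i d τ u - Theta (-i) d τ u) with hf
  set n : ℤ := ((s + 1 : ℕ) : ℤ) with hn
  have hlast : f (-n + 2 * d) - f (-n) =
      2 * cexp (-(π * I * (n : ℂ) ^ 2 * τ / (2 * d)) - 2 * π * I * n * v) *
        (Theta (-n) d τ u - Theta n d τ u) := by
    have hR := RZwegers_sub_add_two_mul hd hτ (-n) v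
    have hT : Theta (-(-n + 2 * d)) d τ u = Theta n d τ u := by
      rw [← Theta_add_two_mul hd]; congr 1; ring
    rw [hf]
    simp only
    rw [Theta_add_two_mul hd, hT, neg_neg, eq_sub_of_add_eq (sub_add_cancel _ _ : _ = _),
      ← sub_mul, ← neg_sub (RZwegers (-n) d τ v), hR]
    have hexp : -(π * I * ((-n : ℤ) : ℂ) ^ 2 * τ / (2 * d)) + 2 * π * I * ((-n : ℤ) : ℂ) * v =
      -(π * I * (n : ℂ) ^ 2 * τ / (2 * d)) - 2 * π * I * n * v := by push_cast; ring
    rw [hexp]; ring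
  -- The 2d + 1 indices from -n to 2d - n are summed in two ways, once splitting off the last and
  -- once the first.
  have hsums : ∑ j ∈ Finset.range (2 * d), f (j - (s + 1 : ℕ)) =
      ∑ j ∈ Finset.range (2 * d), f (j - s) - (f (-n + 2 * d) - f (-n)) := by
    have h3 := Finset.sum_range_succ (fun j : ℕ => f ((j : ℤ) - (s + 1 : ℕ))) (2 * d)
    have h4 := Finset.sum_range_succ' (fun j : ℕ => f ((j : ℤ) - (s + 1 : ℕ))) (2 * d)
    have h5 : ∀ j : ℕ, f (((j + 1 : ℕ) : ℤ) - (s + 1 : ℕ)) = f (j - s) := by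
      intro j; congr 1; push_cast; ring
    simp only [h5] at h4
    have h6 : f (((2 * d : ℕ) : ℤ) - (s + 1 : ℕ)) = f (-n + 2 * d) := by
      congr 1
    have h7 : f (((0 : ℕ) : ℤ) - (s + 1 : ℕ)) = f (-n) := by
      congr 1
    rw [h6, h4, h7] at h3
    linear_combination -h3
  have hu1 : u / 2 - (v + u / 2) = -v := by ring
  have hu2 : -u / 2 - (v - u / 2) = -v := by ring
  rw [hu1] at e1
  rw [hu2] at e2
  rw [phiHat, phiHat]
  change _ + 1 / 2 * ∑ j ∈ Finset.range (2 * d), f (j - (s + 1 : ℕ)) =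
    _ + 1 / 2 * ∑ j ∈ Finset.range (2 * d), f (j - s)
  rw [hsums, hlast]
  have hexp : cexp (-(π * I * (n : ℂ) ^ 2 * τ / (2 * d)) - 2 * π * I * n * v) =
      cexp (2 * π * I * (s + 1 : ℕ) * -v - π * I * ((s + 1 : ℕ) : ℂ) ^ 2 * τ / (2 * d)) := by
    congr 1; rw [hn]; push_cast; ring
  rw [hexp]
  linear_combination e2 - e1

theorem phiHat_eq_zero_index (hd : 0 < d) (hτ : 0 < τ.im) (s : ℕ) {u v : ℂ}
    (h1 : v + u / 2 ∉ periodLattice τ) (h2 : v - u / 2 ∉ periodLattice τ) :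
    phiHat d s τ u v = phiHat d 0 τ u v := by
  induction s with
  | zero => rfl
  | succ s ih => rw [phiHat_succ hd hτ s h1 h2, ih]

/-! ### Oddness in u and quasi-periodicity -/

theorem phiHat_neg (hd : 0 < d) (s : ℕ) (τ u v : ℂ) :
    phiHat d s τ (-u) v = -phiHat d s τ u v := by
  rw [phiHat, phiHat, neg_neg, show v + -u / 2 = v - u / 2 by ring,
    show v - -u / 2 = v + u / 2 by ring]
  have : ∀ j : ℕ, RZwegers (j - s) d τ v *
      (Theta (j - s) d τ (-u) - Theta (-(j - s)) d τ (-u)) =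
      -(RZwegers (j - s) d τ v * (Theta (j - s) d τ u - Theta (-(j - s)) d τ u)) := by
    intro j
    rw [Theta_neg_right hd, Theta_neg_right hd, neg_neg]; ring
  simp only [this, Finset.sum_neg_distrib]
  ring

theorem appell_add_one (d s : ℕ) (τ u z : ℂ) : appell d s τ u (z + 1) = appell d s τ u z := by
  refine tsum_congr fun j => ?_
  congr 1
  · rw [appellNum, appellNum]
    refine Complex.exp_eq_exp_iff_exists_int.2 ⟨-s, ?_⟩
    push_cast; ring
  · congr 2
    rw [mul_add, mul_one, Complex.exp_add, Complex.exp_two_pi_mul_I, mul_one]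

theorem appell_add_one_left (d s : ℕ) (τ u z : ℂ) :
    appell d s τ (u + 1) z = appell d s τ u z := by
  refine tsum_congr fun j => ?_
  congr 1
  rw [appellNum, appellNum]
  refine Complex.exp_eq_exp_iff_exists_int.2 ⟨d * j, ?_⟩
  push_cast; ring

theorem phiHat_add_one (hd : 0 < d) (s : ℕ) (τ u v : ℂ) :
    phiHat d s τ (u + 1) (v + 1 / 2) = phiHat d s τ u v := by
  rw [phiHat, phiHat, show v + 1 / 2 + (u + 1) / 2 = v + u / 2 + 1 by ring,
    show v + 1 / 2 - (u + 1) / 2 = v - u / 2 by ring, appell_add_one, appell_add_one_left]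
  have h1 := appell_add_one_left d s τ (-(u + 1)) (v - u / 2)
  rw [show -(u + 1) + 1 = -u by ring] at h1
  rw [← h1]
  congr 2
  refine Finset.sum_congr rfl fun j _ => ?_
  rw [RZwegers_add_half hd, Theta_add_one hd, Theta_add_one hd]
  have h2 : cexp (π * I * ((-((j : ℤ) - s) : ℤ) : ℂ)) = cexp (π * I * (((j : ℤ) - s : ℤ) : ℂ)) := by
    refine Complex.exp_eq_exp_iff_exists_int.2 ⟨-((j : ℤ) - s), ?_⟩
    push_cast; ring
  have h3 : cexp (π * I * (((j : ℤ) - s : ℤ) : ℂ)) * cexp (π * I * (((j : ℤ) - s : ℤ) : ℂ)) = 1 := by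
    rw [← Complex.exp_add]
    refine Complex.exp_eq_one_iff.2 ⟨(j : ℤ) - s, ?_⟩
    push_cast; ring
  rw [h2]
  linear_combination (RZwegers (j - s) d τ v *
    (Theta (j - s) d τ u - Theta (-(j - s)) d τ u)) * h3

theorem appell_tau_add_one (d s : ℕ) (τ u z : ℂ) :
    appell d s (τ + 1) u z = appell d s τ u z := by
  refine tsum_congr fun j => ?_
  congr 1
  · rw [appellNum, appellNum]
    refine Complex.exp_eq_exp_iff_exists_int.2 ⟨d * j ^ 2 - j * s, ?_⟩
    push_cast; ring
  · congr 2
    rw [qPow, qPow]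
    refine Complex.exp_eq_exp_iff_exists_int.2 ⟨j, ?_⟩
    ring

theorem phiHat_tau_add_one (hd : 0 < d) (s : ℕ) (τ u v : ℂ) :
    phiHat d s (τ + 1) u v = phiHat d s τ u v := by
  rw [phiHat, phiHat, appell_tau_add_one, appell_tau_add_one]
  congr 2
  refine Finset.sum_congr rfl fun j _ => ?_
  rw [RZwegers_tau_add_one hd, Theta_tau_add_one hd, Theta_tau_add_one hd, Int.cast_neg, neg_sq,
    Complex.exp_neg]
  field_simp [Complex.exp_ne_zero]

theorem phiHat_tau_add_natCast (hd : 0 < d) (s : ℕ) (τ u v : ℂ) (n : ℕ) :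
    phiHat d s (τ + n) u v = phiHat d s τ u v := by
  induction n with
  | zero => simp
  | succ n ih => rw [Nat.cast_succ, ← add_assoc, phiHat_tau_add_one hd, ih]

theorem appell_add_tau (d s : ℕ) (τ u z : ℂ) :
    appell d s τ (u + τ) (z + τ) = cexp (-(2 * π * I * d * (u - z))) * appell d (s + d) τ u z := by
  rw [appell, appell, ← tsum_mul_left, ← (Equiv.addRight (-1 : ℤ)).tsum_eq]
  refine tsum_congr fun j => ?_
  rw [← mul_div_assoc]
  congr 1
  · rw [appellNum, appellNum, ← Complex.exp_add]
    congr 1; simp; ring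
  · rw [qPow, qPow, ← Complex.exp_add, ← Complex.exp_add]
    congr 2; simp; ring

theorem appell_sub_tau_left (d s : ℕ) (τ u z : ℂ) :
    appell d s τ (u - τ) z = cexp (2 * π * I * d * z) * appell d (s + d) τ u z := by
  rw [appell, appell, ← tsum_mul_left]
  refine tsum_congr fun j => ?_
  rw [← mul_div_assoc]
  congr 1
  rw [appellNum, appellNum, ← Complex.exp_add]
  congr 1; push_cast; ring

/-- This is z₁ ↦ z₁ + τ with z₂ fixed. Each Appell sum returns with s raised by d, and the R and Θ
indices move accordingly, so this becomes quasi-periodicity only through the independence of s. -/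
theorem phiHat_add_tau_index (hd : 0 < d) (hτ : 0 < τ.im) (s : ℕ) (u v : ℂ) :
    phiHat d s τ (u + τ) (v + τ / 2) =
      cexp (-(2 * π * I * d * (u / 2 - v))) * phiHat d (s + d) τ u v := by
  rw [phiHat, phiHat, show v + τ / 2 + (u + τ) / 2 = v + u / 2 + τ by ring,
    show v + τ / 2 - (u + τ) / 2 = v - u / 2 by ring, appell_add_tau, neg_add, ← sub_eq_add_neg,
    appell_sub_tau_left, mul_add, mul_sub, mul_left_comm _ (1 / 2 : ℂ)]
  congr 2
  · ring_nf
  · rw [Finset.mul_sum]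
    refine Finset.sum_congr rfl fun j _ => ?_
    rw [RZwegers_add_half_tau hd hτ, Theta_add_tau hd, Theta_add_tau hd]
    have h1 : (j : ℤ) - s - d = (j : ℤ) - (s + d : ℕ) := by push_cast; ring
    have h2 : Theta ((j : ℤ) - s + d) d τ u = Theta ((j : ℤ) - (s + d : ℕ)) d τ u := by
      rw [← Theta_add_two_mul hd ((j : ℤ) - (s + d : ℕ))]; congr 1; push_cast; ring
    have h3 : -((j : ℤ) - s) + d = -((j : ℤ) - (s + d : ℕ)) := by push_cast; ring
    rw [h1, h2, h3]
    have h4 : cexp (-(2 * π * I * d * (u / 2 - v))) = cexp (π * I * d * τ / 2 + 2 * π * I * d * v) *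
        cexp (-(π * I * d * τ / 2) - π * I * d * u) := by
      rw [← Complex.exp_add]; congr 1; ring
    rw [h4]; ring

theorem phiHat_add_tau (hd : 0 < d) (hτ : 0 < τ.im) {u v : ℂ}
    (h1 : v + u / 2 ∉ periodLattice τ) (h2 : v - u / 2 ∉ periodLattice τ) :
    phiHat d 0 τ (u + τ) (v + τ / 2) =
      cexp (-(2 * π * I * d * (u / 2 - v))) * phiHat d 0 τ u v := by
  rw [phiHat_add_tau_index hd hτ, phiHat_eq_zero_index hd hτ _ h1 h2]

/-- The shift z₂ ↦ z₂ + τ, obtained from the shift of z₁ by oddness in u. -/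
theorem phiHat_add_tau' (hd : 0 < d) (hτ : 0 < τ.im) {u v : ℂ}
    (h1 : v + u / 2 ∉ periodLattice τ) (h2 : v - u / 2 ∉ periodLattice τ) :
    phiHat d 0 τ (u + τ) (v - τ / 2) =
      cexp (-(2 * π * I * d * (u / 2 + v))) * phiHat d 0 τ u v := by
  have h3 : v - τ / 2 + -(u + τ) / 2 ∉ periodLattice τ := by
    have := add_mem_periodLattice_iff (z := v - τ / 2 + -(u + τ) / 2) (self_mem_periodLattice τ)
    rw [← this]; convert h2 using 1; ring_nf
  have h4 : v - τ / 2 - -(u + τ) / 2 ∉ periodLattice τ := by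
    convert h1 using 1; ring_nf
  have h := phiHat_add_tau hd hτ h3 h4
  rw [show -(u + τ) + τ = -u by ring, show v - τ / 2 + τ / 2 = v by ring, phiHat_neg hd,
    phiHat_neg hd, mul_neg, neg_inj] at h
  rw [h, ← mul_assoc, ← Complex.exp_add]
  rw [show -(2 * π * I * d * (u / 2 + v)) + -(2 * π * I * d * (-(u + τ) / 2 - (v - τ / 2))) = 0 by
    ring, Complex.exp_zero, one_mul]

theorem phiHat_add_one_right (hd : 0 < d) (s : ℕ) (τ u v : ℂ) :
    phiHat d s τ u (v + 1) = phiHat d s τ u v := by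
  have h1 := phiHat_add_one hd s τ (-(u + 1)) (v + 1 / 2)
  rw [show -(u + 1) + 1 = -u by ring, show v + 1 / 2 + 1 / 2 = v + 1 by ring, phiHat_neg hd,
    phiHat_neg hd, neg_inj, phiHat_add_one hd] at h1
  exact h1

/-- The move v ↦ v + τ combines z₁ ↦ z₁ + τ with z₂ ↦ z₂ - τ. The multiplier has negative index, and
this sign drives the vanishing argument. -/
theorem phiHat_add_tau_right (hd : 0 < d) (hτ : 0 < τ.im) {u v : ℂ}
    (h1 : v + u / 2 ∉ periodLattice τ) (h2 : v - u / 2 ∉ periodLattice τ) :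
    phiHat d 0 τ u (v + τ) = cexp (2 * π * I * d * (2 * v + τ)) * phiHat d 0 τ u v := by
  have h3 : v + τ + u / 2 ∉ periodLattice τ := by
    have := add_mem_periodLattice_iff (z := v + u / 2) (self_mem_periodLattice τ)
    rw [← this] at h1; convert h1 using 1; ring_nf
  have h4 : v + τ - u / 2 ∉ periodLattice τ := by
    have := add_mem_periodLattice_iff (z := v - u / 2) (self_mem_periodLattice τ)
    rw [← this] at h2; convert h2 using 1; ring_nf
  have e1 := phiHat_add_tau hd hτ h1 h2
  have e2 := phiHat_add_tau' hd hτ h3 h4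
  rw [show v + τ - τ / 2 = v + τ / 2 by ring, e1] at e2
  have h5 : cexp (2 * π * I * d * (2 * v + τ)) = cexp (-(2 * π * I * d * (u / 2 - v))) *
      cexp (2 * π * I * d * (u / 2 + (v + τ))) := by
    rw [← Complex.exp_add]; congr 1; ring
  rw [h5, mul_right_comm, e2, Complex.exp_neg]
  field_simp [Complex.exp_ne_zero]

end

section

/-! ### Analytic properties of the modified function -/

variable {d : ℕ} {τ : ℂ}

theorem appellNum_zero (hd : 0 < d) (τ u z : ℂ) (j : ℤ) :
    appellNum d 0 τ u z j = thetaTerm d τ u (2 * d * j) := by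
  rw [appellNum_eq hd]; simp

theorem appell_zero_eq (hd : 0 < d) (τ u z : ℂ) :
    appell d 0 τ u z =
      ∑' j : ℤ, thetaTerm d τ u (2 * d * j) / (1 - cexp (2 * π * I * z) * qPow τ j) :=
  tsum_congr fun j => by rw [appellNum_zero hd]

theorem norm_thetaTerm_le (hd : 0 < d) (hτ : 0 < τ.im) {B : ℝ} {u : ℂ} (hu : |u.im| ≤ 2 * B)
    (n : ℤ) : ‖thetaTerm d τ u n‖ ≤ Real.exp (-π * (τ.im / (2 * d) * n ^ 2 - 2 * B * |n|)) := by
  have h2 : (τ / (2 * d)).im = τ.im / (2 * d) := by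
    have : τ / (2 * d) = τ / ((2 * d : ℝ) : ℂ) := by push_cast; rfl
    rw [this, Complex.div_ofReal_im]
  have h3 : |(u / 2).im| ≤ B := by
    have : (u / 2).im = u.im / 2 := by
      have : u / 2 = u / ((2 : ℝ) : ℂ) := by push_cast; rfl
      rw [this, Complex.div_ofReal_im]
    rw [this, abs_div, abs_two]; linarith
  rw [thetaTerm_eq_jacobiTheta₂_term hd]
  exact norm_jacobiTheta₂_term_le (by positivity) h3 h2.ge n

/-- The first argument may vary with z because for fixed v the substitution z = v + u/2 makes u =
2(z - v). This gives differentiability in u as well as in v. -/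
theorem differentiableAt_appell_zero_comp (hd : 0 < d) (hτ : 0 < τ.im) {g : ℂ → ℂ}
    (hg : Differentiable ℂ g) {z : ℂ} (hz : z ∉ periodLattice τ) :
    DifferentiableAt ℂ (fun z => appell d 0 τ (g z) z) z := by
  simp only [appell_zero_eq hd]
  obtain ⟨B, hB⟩ := (isCompact_closedBall z 1).exists_bound_of_continuousOn
    hg.continuous.continuousOn
  have hs := summable_majorant hd hτ 0 B 0
  refine differentiableAt_tsum_div_one_sub hτ (a := fun j z => thetaTerm d τ (g z) (2 * d * j))
    (fun j => ?_) hs (fun w hw j => ?_) fun j => Or.inr (one_sub_ne_zero hz j)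
  · unfold thetaTerm; fun_prop
  · have h1 : |(g w).im| ≤ 2 * B := by
      have h2 := (Complex.abs_im_le_norm (g w)).trans (hB w (Metric.ball_subset_closedBall hw))
      linarith [abs_nonneg (g w).im]
    have := norm_thetaTerm_le hd hτ h1 (2 * d * j)
    simpa using this

theorem differentiableAt_appell_zero (hd : 0 < d) (hτ : 0 < τ.im) (u : ℂ) {z : ℂ}
    (hz : z ∉ periodLattice τ) : DifferentiableAt ℂ (appell d 0 τ u) z :=
  differentiableAt_appell_zero_comp hd hτ (differentiable_const u) hz

theorem differentiableAt_phiHat_left (hd : 0 < d) (hτ : 0 < τ.im) {u v : ℂ}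
    (h1 : v + u / 2 ∉ periodLattice τ) (h2 : v - u / 2 ∉ periodLattice τ) :
    DifferentiableAt ℂ (fun u => phiHat d 0 τ u v) u := by
  unfold phiHat
  have e1 : DifferentiableAt ℂ (fun u => appell d 0 τ u (v + u / 2)) u := by
    have := (differentiableAt_appell_zero_comp hd hτ (g := fun z => 2 * (z - v)) (by fun_prop)
      h1).comp u (f := fun u => v + u / 2) (by fun_prop)
    refine this.congr_of_eventuallyEq (Eventually.of_forall fun w => ?_)
    simp only [Function.comp]
    congr 1; ring_nf
  have e2 : DifferentiableAt ℂ (fun u => appell d 0 τ (-u) (v - u / 2)) u := by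
    have := (differentiableAt_appell_zero_comp hd hτ (g := fun z => 2 * (z - v)) (by fun_prop)
      h2).comp u (f := fun u => v - u / 2) (by fun_prop)
    refine this.congr_of_eventuallyEq (Eventually.of_forall fun w => ?_)
    simp only [Function.comp]
    congr 1; ring_nf
  refine (e1.sub e2).add (DifferentiableAt.const_mul (DifferentiableAt.fun_sum fun j _ => ?_) _)
  exact (((differentiable_Theta hd hτ _) u).sub ((differentiable_Theta hd hτ _) u)).const_mul _

/-- The sesquilinear theta kernel. -/
def thetaKernel (d : ℕ) (τ v u : ℂ) : ℂ :=
  ∑ j ∈ Finset.range (2 * d), conj (Theta j d τ (2 * v)) * Theta j d τ u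

/-- The theta kernel with its Gaussian weight. -/
def weightedKernel (d : ℕ) (τ v u : ℂ) : ℂ :=
  (√(d / τ.im) : ℂ) * (Real.exp (-(4 * π * d * v.im ^ 2 / τ.im)) : ℂ) * thetaKernel d τ v u

/-- The Appell sums are holomorphic off the poles, so only R contributes. The products conj
Θ_{-j}(2v) Θ_{±j}(u) sum to the kernel at -v and at v respectively. -/
theorem hasDbar_phiHat (hd : 0 < d) (hτ : 0 < τ.im) {u v : ℂ}
    (h1 : v + u / 2 ∉ periodLattice τ) (h2 : v - u / 2 ∉ periodLattice τ) :
    HasDbar (phiHat d 0 τ u)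
      (-I * (weightedKernel d τ (-v) u - weightedKernel d τ v u)) v := by
  have e1 : DifferentiableAt ℂ (fun v => appell d 0 τ u (v + u / 2)) v :=
    (differentiableAt_appell_zero hd hτ u h1).comp v (f := fun v => v + u / 2) (by fun_prop)
  have e2 : DifferentiableAt ℂ (fun v => appell d 0 τ (-u) (v - u / 2)) v :=
    (differentiableAt_appell_zero hd hτ (-u) h2).comp v (f := fun v => v - u / 2) (by fun_prop)
  have e3 : HasDbar (fun v => ∑ j ∈ Finset.range (2 * d), (Theta j d τ u - Theta (-j) d τ u) *
      RZwegers j d τ v) (∑ j ∈ Finset.range (2 * d), (Theta j d τ u - Theta (-j) d τ u) *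
      (-(2 * I * √(d / τ.im)) * Real.exp (-(4 * π * d * v.im ^ 2 / τ.im)) *
        conj (Theta (-j) d τ (2 * v)))) v :=
    HasDbar.sum _ fun j _ => (hasDbar_RZwegers hd hτ j v).const_mul _
  have e4 := ((e1.sub e2).hasDbar.add (e3.const_mul (1 / 2)))
  have hfun : phiHat d 0 τ u = fun v => appell d 0 τ u (v + u / 2) - appell d 0 τ (-u) (v - u / 2) +
      1 / 2 * ∑ j ∈ Finset.range (2 * d), (Theta j d τ u - Theta (-j) d τ u) *
      RZwegers j d τ v := by
    funext v
    rw [phiHat]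
    simp only [Nat.cast_zero, sub_zero]
    congr 2
    exact Finset.sum_congr rfl fun j _ => mul_comm _ _
  rw [hfun]
  refine (congrArg (fun b => HasDbar _ b v) ?_).mpr e4
  have hk1 : thetaKernel d τ (-v) u =
      ∑ j ∈ Finset.range (2 * d), conj (Theta (-j) d τ (2 * v)) * Theta j d τ u :=
    Finset.sum_congr rfl fun j _ => by rw [mul_neg, Theta_neg_right hd]
  -- The summand is 2d-periodic in j, so j may be replaced by -j.
  have hk2 : thetaKernel d τ v u =
      ∑ j ∈ Finset.range (2 * d), conj (Theta (-j) d τ (2 * v)) * Theta (-j) d τ u := by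
    have := sum_range_affine (M := 2 * d) (by positivity)
      (f := fun n => conj (Theta n d τ (2 * v)) * Theta n d τ u) (fun n => by
        push_cast
        rw [Theta_add_two_mul hd, Theta_add_two_mul hd]) (c := -1) isCoprime_one_left.neg_left 0
    rw [thetaKernel, ← this]
    exact Finset.sum_congr rfl fun j _ => by simp
  rw [weightedKernel, weightedKernel, hk1, hk2, Complex.neg_im, neg_sq, ← mul_sub,
    ← Finset.sum_sub_distrib, Finset.mul_sum, Finset.mul_sum, Finset.mul_sum, zero_add]
  refine Finset.sum_congr rfl fun j _ => ?_
  ring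

theorem tendsto_sub_mul_of_continuousAt {f : ℂ → ℂ} {p : ℂ} (hf : ContinuousAt f p) :
    Tendsto (fun z => (z - p) * f z) (𝓝[≠] p) (𝓝 0) := by
  have hc : ContinuousAt (fun z => (z - p) * f z) p := ContinuousAt.mul (by fun_prop) hf
  have := hc.tendsto.mono_left (nhdsWithin_le_nhds (s := {p}ᶜ))
  simpa using this

theorem continuous_RZwegers (hd : 0 < d) (hτ : 0 < τ.im) (j : ℤ) : Continuous (RZwegers j d τ) :=
  continuous_iff_continuousAt.2 fun v => (hasDbar_RZwegers hd hτ j v).continuousAt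

/-- The residue of `Φ~` along `z₁ = p - j τ`. -/
theorem tendsto_residue_phiHat (hd : 0 < d) (hτ : 0 < τ.im) {u v₀ : ℂ} {p j : ℤ}
    (h1 : v₀ + u / 2 = p - j * τ) (h2 : v₀ - u / 2 ∉ periodLattice τ) :
    Tendsto (fun v => (v - v₀) * phiHat d 0 τ u v) (𝓝[≠] v₀)
      (𝓝 (-(thetaTerm d τ u (2 * d * j) / (2 * π * I)))) := by
  have hs : Summable fun j : ℤ => thetaTerm d τ u (2 * d * j) := by
    simpa using summable_thetaTerm_affine hd hτ u 0
  have e1 := tendsto_residue_tsum hτ hs ((one_sub_eq_zero_iff j).2 ⟨p, h1⟩)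
  have hmap : Tendsto (fun v => v + u / 2) (𝓝[≠] v₀) (𝓝[≠] (v₀ + u / 2)) := by
    refine tendsto_nhdsWithin_iff.2 ⟨?_, ?_⟩
    · exact (Continuous.tendsto (by fun_prop) v₀).mono_left nhdsWithin_le_nhds
    · filter_upwards [self_mem_nhdsWithin] with v hv h
      exact hv (add_right_cancel h)
  have e2 := e1.comp hmap
  have e3 : ContinuousAt (fun v => -appell d 0 τ (-u) (v - u / 2) +
      1 / 2 * ∑ j ∈ Finset.range (2 * d), RZwegers j d τ v *
      (Theta j d τ u - Theta (-j) d τ u)) v₀ := by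
    refine ContinuousAt.add (ContinuousAt.neg ?_) (Continuous.continuousAt ?_)
    · exact ((differentiableAt_appell_zero hd hτ (-u) h2).comp v₀ (f := fun v => v - u / 2)
        (by fun_prop)).continuousAt
    · exact continuous_const.mul (continuous_finsetSum _ fun j _ =>
        (continuous_RZwegers hd hτ j).mul continuous_const)
  have e4 := e2.add (tendsto_sub_mul_of_continuousAt e3)
  rw [add_zero] at e4
  refine e4.congr fun v => ?_
  simp only [Function.comp, ← appell_zero_eq hd, phiHat, Nat.cast_zero, sub_zero]
  ring

theorem tendsto_residue_phiHat' (hd : 0 < d) (hτ : 0 < τ.im) {u v₀ : ℂ} {p j : ℤ}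
    (h1 : v₀ - u / 2 = p - j * τ) (h2 : v₀ + u / 2 ∉ periodLattice τ) :
    Tendsto (fun v => (v - v₀) * phiHat d 0 τ u v) (𝓝[≠] v₀)
      (𝓝 (thetaTerm d τ (-u) (2 * d * j) / (2 * π * I))) := by
  have h := tendsto_residue_phiHat (u := -u) (v₀ := v₀) hd hτ (by rw [← h1]; ring)
    (by rwa [show v₀ - -u / 2 = v₀ + u / 2 by ring])
  have h3 := h.neg
  rw [neg_neg] at h3
  refine h3.congr fun v => ?_
  rw [phiHat_neg hd]; ring

/-! ### The inversion of the theta kernel -/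

theorem sum_range_exp_eq {N : ℕ} (hN : 0 < N) {n : ℤ} (h : ¬ (N : ℤ) ∣ n) :
    ∑ j ∈ Finset.range N, cexp (2 * π * I * n * j / N) = 0 := by
  have hNc : (N : ℂ) ≠ 0 := by exact_mod_cast hN.ne'
  have hgeom : ∀ j : ℕ, cexp (2 * π * I * n * j / N) = cexp (2 * π * I * n / N) ^ j := by
    intro j
    rw [← Complex.exp_nat_mul]; congr 1; ring
  have h1 : cexp (2 * π * I * n / N) ≠ 1 := by
    intro hcon
    obtain ⟨k, hk⟩ := Complex.exp_eq_one_iff.1 hcon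
    refine h ⟨k, ?_⟩
    have h2 : (2 * π * I) * (n / N : ℂ) = (2 * π * I) * k := by linear_combination hk
    have h3 := mul_left_cancel₀ Complex.two_pi_I_ne_zero h2
    rw [div_eq_iff hNc] at h3
    have : (n : ℂ) = ((N * k : ℤ) : ℂ) := by rw [h3]; push_cast; ring
    exact_mod_cast this
  simp only [hgeom]
  rw [geom_sum_eq h1, ← hgeom]
  have : cexp (2 * π * I * n * N / N) = 1 := by
    refine Complex.exp_eq_one_iff.2 ⟨n, ?_⟩
    field_simp
  rw [this, sub_self, zero_div]

/-- The finite Fourier matrix e^{πijk/d} is unitary up to the factor 2d. In the sesquilinear sum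
over j the cross terms disappear and the kernel reproduces itself. -/
theorem thetaKernel_S (hd : 0 < d) (hτ : 0 < τ.im) (v u : ℂ) :
    thetaKernel d τ v u = (1 / ‖τ‖ : ℝ) * conj (cexp (-(2 * π * I * d * v ^ 2 / τ))) *
      cexp (-(π * I * d * u ^ 2 / (2 * τ))) * thetaKernel d (-1 / τ) (v / τ) (u / τ) := by
  have hdc : (d : ℂ) ≠ 0 := by exact_mod_cast hd.ne'
  have hτ0 : τ ≠ 0 := by rintro rfl; simp at hτ
  set c : ℂ := 1 / (-I * (2 * d * τ)) ^ (1 / 2 : ℂ) with hc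
  -- Only |c|² enters, so the branch of the square root is irrelevant. Its 1/(2d) cancels the 2d
  -- from orthogonality.
  have hcc : conj c * c = ((1 / (2 * d * ‖τ‖) : ℝ) : ℂ) := by
    rw [Complex.conj_mul', ← Complex.ofReal_pow]
    congr 1
    have hne : -I * (2 * d * τ) ≠ 0 := by simp [hτ0, hdc]
    have : ‖c‖ = 1 / ‖-I * (2 * d * τ)‖ ^ (1 / 2 : ℝ) := by
      rw [hc, norm_div, norm_one]
      congr 1
      have := Complex.norm_cpow_of_ne_zero hne (1 / 2 : ℂ)
      rw [this]
      have h1 : (1 / 2 : ℂ) = ((1 / 2 : ℝ) : ℂ) := by push_cast; rfl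
      rw [h1, Complex.ofReal_re, Complex.ofReal_im, mul_zero, Real.exp_zero, div_one]
    rw [this, div_pow, ← Real.sqrt_eq_rpow, Real.sq_sqrt (norm_nonneg _)]
    simp
  set A : ℂ := conj (cexp (-(2 * π * I * d * v ^ 2 / τ))) with hA
  set B : ℂ := cexp (-(π * I * d * u ^ 2 / (2 * τ))) with hB
  set X : ℕ → ℂ := fun k => conj (Theta k d (-1 / τ) (2 * (v / τ))) with hX
  set Y : ℕ → ℂ := fun k => Theta k d (-1 / τ) (u / τ) with hY
  have hterm : ∀ j : ℕ, conj (Theta j d τ (2 * v)) * Theta j d τ u =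
      conj c * c * A * B * ∑ k ∈ Finset.range (2 * d), ∑ l ∈ Finset.range (2 * d),
        X k * Y l * cexp (2 * π * I * ((l : ℤ) - k : ℤ) * j / (2 * d : ℕ)) := by
    intro j
    rw [Theta_S hd hτ j (2 * v), Theta_S hd hτ j u, map_mul, map_mul, map_sum, ← hc]
    have e1 : -(π * I * d * (2 * v) ^ 2 / (2 * τ)) = -(2 * π * I * d * v ^ 2 / τ) := by ring
    rw [e1, ← hA, ← hB]
    rw [show conj c * A * (∑ k ∈ Finset.range (2 * d), conj
        (cexp (π * I * (j : ℤ) * k / d) * Theta k d (-1 / τ) (2 * v / τ))) *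
        (c * B * ∑ k ∈ Finset.range (2 * d), cexp (π * I * (j : ℤ) * k / d) *
          Theta k d (-1 / τ) (u / τ)) = conj c * c * A * B *
        ((∑ k ∈ Finset.range (2 * d), conj
        (cexp (π * I * (j : ℤ) * k / d) * Theta k d (-1 / τ) (2 * v / τ))) *
        ∑ k ∈ Finset.range (2 * d), cexp (π * I * (j : ℤ) * k / d) *
          Theta k d (-1 / τ) (u / τ)) by ring, Finset.sum_mul_sum]
    congr 1
    refine Finset.sum_congr rfl fun k _ => Finset.sum_congr rfl fun l _ => ?_
    have e2 : cexp (2 * π * I * ((l : ℤ) - k : ℤ) * j / (2 * d : ℕ)) =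
        conj (cexp (π * I * (j : ℤ) * k / d)) * cexp (π * I * (j : ℤ) * l / d) := by
      rw [← Complex.exp_conj, ← Complex.exp_add]
      congr 1
      simp only [map_mul, map_div₀, Complex.conj_ofReal, Complex.conj_I, map_natCast, map_intCast]
      push_cast
      field_simp; ring
    rw [e2, hX, hY, map_mul, mul_div_assoc]
    ring_nf
  have horth : ∀ k ∈ Finset.range (2 * d), ∀ l ∈ Finset.range (2 * d),
      ∑ j ∈ Finset.range (2 * d), cexp (2 * π * I * ((l : ℤ) - k : ℤ) * j / (2 * d : ℕ)) =
        if k = l then (2 * d : ℂ) else 0 := by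
    intro k hk l hl
    split_ifs with hkl
    · subst hkl; simp
    · refine sum_range_exp_eq (by positivity) fun hdvd => hkl ?_
      rw [Finset.mem_range] at hk hl
      have := Int.eq_zero_of_abs_lt_dvd hdvd (by rw [abs_lt]; omega)
      omega
  have hsum : ∑ j ∈ Finset.range (2 * d), ∑ k ∈ Finset.range (2 * d), ∑ l ∈ Finset.range (2 * d),
        X k * Y l * cexp (2 * π * I * ((l : ℤ) - k : ℤ) * j / (2 * d : ℕ)) =
      2 * d * ∑ k ∈ Finset.range (2 * d), X k * Y k := by
    rw [Finset.sum_comm, Finset.mul_sum]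
    refine Finset.sum_congr rfl fun k hk => ?_
    rw [Finset.sum_comm]
    have : ∀ l ∈ Finset.range (2 * d), ∑ j ∈ Finset.range (2 * d), X k * Y l *
        cexp (2 * π * I * ((l : ℤ) - k : ℤ) * j / (2 * d : ℕ)) =
        if k = l then X k * Y l * (2 * d) else 0 := by
      intro l hl
      rw [← Finset.mul_sum, horth k hk l hl]
      split_ifs <;> simp
    rw [Finset.sum_congr rfl this, Finset.sum_ite_eq, if_pos hk]
    ring
  have hτn : (‖τ‖ : ℂ) ≠ 0 := by exact_mod_cast norm_ne_zero_iff.2 hτ0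
  rw [thetaKernel, Finset.sum_congr rfl fun j _ => hterm j, ← Finset.mul_sum, hsum, hcc,
    thetaKernel]
  have hXY : ∑ k ∈ Finset.range (2 * d), X k * Y k = ∑ k ∈ Finset.range (2 * d),
      conj (Theta k d (-1 / τ) (2 * (v / τ))) * Theta k d (-1 / τ) (u / τ) := rfl
  rw [← hXY]
  push_cast
  field_simp

theorem im_neg_one_div (τ : ℂ) : (-1 / τ).im = τ.im / ‖τ‖ ^ 2 := by
  rw [neg_div, one_div, Complex.neg_im, Complex.inv_im, Complex.sq_norm]; ring

theorem im_neg_one_div_pos (hτ : 0 < τ.im) : 0 < (-1 / τ).im := by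
  have hτ0 : τ ≠ 0 := by rintro rfl; simp at hτ
  have := norm_pos_iff.2 hτ0
  rw [im_neg_one_div]; positivity

/-- The powers of |τ| match: |τ|⁻² from (1/τ) conj(1/τ), times |τ| from the square root, is the
|τ|⁻¹ of the bare kernel. The Gaussian turns the holomorphic quadratic exponential in v into its
conjugate. -/
theorem weightedKernel_S (hd : 0 < d) (hτ : 0 < τ.im) (v u : ℂ) :
    1 / τ * cexp (-(2 * π * I * d * (u ^ 2 / 4 - v ^ 2) / τ)) *
      (conj (1 / τ) * weightedKernel d (-1 / τ) (v / τ) (u / τ)) = weightedKernel d τ v u := by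
  have hτ0 : τ ≠ 0 := by rintro rfl; simp at hτ
  have hn : ‖τ‖ ≠ 0 := norm_ne_zero_iff.2 hτ0
  have hnc : (‖τ‖ : ℂ) ≠ 0 := by exact_mod_cast hn
  rw [weightedKernel, weightedKernel, thetaKernel_S hd hτ, im_neg_one_div]
  have hsq : √(d / (τ.im / ‖τ‖ ^ 2)) = ‖τ‖ * √(d / τ.im) := by
    rw [show (d : ℝ) / (τ.im / ‖τ‖ ^ 2) = ‖τ‖ ^ 2 * (d / τ.im) by field_simp,
      Real.sqrt_mul (by positivity), Real.sqrt_sq (norm_nonneg _)]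
  have hinv : 1 / τ * conj (1 / τ) = ((1 / ‖τ‖ ^ 2 : ℝ) : ℂ) := by
    rw [Complex.mul_conj']; simp
  have hexp : cexp (-(2 * π * I * d * (u ^ 2 / 4 - v ^ 2) / τ)) *
      (Real.exp (-(4 * π * d * (v / τ).im ^ 2 / (τ.im / ‖τ‖ ^ 2))) : ℂ) =
      (Real.exp (-(4 * π * d * v.im ^ 2 / τ.im)) : ℂ) *
        (conj (cexp (-(2 * π * I * d * v ^ 2 / τ))) * cexp (-(π * I * d * u ^ 2 / (2 * τ)))) := by
    rw [Complex.ofReal_exp, Complex.ofReal_exp, ← Complex.exp_conj, ← Complex.exp_add,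
      ← Complex.exp_add, ← Complex.exp_add]
    congr 1
    set w := v / τ with hw
    have hv : v = w * τ := by rw [hw]; field_simp
    -- Imaginary parts are eliminated in favour of conjugates, so that the exponents agree as
    -- rational functions of w, conj w, τ, conj τ and u.
    have hk1 : (w.im : ℂ) = (w - conj w) / (2 * I) := by
      rw [Complex.sub_conj]; push_cast; field_simp
    have hk2 : (v.im : ℂ) = (w * τ - conj w * conj τ) / (2 * I) := by
      rw [← map_mul, ← hv, Complex.sub_conj]; push_cast; field_simp
    have hk3 : (τ.im : ℂ) = (τ - conj τ) / (2 * I) := by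
      rw [Complex.sub_conj]; push_cast; field_simp
    have hk4 : (‖τ‖ : ℂ) ^ 2 = τ * conj τ := by rw [Complex.mul_conj']
    have hτc : conj τ ≠ 0 := by simpa using hτ0
    have hsub : τ - conj τ ≠ 0 := by
      rw [Complex.sub_conj]
      have : (τ.im : ℂ) ≠ 0 := by exact_mod_cast hτ.ne'
      simp [this]
    push_cast
    rw [hk1, hk2, hk3, hk4, hv]
    simp only [map_neg, map_mul, map_div₀, map_pow, Complex.conj_ofReal, Complex.conj_I, map_ofNat,
      map_natCast]
    field_simp
    ring_nf
    simp only [Complex.I_sq]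
    ring
  rw [hsq]
  push_cast
  calc _ = (1 / τ * conj (1 / τ)) * ‖τ‖ * √(d / τ.im) *
        (cexp (-(2 * π * I * d * (u ^ 2 / 4 - v ^ 2) / τ)) *
      (Real.exp (-(4 * π * d * (v / τ).im ^ 2 / (τ.im / ‖τ‖ ^ 2))) : ℂ)) *
        thetaKernel d (-1 / τ) (v / τ) (u / τ) := by push_cast; ring
    _ = _ := by
      rw [hinv, hexp]
      push_cast
      field_simp

end

section

/-! ### Extension by limits -/

open Classical in
/-- The extension of `f` to `P` by its limits. -/
def limExt (P : Set ℂ) (f : ℂ → ℂ) (z : ℂ) : ℂ :=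
  if z ∈ P then limUnder (𝓝[≠] z) f else f z

section limExt

variable {P : Set ℂ} {f : ℂ → ℂ}

theorem limExt_of_notMem {z : ℂ} (hz : z ∉ P) : limExt P f z = f z := if_neg hz

theorem dense_compl_of_eventually (hP : ∀ z, ∀ᶠ w in 𝓝[≠] z, w ∉ P) : Dense Pᶜ := fun z =>
  mem_closure_iff_frequently.2 ((hP z).frequently.filter_mono nhdsWithin_le_nhds)

theorem limExt_eventuallyEq (hP : ∀ z, ∀ᶠ w in 𝓝[≠] z, w ∉ P) (z : ℂ) :
    limExt P f =ᶠ[𝓝[≠] z] f := by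
  filter_upwards [hP z] with w hw using limExt_of_notMem hw

theorem limExt_eventuallyEq_nhds (hP : ∀ z, ∀ᶠ w in 𝓝[≠] z, w ∉ P) {z : ℂ} (hz : z ∉ P) :
    limExt P f =ᶠ[𝓝 z] f := by
  have h := limExt_eventuallyEq (f := f) hP z
  rw [Filter.EventuallyEq, eventually_nhdsWithin_iff] at h
  filter_upwards [h] with w hw
  by_cases hwz : w = z
  · rw [hwz, limExt_of_notMem hz]
  · exact hw hwz

theorem limExt_eventuallyEq_update (hP : ∀ z, ∀ᶠ w in 𝓝[≠] z, w ∉ P) {z : ℂ} (hz : z ∈ P) :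
    limExt P f =ᶠ[𝓝 z] Function.update f z (limUnder (𝓝[≠] z) f) := by
  have h := limExt_eventuallyEq (f := f) hP z
  rw [Filter.EventuallyEq, eventually_nhdsWithin_iff] at h
  filter_upwards [h] with w hw
  by_cases hwz : w = z
  · rw [hwz, Function.update_self, limExt, if_pos hz]
  · rw [Function.update_of_ne hwz]; exact hw hwz

theorem continuousAt_limExt (hP : ∀ z, ∀ᶠ w in 𝓝[≠] z, w ∉ P) {z c : ℂ} (hz : z ∈ P)
    (h : Tendsto f (𝓝[≠] z) (𝓝 c)) : ContinuousAt (limExt P f) z := by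
  refine ContinuousAt.congr ?_ (limExt_eventuallyEq_update hP hz).symm
  rw [continuousAt_update_same, h.limUnder_eq]
  exact h

theorem continuous_limExt (hP : ∀ z, ∀ᶠ w in 𝓝[≠] z, w ∉ P)
    (h1 : ∀ z ∉ P, ContinuousAt f z) (h2 : ∀ z ∈ P, ∃ c, Tendsto f (𝓝[≠] z) (𝓝 c)) :
    Continuous (limExt P f) := by
  refine continuous_iff_continuousAt.2 fun z => ?_
  by_cases hz : z ∈ P
  · obtain ⟨c, hc⟩ := h2 z hz
    exact continuousAt_limExt hP hz hc
  · exact (h1 z hz).congr (limExt_eventuallyEq_nhds hP hz).symm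

/-- Riemann's removable singularity theorem at each point of P. -/
theorem differentiable_limExt (hP : ∀ z, ∀ᶠ w in 𝓝[≠] z, w ∉ P)
    (h1 : ∀ z ∉ P, DifferentiableAt ℂ f z)
    (h2 : ∀ z ∈ P, Tendsto (fun w => (w - z) * f w) (𝓝[≠] z) (𝓝 0)) :
    Differentiable ℂ (limExt P f) := by
  intro z
  by_cases hz : z ∈ P
  · refine DifferentiableAt.congr_of_eventuallyEq ?_ (limExt_eventuallyEq_update hP hz)
    have h := hP z
    rw [eventually_nhdsWithin_iff] at h
    refine (Complex.differentiableOn_update_limUnder_of_isLittleO h (fun w hw => ?_) ?_).differentiableAt h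
    · exact (h1 w (hw.1 hw.2)).differentiableWithinAt
    · rw [Asymptotics.isLittleO_iff_tendsto']
      · have h3 : Tendsto (fun w => (w - z) * f w - (w - z) * f z) (𝓝[≠] z) (𝓝 0) := by
          have h4 := (h2 z hz).sub (tendsto_sub_mul_of_continuousAt (f := fun _ => f z) (p := z)
            continuousAt_const)
          simpa using h4
        refine h3.congr fun w => ?_
        rw [div_inv_eq_mul]; ring
      · filter_upwards [self_mem_nhdsWithin] with w hw h0
        exact absurd (inv_eq_zero.1 h0) (sub_ne_zero.2 hw)
  · exact (h1 z hz).congr_of_eventuallyEq (limExt_eventuallyEq_nhds hP hz)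

end limExt

theorem tendsto_add_nhdsNE (p c : ℂ) : Tendsto (fun w => w + c) (𝓝[≠] p) (𝓝[≠] (p + c)) := by
  refine tendsto_nhdsWithin_iff.2 ⟨?_, ?_⟩
  · exact (Continuous.tendsto (by fun_prop) p).mono_left nhdsWithin_le_nhds
  · filter_upwards [self_mem_nhdsWithin] with v hv h
    exact hv (add_right_cancel h)

theorem tendsto_mul_nhdsNE {c : ℂ} (hc : c ≠ 0) (p : ℂ) :
    Tendsto (fun w => c * w) (𝓝[≠] p) (𝓝[≠] (c * p)) := by
  refine tendsto_nhdsWithin_iff.2 ⟨?_, ?_⟩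
  · exact (Continuous.tendsto (by fun_prop) p).mono_left nhdsWithin_le_nhds
  · filter_upwards [self_mem_nhdsWithin] with v hv h
    exact hv (mul_left_cancel₀ hc h)

/-! ### Quasi-periodic functions of negative index -/

variable {d : ℕ} {τ : ℂ}

/-- The poles of `Φ~` as a function of `v`, for fixed `u`. -/
def polePoints (τ u : ℂ) : Set ℂ :=
  {v | v + u / 2 ∈ periodLattice τ ∨ v - u / 2 ∈ periodLattice τ}

theorem notMem_polePoints {u v : ℂ} :
    v ∉ polePoints τ u ↔ v + u / 2 ∉ periodLattice τ ∧ v - u / 2 ∉ periodLattice τ := by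
  rw [polePoints, Set.mem_ofPred_eq, not_or]

theorem eventually_notMem_polePoints (hτ : 0 < τ.im) (u z : ℂ) :
    ∀ᶠ w in 𝓝[≠] z, w ∉ polePoints τ u := by
  have h1 := (tendsto_add_nhdsNE z (u / 2)).eventually (eventually_notMem_periodLattice hτ _)
  have h2 := (tendsto_add_nhdsNE z (-(u / 2))).eventually (eventually_notMem_periodLattice hτ _)
  filter_upwards [h1, h2] with w hw1 hw2
  exact notMem_polePoints.2 ⟨hw1, by rwa [sub_eq_add_neg]⟩

theorem add_mem_polePoints_iff {u v w : ℂ} (hw : w ∈ periodLattice τ) :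
    v + w ∈ polePoints τ u ↔ v ∈ polePoints τ u := by
  rw [polePoints, Set.mem_ofPred_eq, Set.mem_ofPred_eq, add_right_comm, add_mem_periodLattice_iff hw,
    add_sub_right_comm, add_mem_periodLattice_iff hw]

theorem norm_exp_two_pi_I_mul_ofReal (κ : ℝ) (z : ℂ) :
    ‖cexp (2 * π * I * κ * z)‖ = Real.exp (-(2 * π * κ * z.im)) := by
  rw [Complex.norm_exp]
  congr 1
  have : 2 * π * I * κ * z = ((2 * π * κ : ℝ) : ℂ) * (I * z) := by push_cast; ring
  rw [this, Complex.re_ofReal_mul, Complex.I_mul_re]; ring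

theorem exists_bound_of_doubly_periodic (hτ : 0 < τ.im) {N : ℕ} (hN : 0 < N) {G : ℂ → ℝ}
    (hG : Continuous G) (h1 : Function.Periodic G (N : ℂ)) (h2 : Function.Periodic G τ) :
    ∃ C, ∀ v, G v ≤ C := by
  have hN' : (0 : ℝ) < N := by exact_mod_cast hN
  have hcpt : IsCompact (Set.Icc (0 : ℝ) N ×ℂ Set.Icc (0 : ℝ) τ.im) :=
    isCompact_Icc.reProdIm isCompact_Icc
  obtain ⟨C, hC⟩ := hcpt.exists_bound_of_continuousOn hG.continuousOn
  refine ⟨C, fun v => ?_⟩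
  -- The multiple of τ is fixed first by the imaginary part, then the multiple of N by the real
  -- part, so v is moved into a compact rectangle.
  set b : ℤ := ⌊v.im / τ.im⌋ with hb
  set w : ℂ := v - b • τ with hw
  set a : ℤ := ⌊w.re / N⌋ with ha
  have e1 : G (w - a • (N : ℂ)) = G v := by
    rw [h1.sub_zsmul_eq, hw, h2.sub_zsmul_eq]
  rw [← e1]
  refine (le_abs_self _).trans (hC _ ?_)
  have f1 := Int.floor_le (v.im / τ.im)
  have f2 := Int.lt_floor_add_one (v.im / τ.im)
  have f3 := Int.floor_le (w.re / N)
  have f4 := Int.lt_floor_add_one (w.re / N)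
  rw [← hb] at f1 f2
  rw [← ha] at f3 f4
  rw [le_div_iff₀ hτ] at f1
  rw [div_lt_iff₀ hτ] at f2
  rw [le_div_iff₀ hN'] at f3
  rw [div_lt_iff₀ hN'] at f4
  rw [Complex.mem_reProdIm]
  have him : (w - a • (N : ℂ)).im = v.im - b * τ.im := by
    rw [hw]; simp
  have hre : (w - a • (N : ℂ)).re = w.re - a * N := by simp
  rw [him, hre]
  constructor <;> constructor <;> linarith

/-- A quasi-periodic entire function of negative index vanishes: ‖E‖ times a growing Gaussian in Im
v is doubly periodic, hence bounded, so E is constant by Liouville, and a constant is incompatible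
with the multiplier. Residues need checking only at integral z₁ or -z₂, as quasi-periodicity carries
them along τ. -/
theorem eq_zero_of_quasiPeriodic (hτ : 0 < τ.im) {N : ℕ} (hN : 0 < N) {κ : ℝ} (hκ : 0 < κ)
    {u : ℂ} {D : ℂ → ℂ} (hdiff : ∀ v ∉ polePoints τ u, DifferentiableAt ℂ D v)
    (hper : ∀ v ∉ polePoints τ u, D (v + N) = D v)
    (hquasi : ∀ v ∉ polePoints τ u, D (v + τ) = cexp (2 * π * I * κ * (2 * v + τ)) * D v)
    (hres : ∀ (v : ℂ) (n : ℤ), v + u / 2 = n ∨ v - u / 2 = n →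
      Tendsto (fun w => (w - v) * D w) (𝓝[≠] v) (𝓝 0)) :
    ∀ v ∉ polePoints τ u, D v = 0 := by
  set P := polePoints τ u with hPdef
  have hP : ∀ z, ∀ᶠ w in 𝓝[≠] z, w ∉ P := eventually_notMem_polePoints hτ u
  have hup : ∀ p, Tendsto (fun w => (w - p) * D w) (𝓝[≠] p) (𝓝 0) →
      Tendsto (fun w => (w - (p + τ)) * D w) (𝓝[≠] (p + τ)) (𝓝 0) := by
    intro p h
    have hm := tendsto_add_nhdsNE (p + τ) (-τ)
    rw [add_neg_cancel_right] at hm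
    have h3 : Tendsto (fun w => cexp (2 * π * I * κ * (2 * w + τ)) * ((w - p) * D w))
        (𝓝[≠] p) (𝓝 0) := by
      have hc : Tendsto (fun w => cexp (2 * π * I * κ * (2 * w + τ))) (𝓝[≠] p)
          (𝓝 (cexp (2 * π * I * κ * (2 * p + τ)))) :=
        (Continuous.tendsto (by fun_prop) p).mono_left nhdsWithin_le_nhds
      simpa using hc.mul h
    refine (h3.comp hm).congr' ?_
    filter_upwards [hm.eventually (hP p)] with w hw
    have := hquasi _ hw
    rw [neg_add_cancel_right] at this
    simp only [Function.comp]
    rw [this]; ring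
  have hdown : ∀ p, Tendsto (fun w => (w - (p + τ)) * D w) (𝓝[≠] (p + τ)) (𝓝 0) →
      Tendsto (fun w => (w - p) * D w) (𝓝[≠] p) (𝓝 0) := by
    intro p h
    have h3 := h.comp (tendsto_add_nhdsNE p τ)
    have hc : Tendsto (fun w => cexp (-(2 * π * I * κ * (2 * w + τ)))) (𝓝[≠] p)
        (𝓝 (cexp (-(2 * π * I * κ * (2 * p + τ))))) :=
      (Continuous.tendsto (by fun_prop) p).mono_left nhdsWithin_le_nhds
    have h4 := hc.mul h3
    rw [mul_zero] at h4
    refine h4.congr' ?_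
    filter_upwards [hP p] with w hw
    simp only [Function.comp]
    rw [hquasi w hw, Complex.exp_neg]
    field_simp [Complex.exp_ne_zero]
    ring
  have hall : ∀ (p : ℂ), Tendsto (fun w => (w - p) * D w) (𝓝[≠] p) (𝓝 0) →
      ∀ q : ℤ, Tendsto (fun w => (w - (p + q * τ)) * D w) (𝓝[≠] (p + q * τ)) (𝓝 0) := by
    intro p h q
    induction q using Int.induction_on with
    | zero => simpa using h
    | succ i ih =>
      have := hup _ ih
      rwa [show p + (i : ℤ) * τ + τ = p + ((i : ℤ) + 1 : ℤ) * τ by push_cast; ring] at this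
    | pred i ih =>
      refine hdown _ ?_
      rwa [show p + (-(i : ℤ) - 1 : ℤ) * τ + τ = p + (-(i : ℤ) : ℤ) * τ by push_cast; ring]
  have hresP : ∀ p ∈ P, Tendsto (fun w => (w - p) * D w) (𝓝[≠] p) (𝓝 0) := by
    rintro p (⟨n, q, h⟩ | ⟨n, q, h⟩)
    · have := hall _ (hres (p - q * τ) n (Or.inl (by linear_combination h))) q
      rwa [sub_add_cancel] at this
    · have := hall _ (hres (p - q * τ) n (Or.inr (by linear_combination h))) q
      rwa [sub_add_cancel] at this
  set E := limExt P D with hE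
  have hEd : Differentiable ℂ E := differentiable_limExt hP hdiff hresP
  have hEc := hEd.continuous
  have hdense := dense_compl_of_eventually hP
  have hE1 : ∀ v, E (v + N) = E v := by
    have : (fun v => E (v + N)) = E := by
      refine Continuous.ext_on hdense (by fun_prop) hEc fun v hv => ?_
      have hv' : v + N ∉ P := by
        rw [hPdef, add_mem_polePoints_iff ⟨N, 0, by simp⟩]; exact hv
      simp only [hE]
      rw [limExt_of_notMem hv, limExt_of_notMem hv', hper v hv]
    exact congrFun this
  have hE2 : ∀ v, E (v + τ) = cexp (2 * π * I * κ * (2 * v + τ)) * E v := by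
    have : (fun v => E (v + τ)) = fun v => cexp (2 * π * I * κ * (2 * v + τ)) * E v := by
      refine Continuous.ext_on hdense (by fun_prop) (by fun_prop) fun v hv => ?_
      have hv' : v + τ ∉ P := by
        rw [hPdef, add_mem_polePoints_iff (self_mem_periodLattice τ)]; exact hv
      simp only [hE]
      rw [limExt_of_notMem hv, limExt_of_notMem hv', hquasi v hv]
    exact congrFun this
  -- The multiplier has modulus e^{-2πκ(2 Im v + Im τ)}, and this is exactly compensated by the
  -- change of e^{2πκ(Im v)²/Im τ} under v ↦ v + τ.
  obtain ⟨C, hC⟩ := exists_bound_of_doubly_periodic hτ hN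
    (G := fun v => ‖E v‖ * Real.exp (2 * π * κ / τ.im * v.im ^ 2)) (by fun_prop)
    (fun v => by simp [hE1]) (fun v => by
      simp only
      rw [hE2, norm_mul, norm_exp_two_pi_I_mul_ofReal, mul_right_comm, ← Real.exp_add, mul_comm]
      congr 2
      have : (2 * v + τ).im = 2 * v.im + τ.im := by simp
      rw [this, Complex.add_im]
      field_simp
      ring)
  have hbd : ∀ v, ‖E v‖ ≤ C := fun v => by
    refine le_trans ?_ (hC v)
    refine le_mul_of_one_le_right (norm_nonneg _) (Real.one_le_exp ?_)
    positivity
  have hconst : ∀ v w, E v = E w := fun v w => by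
    refine hEd.apply_eq_apply_of_bounded ?_ v w
    exact isBounded_iff_forall_norm_le.2 ⟨C, by rintro _ ⟨x, rfl⟩; exact hbd x⟩
  have hE0 : E 0 = 0 := by
    have h := hE2 0
    rw [hconst (0 + τ) 0] at h
    by_contra hne
    have h1 : cexp (2 * π * I * κ * (2 * 0 + τ)) = 1 := by
      have := mul_right_cancel₀ hne (h.symm.trans (one_mul (E 0)).symm)
      exact this
    -- A nonzero constant would force the multiplier at v = 0 to be 1, but its modulus is e^{-2πκ Im
    -- τ} < 1.
    have h2 := norm_exp_two_pi_I_mul_ofReal κ (2 * 0 + τ)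
    rw [h1, norm_one, mul_zero, zero_add] at h2
    have : Real.exp (-(2 * π * κ * τ.im)) < 1 := by
      rw [Real.exp_lt_one_iff]
      have := Real.pi_pos
      have : 0 < 2 * π * κ * τ.im := by positivity
      linarith
    linarith
  intro v hv
  rw [← limExt_of_notMem (f := D) hv]
  exact (hconst v 0).trans hE0

/-! ### Inversion of the modified function -/

theorem div_mem_periodLattice_neg_inv (hτ : τ ≠ 0) {z : ℂ} :
    z / τ ∈ periodLattice (-1 / τ) ↔ z ∈ periodLattice τ := by
  constructor
  · rintro ⟨p, q, h⟩
    refine ⟨-q, p, ?_⟩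
    rw [div_eq_iff hτ] at h
    rw [h]; push_cast; field_simp; ring
  · rintro ⟨p, q, rfl⟩
    refine ⟨q, -p, ?_⟩
    push_cast; field_simp; ring

theorem div_mem_polePoints_neg_inv (hτ : τ ≠ 0) {u v : ℂ} :
    v / τ ∈ polePoints (-1 / τ) (u / τ) ↔ v ∈ polePoints τ u := by
  rw [polePoints, polePoints, Set.mem_ofPred_eq, Set.mem_ofPred_eq,
    ← div_mem_periodLattice_neg_inv hτ, ← div_mem_periodLattice_neg_inv hτ (z := v - u / 2)]
  rw [show (v + u / 2) / τ = v / τ + u / τ / 2 by ring,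
    show (v - u / 2) / τ = v / τ - u / τ / 2 by ring]

/-- The deviation of `Φ~` from being invariant under inversion. -/
def inversionDefect (d : ℕ) (τ u v : ℂ) : ℂ :=
  1 / τ * cexp (-(2 * π * I * d * (u ^ 2 / 4 - v ^ 2) / τ)) *
    phiHat d 0 (-1 / τ) (u / τ) (v / τ) - phiHat d 0 τ u v

theorem inversionDefect_neg (hd : 0 < d) (τ u v : ℂ) :
    inversionDefect d τ (-u) v = -inversionDefect d τ u v := by
  rw [inversionDefect, inversionDefect, neg_div τ u, phiHat_neg hd, phiHat_neg hd, neg_sq]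
  ring

/-- The condition on u keeps the second family of poles away. The point z₁ = n is the pole j = 0 for
τ, and n/τ = 0 - n(-1/τ) is the pole j = n for -1/τ; their residues match after the exponential
prefactor. -/
theorem tendsto_inversionDefect (hd : 0 < d) (hτ : 0 < τ.im) {u : ℂ} (hu : u ∉ periodLattice τ)
    {v₀ : ℂ} {n : ℤ} (h : v₀ + u / 2 = n) :
    Tendsto (fun w => (w - v₀) * inversionDefect d τ u w) (𝓝[≠] v₀) (𝓝 0) := by
  have hτ0 : τ ≠ 0 := by rintro rfl; simp at hτ
  have hdc : (d : ℂ) ≠ 0 := by exact_mod_cast hd.ne'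
  have hv2 : v₀ - u / 2 ∉ periodLattice τ := by
    rw [show v₀ - u / 2 = -u + n by linear_combination h,
      add_mem_periodLattice_iff (intCast_mem_periodLattice τ n), neg_mem_periodLattice]
    exact hu
  have hv2' : v₀ / τ - u / τ / 2 ∉ periodLattice (-1 / τ) := by
    rw [show v₀ / τ - u / τ / 2 = (v₀ - u / 2) / τ by ring, div_mem_periodLattice_neg_inv hτ0]
    exact hv2
  have e1 := tendsto_residue_phiHat hd hτ (p := n) (j := 0) (by rw [h]; simp) hv2
  have e2 := tendsto_residue_phiHat hd (im_neg_one_div_pos hτ) (u := u / τ) (v₀ := v₀ / τ)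
    (p := 0) (j := n) (by
      rw [show v₀ / τ + u / τ / 2 = (v₀ + u / 2) / τ by ring, h]; push_cast; ring) hv2'
  have hm := tendsto_mul_nhdsNE (inv_ne_zero hτ0) v₀
  rw [inv_mul_eq_div] at hm
  have e3 := e2.comp hm
  have e4 : Tendsto (fun w => cexp (-(2 * π * I * d * (u ^ 2 / 4 - w ^ 2) / τ))) (𝓝[≠] v₀)
      (𝓝 (cexp (-(2 * π * I * d * (u ^ 2 / 4 - v₀ ^ 2) / τ)))) :=
    (Continuous.tendsto (by fun_prop) v₀).mono_left nhdsWithin_le_nhds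
  have e5 := (e4.mul e3).sub e1
  have hlim : cexp (-(2 * π * I * d * (u ^ 2 / 4 - v₀ ^ 2) / τ)) *
      -(thetaTerm d (-1 / τ) (u / τ) (2 * d * n) / (2 * π * I)) -
      -(thetaTerm d τ u (2 * d * 0) / (2 * π * I)) = 0 := by
    have h1 : cexp (-(2 * π * I * d * (u ^ 2 / 4 - v₀ ^ 2) / τ)) *
        thetaTerm d (-1 / τ) (u / τ) (2 * d * n) = 1 := by
      have hv : v₀ = n - u / 2 := by linear_combination h
      rw [thetaTerm, ← Complex.exp_add, hv, Complex.exp_eq_one_iff]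
      refine ⟨0, ?_⟩
      push_cast
      field_simp
      ring
    have h2 : thetaTerm d τ u (2 * d * 0) = 1 := by simp [thetaTerm]
    rw [mul_neg, ← mul_div_assoc, h1, h2]; ring
  rw [hlim] at e5
  refine e5.congr fun w => ?_
  simp only [Function.comp, inversionDefect, inv_mul_eq_div]
  field_simp

/-- The vanishing theorem with N = 1 and κ = d. Holomorphy is the inversion of the weighted kernel
at v and -v. The two sides exchange roles: v ↦ v + 1 shifts v/τ by minus the modulus -1/τ, and v ↦ v
+ τ shifts it by 1. -/
theorem phiHat_S_aux (hd : 0 < d) (hτ : 0 < τ.im) {u : ℂ} (hu : u ∉ periodLattice τ) :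
    ∀ v ∉ polePoints τ u, inversionDefect d τ u v = 0 := by
  have hτ0 : τ ≠ 0 := by rintro rfl; simp at hτ
  have hτ' := im_neg_one_div_pos hτ
  refine eq_zero_of_quasiPeriodic hτ one_pos (κ := d) (by exact_mod_cast hd) ?_ ?_ ?_ ?_
  · intro v hv
    have hv' := (div_mem_polePoints_neg_inv hτ0).not.2 hv
    obtain ⟨h1, h2⟩ := notMem_polePoints.1 hv
    obtain ⟨h1', h2'⟩ := notMem_polePoints.1 hv'
    have e1 := hasDbar_phiHat hd hτ h1 h2
    have e2 := hasDbar_phiHat hd hτ' h1' h2'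
    have e3 := HasDbar.comp_affine (v := v) (1 / τ) 0
      (by rwa [show 1 / τ * v + 0 = v / τ by ring])
    have hg : DifferentiableAt ℂ
        (fun v => 1 / τ * cexp (-(2 * π * I * d * (u ^ 2 / 4 - v ^ 2) / τ))) v := by fun_prop
    have e4 := (e3.mul_differentiableAt hg).sub e1
    have hzero : 1 / τ * cexp (-(2 * π * I * d * (u ^ 2 / 4 - v ^ 2) / τ)) *
        (conj (1 / τ) * (-I * (weightedKernel d (-1 / τ) (-(v / τ)) (u / τ) -
          weightedKernel d (-1 / τ) (v / τ) (u / τ)))) -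
        -I * (weightedKernel d τ (-v) u - weightedKernel d τ v u) = 0 := by
      have k1 := weightedKernel_S hd hτ v u
      have k2 := weightedKernel_S hd hτ (-v) u
      rw [neg_sq, neg_div τ v] at k2
      linear_combination (-I) * (k2 - k1)
    rw [hzero] at e4
    have := e4.differentiableAt
    refine this.congr_of_eventuallyEq (Eventually.of_forall fun w => ?_)
    simp only [inversionDefect]
    rw [show 1 / τ * w + 0 = w / τ by ring]
  · intro v hv
    have hv1 : v - 1 ∉ polePoints τ u ∧ v + 1 ∉ polePoints τ u := by
      refine ⟨?_, (add_mem_polePoints_iff (one_mem_periodLattice τ)).not.2 hv⟩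
      rw [sub_eq_add_neg]
      exact (add_mem_polePoints_iff (neg_mem_periodLattice.2 (one_mem_periodLattice τ))).not.2 hv
    have hv' := (div_mem_polePoints_neg_inv hτ0).not.2 hv1.2
    obtain ⟨h1', h2'⟩ := notMem_polePoints.1 hv'
    have e := phiHat_add_tau_right hd hτ' h1' h2'
    rw [show (v + 1) / τ + -1 / τ = v / τ by ring] at e
    rw [Nat.cast_one, inversionDefect, inversionDefect, phiHat_add_one_right hd, e]
    have hexp : cexp (-(2 * π * I * d * (u ^ 2 / 4 - (v + 1) ^ 2) / τ)) =
        cexp (-(2 * π * I * d * (u ^ 2 / 4 - v ^ 2) / τ)) *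
          cexp (2 * π * I * d * (2 * ((v + 1) / τ) + -1 / τ)) := by
      rw [← Complex.exp_add]; congr 1; field_simp; ring
    rw [hexp]; ring
  · intro v hv
    obtain ⟨h1, h2⟩ := notMem_polePoints.1 hv
    have e := phiHat_add_tau_right hd hτ h1 h2
    have hexp : cexp (-(2 * π * I * d * (u ^ 2 / 4 - (v + τ) ^ 2) / τ)) =
        cexp (2 * π * I * (d : ℝ) * (2 * v + τ)) *
          cexp (-(2 * π * I * d * (u ^ 2 / 4 - v ^ 2) / τ)) := by
      rw [← Complex.exp_add]; congr 1; push_cast; field_simp; ring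
    rw [inversionDefect, inversionDefect, e, hexp, add_div, div_self hτ0,
      phiHat_add_one_right hd]
    push_cast
    ring
  · rintro v n (h | h)
    · exact tendsto_inversionDefect hd hτ hu h
    · have h' : v + -u / 2 = n := by rw [← h]; ring
      have := (tendsto_inversionDefect hd hτ (neg_mem_periodLattice.not.2 hu) h').neg
      rw [neg_zero] at this
      refine this.congr fun w => ?_
      rw [inversionDefect_neg hd]; ring

theorem phiHat_S (hd : 0 < d) (hτ : 0 < τ.im) {u v : ℂ} (hu : u ∉ periodLattice τ)
    (hv : v ∉ polePoints τ u) :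
    phiHat d 0 (-1 / τ) (u / τ) (v / τ) =
      τ * cexp (2 * π * I * d * (u ^ 2 / 4 - v ^ 2) / τ) * phiHat d 0 τ u v := by
  have hτ0 : τ ≠ 0 := by rintro rfl; simp at hτ
  have h := phiHat_S_aux hd hτ hu v hv
  rw [inversionDefect, sub_eq_zero] at h
  rw [← h, Complex.exp_neg]
  field_simp [Complex.exp_ne_zero]

end

section

/-! ### Change of level: the kernel -/

variable {d M : ℕ} {τ : ℂ}

theorem im_natCast_mul (M : ℕ) (τ : ℂ) : ((M : ℂ) * τ).im = M * τ.im := by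
  simp

theorem im_div_natCast (M : ℕ) (τ : ℂ) : (τ / (M : ℂ)).im = τ.im / M := by
  simp

theorem Theta_add_two_mul_mul (hd : 0 < d) (j k : ℤ) (τ z : ℂ) :
    Theta (2 * d * k + j) d τ z = Theta j d τ z := by
  have hper : Function.Periodic (fun j : ℤ => Theta j d τ z) (2 * d) :=
    fun j => Theta_add_two_mul hd j τ z
  have := hper.zsmul k j
  simp only [smul_eq_mul] at this
  rw [← this]; congr 1; ring

theorem summable_conj_thetaTerm_mul (hd : 0 < d) (hτ : 0 < τ.im) (w : ℂ) {g : ℤ → ℂ} {C : ℝ}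
    (hg : ∀ n, ‖g n‖ ≤ C) : Summable fun n => conj (thetaTerm d τ w n) * g n := by
  refine Summable.of_norm_bounded ((summable_thetaTerm hd hτ w).norm.mul_right C) fun n => ?_
  rw [norm_mul, RCLike.norm_conj]
  exact mul_le_mul_of_nonneg_left (hg n) (norm_nonneg _)

/-- Since Θ_n depends only on n mod 2d, the sum over j and the series of the conjugated theta
function merge into one sum over ℤ, which can then be cut into other residue classes. -/
theorem thetaKernel_eq_tsum (hd : 0 < d) (hτ : 0 < τ.im) (v u : ℂ) :
    thetaKernel d τ v u = ∑' n : ℤ, conj (thetaTerm d τ (2 * v) n) * Theta n d τ u := by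
  obtain ⟨C, hC⟩ := exists_norm_Theta_le hd τ u
  rw [tsum_eq_sum_residue (M := 2 * d) (by positivity)
    (summable_conj_thetaTerm_mul hd hτ (2 * v) hC), thetaKernel]
  refine Finset.sum_congr rfl fun j _ => ?_
  rw [Theta_eq_tsum hd j τ (2 * v), Complex.conj_tsum, ← tsum_mul_right]
  refine tsum_congr fun n => ?_
  push_cast
  rw [Theta_add_two_mul_mul hd]

theorem thetaTerm_div (hd : 0 < d) (hM : 0 < M) (τ z : ℂ) (n : ℤ) :
    thetaTerm d (τ / M) z n = thetaTerm (d * M) τ z n := by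
  have hdc : (d : ℂ) ≠ 0 := by exact_mod_cast hd.ne'
  have hMc : (M : ℂ) ≠ 0 := by exact_mod_cast hM.ne'
  rw [thetaTerm, thetaTerm]; congr 1; push_cast; field_simp

theorem Theta_div_eq_sum (hd : 0 < d) (hM : 0 < M) (hτ : 0 < τ.im) (n : ℤ) (z : ℂ) :
    Theta n d (τ / M) z = ∑ b ∈ Finset.range M, Theta (n + 2 * d * b) (d * M) τ z := by
  have hdM : 0 < d * M := Nat.mul_pos hd hM
  have hs : Summable fun l : ℤ => thetaTerm (d * M) τ z (2 * d * l + n) :=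
    (summable_thetaTerm hdM hτ z).comp_injective (injective_affine (by positivity) n)
  rw [Theta_eq_tsum hd]
  simp only [thetaTerm_div hd hM]
  rw [tsum_eq_sum_residue hM hs]
  refine Finset.sum_congr rfl fun b _ => ?_
  rw [Theta_eq_tsum hdM]
  refine tsum_congr fun l => ?_
  congr 1; push_cast; ring

theorem thetaTerm_mul (hd : 0 < d) (hM : 0 < M) (τ z : ℂ) (n s : ℤ) :
    thetaTerm (d * M) τ (z / M) (M * n + d * s) =
      cexp (π * I * d * s * z / M + π * I * d * (s : ℂ) ^ 2 * τ / (2 * M)) *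
        thetaTerm d (M * τ) (z + s * τ) n := by
  have hdc : (d : ℂ) ≠ 0 := by exact_mod_cast hd.ne'
  have hMc : (M : ℂ) ≠ 0 := by exact_mod_cast hM.ne'
  rw [thetaTerm, thetaTerm, ← Complex.exp_add]
  congr 1; push_cast; field_simp; ring

/-- Multiples of M in the index pass to level Mτ, while the part ds becomes a shift of the argument
by sτ. -/
theorem Theta_mul (hd : 0 < d) (hM : 0 < M) (τ z : ℂ) (n s : ℤ) :
    Theta (M * n + d * s) (d * M) τ (z / M) =
      cexp (π * I * d * s * z / M + π * I * d * (s : ℂ) ^ 2 * τ / (2 * M)) *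
        Theta n d (M * τ) (z + s * τ) := by
  rw [Theta_eq_tsum (Nat.mul_pos hd hM), Theta_eq_tsum hd, ← tsum_mul_left]
  refine tsum_congr fun l => ?_
  rw [← thetaTerm_mul hd hM]
  congr 1; push_cast; ring

/-- At τ/M the thetas of degree d are sums of thetas of degree dM, which brings in b mod M. The
summation index is then written as Mn + d(a - b), possible because d is invertible mod M. -/
theorem thetaKernel_div (hd : 0 < d) (hM : 0 < M) (hdM : IsCoprime (d : ℤ) (M : ℤ))
    (hτ : 0 < τ.im) (v u : ℂ) :
    thetaKernel d (τ / M) (v / M) (u / M) =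
      ∑ a ∈ Finset.range M, ∑ b ∈ Finset.range M,
        conj (cexp (π * I * d * ((a : ℤ) - b : ℤ) * (2 * v) / M +
          π * I * d * (((a : ℤ) - b : ℤ) : ℂ) ^ 2 * τ / (2 * M))) *
        cexp (π * I * d * ((a : ℤ) + b : ℤ) * u / M +
          π * I * d * (((a : ℤ) + b : ℤ) : ℂ) ^ 2 * τ / (2 * M)) *
        thetaKernel d (M * τ) (v + (a - b) * τ / 2) (u + (a + b) * τ) := by
  have hdM' : 0 < d * M := Nat.mul_pos hd hM
  have hMr : (0 : ℝ) < M := by exact_mod_cast hM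
  have hτM : 0 < (τ / M).im := by rw [im_div_natCast]; positivity
  have hτM' : 0 < (M * τ).im := by rw [im_natCast_mul]; positivity
  obtain ⟨C, hC⟩ := exists_norm_Theta_le hdM' τ (u / M)
  have hs : ∀ b : ℕ, Summable fun n : ℤ => conj (thetaTerm (d * M) τ (2 * v / M) n) *
      Theta (n + 2 * d * b) (d * M) τ (u / M) := fun b =>
    summable_conj_thetaTerm_mul hdM' hτ _ fun n => hC _
  have h1 : thetaKernel d (τ / M) (v / M) (u / M) = ∑ b ∈ Finset.range M, ∑' n : ℤ,
      conj (thetaTerm (d * M) τ (2 * v / M) n) * Theta (n + 2 * d * b) (d * M) τ (u / M) := by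
    rw [thetaKernel_eq_tsum hd hτM, ← Summable.tsum_finsetSum fun b _ => hs b]
    refine tsum_congr fun n => ?_
    rw [Theta_div_eq_sum hd hM hτ, thetaTerm_div hd hM, Finset.mul_sum, mul_div_assoc]
  rw [h1, Finset.sum_comm]
  refine Finset.sum_congr rfl fun b _ => ?_
  -- The offset -db makes the two indices symmetric, Mn + d(a - b) and Mn + d(a + b). These give the
  -- shifts of 2v and u.
  rw [tsum_eq_sum_affine hM (hs b) hdM (-(d * b))]
  refine Finset.sum_congr rfl fun a _ => ?_
  rw [thetaKernel_eq_tsum hd hτM', ← tsum_mul_left]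
  refine tsum_congr fun n => ?_
  rw [show (M * n + (d * (a : ℤ) + -(d * b)) : ℤ) = M * n + d * ((a : ℤ) - b) by ring,
    show (M * n + d * ((a : ℤ) - b) + 2 * d * b : ℤ) = M * n + d * ((a : ℤ) + b) by ring,
    thetaTerm_mul hd hM, Theta_mul hd hM, map_mul]
  have e1 : 2 * v + (((a : ℤ) - b : ℤ) : ℂ) * τ = 2 * (v + (a - b) * τ / 2) := by
    push_cast; ring
  have e2 : u + (((a : ℤ) + b : ℤ) : ℂ) * τ = u + (a + b) * τ := by push_cast; ring
  rw [e1, e2]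
  ring

/-- The exponential prefactors in the change of level. -/
def levelFactor (d M : ℕ) (τ u v : ℂ) (a b : ℤ) : ℂ :=
  cexp (2 * π * I * (d * (a * b) * τ / M + d * (b * (u / 2 + v) + a * (u / 2 - v)) / M))

theorem weightedKernel_div (hd : 0 < d) (hM : 0 < M) (hdM : IsCoprime (d : ℤ) (M : ℤ))
    (hτ : 0 < τ.im) (v u : ℂ) :
    1 / M * weightedKernel d (τ / M) (v / M) (u / M) =
      ∑ a ∈ Finset.range M, ∑ b ∈ Finset.range M, levelFactor d M τ u v a b *
        weightedKernel d (M * τ) (v + (a - b) * τ / 2) (u + (a + b) * τ) := by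
  have hMr : (0 : ℝ) < M := by exact_mod_cast hM
  have hMc : (M : ℂ) ≠ 0 := by exact_mod_cast hM.ne'
  have hτc : (τ.im : ℂ) ≠ 0 := by exact_mod_cast hτ.ne'
  rw [weightedKernel, thetaKernel_div hd hM hdM hτ, Finset.mul_sum, Finset.mul_sum]
  refine Finset.sum_congr rfl fun a _ => ?_
  rw [Finset.mul_sum, Finset.mul_sum]
  refine Finset.sum_congr rfl fun b _ => ?_
  rw [weightedKernel, im_div_natCast, im_div_natCast, im_natCast_mul]
  have hsq : √(d / (τ.im / M)) = M * √(d / (M * τ.im)) := by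
    rw [show (d : ℝ) / (τ.im / M) = (M : ℝ) ^ 2 * (d / (M * τ.im)) by field_simp,
      Real.sqrt_mul (by positivity), Real.sqrt_sq hMr.le]
  have hvim : (v + (a - b) * τ / 2).im = v.im + (a - b) * τ.im / 2 := by
    have : v + ((a : ℂ) - b) * τ / 2 = v + (((a - b) / 2 : ℝ) : ℂ) * τ := by push_cast; ring
    rw [this, Complex.add_im, Complex.im_ofReal_mul]; ring
  have hexp : (Real.exp (-(4 * π * d * (v.im / M) ^ 2 / (τ.im / M))) : ℂ) *
      (conj (cexp (π * I * d * ((a : ℤ) - b : ℤ) * (2 * v) / M +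
          π * I * d * (((a : ℤ) - b : ℤ) : ℂ) ^ 2 * τ / (2 * M))) *
        cexp (π * I * d * ((a : ℤ) + b : ℤ) * u / M +
          π * I * d * (((a : ℤ) + b : ℤ) : ℂ) ^ 2 * τ / (2 * M))) =
      levelFactor d M τ u v a b *
        (Real.exp (-(4 * π * d * (v + (a - b) * τ / 2).im ^ 2 / (M * τ.im))) : ℂ) := by
    rw [hvim, levelFactor, Complex.ofReal_exp, Complex.ofReal_exp, ← Complex.exp_conj,
      ← Complex.exp_add, ← Complex.exp_add, ← Complex.exp_add]
    congr 1
    have hv : conj v = v - 2 * I * v.im := by apply Complex.ext <;> simp; ring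
    have ht : conj τ = τ - 2 * I * τ.im := by apply Complex.ext <;> simp; ring
    simp only [map_add, map_mul, map_div₀, map_pow, Complex.conj_ofReal, Complex.conj_I, map_ofNat,
      map_natCast, map_intCast, hv, ht]
    push_cast
    field_simp
    ring_nf
    simp only [Complex.I_sq]
    ring
  have hc : ∀ x y w : ℂ, 1 / (M : ℂ) * (M * x * y * w) = x * y * w := by
    intro x y w; field_simp
  rw [hsq, Complex.ofReal_mul, Complex.ofReal_natCast, hc]
  linear_combination ((√(d / (M * τ.im)) : ℂ) *
    thetaKernel d (M * τ) (v + (a - b) * τ / 2) (u + (a + b) * τ)) * hexp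

end

section

/-! ### Change of level of the modified function -/

variable {d M : ℕ} {τ : ℂ}

theorem mem_periodLattice_of_natCast_mul {z : ℂ} (h : z ∈ periodLattice (M * τ)) :
    z ∈ periodLattice τ := by
  obtain ⟨p, q, rfl⟩ := h
  exact ⟨p, q * M, by push_cast; ring⟩

theorem mem_periodLattice_of_div {z : ℂ} (hM : 0 < M) (h : z / M ∈ periodLattice (τ / M)) :
    z ∈ periodLattice τ := by
  have hMc : (M : ℂ) ≠ 0 := by exact_mod_cast hM.ne'
  obtain ⟨p, q, h⟩ := h
  rw [div_eq_iff hMc] at h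
  exact ⟨p * M, q, by rw [h]; push_cast; field_simp⟩

theorem mul_self_mem_periodLattice (n : ℤ) : (n : ℂ) * τ ∈ periodLattice τ := ⟨0, n, by simp⟩

/-- The shifted functions occurring in the change of level. -/
def levelTerm (d M : ℕ) (τ u v : ℂ) (a b : ℤ) : ℂ :=
  levelFactor d M τ u v a b * phiHat d 0 (M * τ) (u + (a + b) * τ) (v + (a - b) * τ / 2)

theorem levelTerm_notMem_polePoints {u v : ℂ} (hv : v ∉ polePoints τ u) (a b : ℤ) :
    v + (a - b) * τ / 2 ∉ polePoints (M * τ) (u + (a + b) * τ) := by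
  obtain ⟨h1, h2⟩ := notMem_polePoints.1 hv
  refine notMem_polePoints.2 ⟨fun h => h1 ?_, fun h => h2 ?_⟩
  · have := mem_periodLattice_of_natCast_mul h
    rw [show v + (a - b) * τ / 2 + (u + (a + b) * τ) / 2 = v + u / 2 + (a : ℂ) * τ by ring] at this
    exact (add_mem_periodLattice_iff (mul_self_mem_periodLattice a)).1 this
  · have := mem_periodLattice_of_natCast_mul h
    rw [show v + (a - b) * τ / 2 - (u + (a + b) * τ) / 2 = v - u / 2 + ((-b : ℤ) : ℂ) * τ by
      push_cast; ring] at this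
    exact (add_mem_periodLattice_iff (mul_self_mem_periodLattice (-b))).1 this

theorem div_notMem_polePoints (hM : 0 < M) {u v : ℂ} (hv : v ∉ polePoints τ u) :
    v / M ∉ polePoints (τ / M) (u / M) := by
  obtain ⟨h1, h2⟩ := notMem_polePoints.1 hv
  refine notMem_polePoints.2 ⟨fun h => h1 ?_, fun h => h2 ?_⟩
  · rw [show v / M + u / M / 2 = (v + u / 2) / M by ring] at h
    exact mem_periodLattice_of_div hM h
  · rw [show v / M - u / M / 2 = (v - u / 2) / M by ring] at h
    exact mem_periodLattice_of_div hM h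

/-- Raising a by M shifts z₁ by the modulus Mτ, and the multiplier cancels against the change of the
prefactor. So the terms depend only on residues mod M. -/
theorem levelTerm_add_left (hd : 0 < d) (hM : 0 < M) (hτ : 0 < τ.im) {u v : ℂ}
    (hv : v ∉ polePoints τ u) (a b : ℤ) :
    levelTerm d M τ u v (a + M) b = levelTerm d M τ u v a b := by
  have hMr : (0 : ℝ) < M := by exact_mod_cast hM
  have hMc : (M : ℂ) ≠ 0 := by exact_mod_cast hM.ne'
  have hτM' : 0 < (M * τ).im := by rw [im_natCast_mul]; positivity
  obtain ⟨h1, h2⟩ := notMem_polePoints.1 (levelTerm_notMem_polePoints (M := M) hv a b)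
  have e := phiHat_add_tau hd hτM' h1 h2
  rw [levelTerm, levelTerm, show u + (((a + M : ℤ) : ℂ) + b) * τ = u + (a + b) * τ + M * τ by
    push_cast; ring, show v + (((a + M : ℤ) : ℂ) - b) * τ / 2 = v + (a - b) * τ / 2 + M * τ / 2 by
    push_cast; ring, e, ← mul_assoc, levelFactor, levelFactor, ← Complex.exp_add]
  congr 2
  push_cast
  field_simp
  ring

theorem levelTerm_neg (hd : 0 < d) (u v : ℂ) (a b : ℤ) :
    levelTerm d M τ (-u) v a b = -levelTerm d M τ u v (-b) (-a) := by
  rw [levelTerm, levelTerm, show -u + ((a : ℂ) + b) * τ = -(u + (((-b : ℤ) : ℂ) + (-a : ℤ)) * τ) by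
    push_cast; ring, phiHat_neg hd, mul_neg, levelFactor, levelFactor]
  congr 3
  · push_cast; ring
  · push_cast; ring

theorem levelTerm_add_right (hd : 0 < d) (hM : 0 < M) (hτ : 0 < τ.im) {u v : ℂ}
    (hv : v ∉ polePoints τ u) (a b : ℤ) :
    levelTerm d M τ u v a (b + M) = levelTerm d M τ u v a b := by
  have hMr : (0 : ℝ) < M := by exact_mod_cast hM
  have hMc : (M : ℂ) ≠ 0 := by exact_mod_cast hM.ne'
  have hτM' : 0 < (M * τ).im := by rw [im_natCast_mul]; positivity
  obtain ⟨h1, h2⟩ := notMem_polePoints.1 (levelTerm_notMem_polePoints (M := M) hv a b)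
  have e := phiHat_add_tau' hd hτM' h1 h2
  rw [levelTerm, levelTerm, show u + ((a : ℂ) + ((b + M : ℤ) : ℂ)) * τ = u + (a + b) * τ + M * τ by
    push_cast; ring, show v + ((a : ℂ) - ((b + M : ℤ) : ℂ)) * τ / 2 =
      v + (a - b) * τ / 2 - M * τ / 2 by
    push_cast; ring, e, ← mul_assoc, levelFactor, levelFactor, ← Complex.exp_add]
  congr 2
  push_cast
  field_simp
  ring

/-- The sum of the shifted functions over all residue classes. -/
def levelSum (d M : ℕ) (τ u v : ℂ) : ℂ :=
  ∑ a ∈ Finset.range M, ∑ b ∈ Finset.range M, levelTerm d M τ u v a b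

theorem sum_levelTerm_affine (hd : 0 < d) (hM : 0 < M) (hτ : 0 < τ.im) {u v : ℂ}
    (hv : v ∉ polePoints τ u) {c : ℤ} (hc : IsCoprime c (M : ℤ)) (e f : ℤ) :
    ∑ a ∈ Finset.range M, ∑ b ∈ Finset.range M, levelTerm d M τ u v (c * a + e) (c * b + f) =
      levelSum d M τ u v := by
  have h1 : ∀ a : ℤ, ∑ b ∈ Finset.range M, levelTerm d M τ u v a (c * b + f) =
      ∑ b ∈ Finset.range M, levelTerm d M τ u v a b := fun a =>
    sum_range_affine hM (f := levelTerm d M τ u v a)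
      (fun b => levelTerm_add_right hd hM hτ hv a b) hc f
  simp only [h1]
  exact sum_range_affine hM (f := fun a => ∑ b ∈ Finset.range M, levelTerm d M τ u v a b)
    (fun a => Finset.sum_congr rfl fun b _ => levelTerm_add_left hd hM hτ hv a b) hc e

theorem levelSum_neg (hd : 0 < d) (hM : 0 < M) (hτ : 0 < τ.im) {u v : ℂ}
    (hv : v ∉ polePoints τ u) : levelSum d M τ (-u) v = -levelSum d M τ u v := by
  rw [← sum_levelTerm_affine hd hM hτ hv (c := -1) isCoprime_one_left.neg_left 0 0, levelSum,
    Finset.sum_comm, ← Finset.sum_neg_distrib]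
  refine Finset.sum_congr rfl fun a _ => ?_
  rw [← Finset.sum_neg_distrib]
  refine Finset.sum_congr rfl fun b _ => ?_
  rw [levelTerm_neg hd]
  congr 2 <;> ring

/-- The shift v ↦ v + τ sends (a, b) to (a + 1, b - 1), which permutes residue pairs. -/
theorem levelSum_add_tau (hd : 0 < d) (hM : 0 < M) (hτ : 0 < τ.im) {u v : ℂ}
    (hv : v ∉ polePoints τ u) :
    levelSum d M τ u (v + τ) = cexp (2 * π * I * (d / M) * (2 * v + τ)) * levelSum d M τ u v := by
  have hMc : (M : ℂ) ≠ 0 := by exact_mod_cast hM.ne'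
  rw [← sum_levelTerm_affine hd hM hτ hv (c := 1) isCoprime_one_left 1 (-1), levelSum,
    Finset.mul_sum]
  refine Finset.sum_congr rfl fun a _ => ?_
  rw [Finset.mul_sum]
  refine Finset.sum_congr rfl fun b _ => ?_
  rw [levelTerm, levelTerm, ← mul_assoc, levelFactor, levelFactor, ← Complex.exp_add]
  congr 1
  · congr 1
    push_cast
    field_simp
    ring
  · congr 1
    · push_cast; ring
    · push_cast; ring

theorem phiHat_add_natCast_right (hd : 0 < d) (s : ℕ) (τ u v : ℂ) (n : ℕ) :
    phiHat d s τ u (v + n) = phiHat d s τ u v := by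
  induction n with
  | zero => simp
  | succ n ih => rw [Nat.cast_succ, ← add_assoc, phiHat_add_one_right hd, ih]

theorem levelSum_add_natCast (hd : 0 < d) (hM : 0 < M) (τ u v : ℂ) :
    levelSum d M τ u (v + M) = levelSum d M τ u v := by
  have hMc : (M : ℂ) ≠ 0 := by exact_mod_cast hM.ne'
  refine Finset.sum_congr rfl fun a _ => Finset.sum_congr rfl fun b _ => ?_
  rw [levelTerm, levelTerm, add_right_comm, phiHat_add_natCast_right hd, levelFactor, levelFactor]
  congr 1
  refine Complex.exp_eq_exp_iff_exists_int.2 ⟨d * (b - a), ?_⟩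
  push_cast
  field_simp
  ring

theorem hasDbar_levelSum (hd : 0 < d) (hM : 0 < M) (hτ : 0 < τ.im) {u v : ℂ}
    (hv : v ∉ polePoints τ u) :
    HasDbar (levelSum d M τ u) (∑ a ∈ Finset.range M, ∑ b ∈ Finset.range M,
      levelFactor d M τ u v a b *
        (-I * (weightedKernel d (M * τ) (-(v + (a - b) * τ / 2)) (u + (a + b) * τ) -
          weightedKernel d (M * τ) (v + (a - b) * τ / 2) (u + (a + b) * τ)))) v := by
  have hMr : (0 : ℝ) < M := by exact_mod_cast hM
  have hτM' : 0 < (M * τ).im := by rw [im_natCast_mul]; positivity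
  refine HasDbar.sum _ fun a _ => HasDbar.sum _ fun b _ => ?_
  obtain ⟨h1, h2⟩ := notMem_polePoints.1 (levelTerm_notMem_polePoints (M := M) hv a b)
  have e1 := hasDbar_phiHat hd hτM' h1 h2
  have e2 := HasDbar.comp_affine (v := v) 1 (((a : ℤ) - (b : ℤ)) * τ / 2) (by rwa [one_mul])
  rw [map_one, one_mul] at e2
  have hg : DifferentiableAt ℂ (fun v => levelFactor d M τ u v a b) v := by
    unfold levelFactor; fun_prop
  simpa [levelTerm] using e2.mul_differentiableAt hg

/-- The deviation from the change of level formula. -/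
def levelDefect (d M : ℕ) (τ u v : ℂ) : ℂ :=
  phiHat d 0 (τ / M) (u / M) (v / M) - levelSum d M τ u v

theorem differentiableAt_levelDefect (hd : 0 < d) (hM : 0 < M)
    (hdM : IsCoprime (d : ℤ) (M : ℤ)) (hτ : 0 < τ.im) {u v : ℂ} (hv : v ∉ polePoints τ u) :
    DifferentiableAt ℂ (levelDefect d M τ u) v := by
  have hMr : (0 : ℝ) < M := by exact_mod_cast hM
  have hτM : 0 < (τ / M).im := by rw [im_div_natCast]; positivity
  obtain ⟨h1, h2⟩ := notMem_polePoints.1 (div_notMem_polePoints hM hv)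
  have e1 := hasDbar_phiHat hd hτM h1 h2
  have e2 := HasDbar.comp_affine (v := v) (1 / M) 0
    (by rwa [show 1 / (M : ℂ) * v + 0 = v / M by ring])
  have e3 := e2.sub (hasDbar_levelSum hd hM hτ hv)
  have k1 := weightedKernel_div hd hM hdM hτ v u
  have k2 := weightedKernel_div hd hM hdM hτ (-v) u
  -- Replacing v by -v amounts to exchanging a and b.
  have k3 : ∑ a ∈ Finset.range M, ∑ b ∈ Finset.range M, levelFactor d M τ u (-v) a b *
        weightedKernel d (M * τ) (-v + (a - b) * τ / 2) (u + (a + b) * τ) =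
      ∑ a ∈ Finset.range M, ∑ b ∈ Finset.range M, levelFactor d M τ u v a b *
        weightedKernel d (M * τ) (-(v + (a - b) * τ / 2)) (u + (a + b) * τ) := by
    rw [Finset.sum_comm]
    refine Finset.sum_congr rfl fun a _ => Finset.sum_congr rfl fun b _ => ?_
    congr 1
    · rw [levelFactor, levelFactor]; congr 1; ring
    · congr 1 <;> ring
  have hzero : conj (1 / (M : ℂ)) * (-I * (weightedKernel d (τ / M) (-(v / M)) (u / M) -
        weightedKernel d (τ / M) (v / M) (u / M))) -
      ∑ a ∈ Finset.range M, ∑ b ∈ Finset.range M, levelFactor d M τ u v a b *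
        (-I * (weightedKernel d (M * τ) (-(v + (a - b) * τ / 2)) (u + (a + b) * τ) -
          weightedKernel d (M * τ) (v + (a - b) * τ / 2) (u + (a + b) * τ))) = 0 := by
    have k4 : ∑ a ∈ Finset.range M, ∑ b ∈ Finset.range M, levelFactor d M τ u v a b *
        (-I * (weightedKernel d (M * τ) (-(v + (a - b) * τ / 2)) (u + (a + b) * τ) -
          weightedKernel d (M * τ) (v + (a - b) * τ / 2) (u + (a + b) * τ))) =
        -I * (1 / M * weightedKernel d (τ / M) (-v / M) (u / M) -
          1 / M * weightedKernel d (τ / M) (v / M) (u / M)) := by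
      rw [k1, k2, k3, ← Finset.sum_sub_distrib, Finset.mul_sum]
      refine Finset.sum_congr rfl fun a _ => ?_
      rw [← Finset.sum_sub_distrib, Finset.mul_sum]
      refine Finset.sum_congr rfl fun b _ => ?_
      ring
    rw [k4, map_div₀, map_one, map_natCast, neg_div]
    ring
  rw [hzero] at e3
  refine e3.differentiableAt.congr_of_eventuallyEq (Eventually.of_forall fun w => ?_)
  simp only [levelDefect]
  rw [show 1 / (M : ℂ) * w + 0 = w / M by ring]

theorem continuousAt_phiHat (hd : 0 < d) (hτ : 0 < τ.im) {u v : ℂ} (hv : v ∉ polePoints τ u) :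
    ContinuousAt (phiHat d 0 τ u) v := by
  obtain ⟨h1, h2⟩ := notMem_polePoints.1 hv
  exact (hasDbar_phiHat hd hτ h1 h2).continuousAt

/-- At this point the shifted z₁ equals n + aτ, which lies in ℤ + ℤMτ only for a = 0. The root of
unity is the value of the prefactor there. -/
theorem tendsto_levelTerm (hd : 0 < d) (hM : 0 < M) (hτ : 0 < τ.im) {u : ℂ}
    (hu : u ∉ periodLattice τ) {v₀ : ℂ} {n : ℤ} (h : v₀ + u / 2 = n) {a : ℕ}
    (ha : a ∈ Finset.range M) (b : ℕ) :
    Tendsto (fun w => (w - v₀) * levelTerm d M τ u w a b) (𝓝[≠] v₀)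
      (𝓝 (if a = 0 then -(cexp (2 * π * I * (d * n : ℤ) * b / M) / (2 * π * I)) else 0)) := by
  have hMr : (0 : ℝ) < M := by exact_mod_cast hM
  have hMc : (M : ℂ) ≠ 0 := by exact_mod_cast hM.ne'
  have hτM' : 0 < (M * τ).im := by rw [im_natCast_mul]; positivity
  have h2 : v₀ - u / 2 ∉ periodLattice τ := by
    rw [show v₀ - u / 2 = -u + n by linear_combination h,
      add_mem_periodLattice_iff (intCast_mem_periodLattice τ n), neg_mem_periodLattice]
    exact hu
  have h2' : v₀ + ((a : ℤ) - (b : ℤ)) * τ / 2 - (u + ((a : ℤ) + (b : ℤ)) * τ) / 2 ∉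
      periodLattice (M * τ) := by
    intro hm
    have := mem_periodLattice_of_natCast_mul hm
    rw [show v₀ + ((a : ℤ) - (b : ℤ)) * τ / 2 - (u + ((a : ℤ) + (b : ℤ)) * τ) / 2 =
      v₀ - u / 2 + ((-b : ℤ) : ℂ) * τ by push_cast; ring] at this
    exact h2 ((add_mem_periodLattice_iff (mul_self_mem_periodLattice _)).1 this)
  have hz1 : v₀ + ((a : ℤ) - (b : ℤ)) * τ / 2 + (u + ((a : ℤ) + (b : ℤ)) * τ) / 2 =
      n + a * τ := by rw [← h]; push_cast; ring
  have hfac : ContinuousAt (fun w => levelFactor d M τ u w a b) v₀ := by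
    unfold levelFactor; fun_prop
  have hm := tendsto_add_nhdsNE v₀ (((a : ℤ) - (b : ℤ)) * τ / 2)
  split_ifs with ha0
  · subst ha0
    have e1 := (tendsto_residue_phiHat hd hτM' (p := n) (j := 0) (by rw [hz1]; simp) h2').comp hm
    have e2 := (hfac.tendsto.mono_left (nhdsWithin_le_nhds (s := {v₀}ᶜ))).mul e1
    have hval : levelFactor d M τ u v₀ (0 : ℕ) b = cexp (2 * π * I * (d * n : ℤ) * b / M) := by
      rw [levelFactor]; congr 1
      rw [← add_comm v₀, h]; push_cast; ring
    have hone : ∀ w, thetaTerm d (M * τ) w (2 * d * 0) = 1 := by simp [thetaTerm]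
    rw [hval, hone, mul_neg, mul_one_div] at e2
    refine e2.congr fun w => ?_
    simp only [Function.comp, levelTerm]
    ring
  · have hnp : v₀ + ((a : ℤ) - (b : ℤ)) * τ / 2 ∉
        polePoints (M * τ) (u + ((a : ℤ) + (b : ℤ)) * τ) := by
      refine notMem_polePoints.2 ⟨?_, h2'⟩
      rw [hz1]
      rintro ⟨p, q, hpq⟩
      have him := congrArg Complex.im hpq
      have h3 : ((q : ℂ) * (M * τ)).im = q * (M * τ.im) := by
        simp
      rw [Complex.add_im, Complex.add_im, im_natCast_mul, h3, Complex.intCast_im,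
        Complex.intCast_im, zero_add, zero_add, ← mul_assoc] at him
      have h4 := mul_right_cancel₀ hτ.ne' him
      have h5 : (a : ℤ) = q * M := by exact_mod_cast h4
      have h6 : (M : ℤ) ∣ a := ⟨q, by rw [h5]; ring⟩
      have h7 := Nat.le_of_dvd (Nat.pos_of_ne_zero ha0) (by exact_mod_cast h6)
      rw [Finset.mem_range] at ha
      omega
    have hc : ContinuousAt (fun w => levelTerm d M τ u w a b) v₀ := by
      refine hfac.mul ?_
      exact ContinuousAt.comp (f := fun w => w + ((a : ℤ) - (b : ℤ)) * τ / 2)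
        (continuousAt_phiHat hd hτM' hnp) (by fun_prop)
    exact tendsto_sub_mul_of_continuousAt hc

/-- The left side has a pole at v₀/M only if M divides n, and rescaling the variable multiplies its
residue by M. The residues on the right are the roots of unity e^{2πidnb/M}, whose sum over b is M
or 0 in the same cases because d is prime to M. -/
theorem tendsto_levelDefect (hd : 0 < d) (hM : 0 < M)
    (hdM : IsCoprime (d : ℤ) (M : ℤ)) (hτ : 0 < τ.im) {u : ℂ} (hu : u ∉ periodLattice τ)
    {v₀ : ℂ} {n : ℤ} (h : v₀ + u / 2 = n) :
    Tendsto (fun w => (w - v₀) * levelDefect d M τ u w) (𝓝[≠] v₀) (𝓝 0) := by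
  have hMr : (0 : ℝ) < M := by exact_mod_cast hM
  have hMc : (M : ℂ) ≠ 0 := by exact_mod_cast hM.ne'
  have hτM : 0 < (τ / M).im := by rw [im_div_natCast]; positivity
  have h2 : v₀ - u / 2 ∉ periodLattice τ := by
    rw [show v₀ - u / 2 = -u + n by linear_combination h,
      add_mem_periodLattice_iff (intCast_mem_periodLattice τ n), neg_mem_periodLattice]
    exact hu
  have h2' : v₀ / M - u / M / 2 ∉ periodLattice (τ / M) := by
    rw [show v₀ / M - u / M / 2 = (v₀ - u / 2) / M by ring]
    exact fun h => h2 (mem_periodLattice_of_div hM h)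
  have hsum : Tendsto (fun w => (w - v₀) * levelSum d M τ u w) (𝓝[≠] v₀)
      (𝓝 (∑ b ∈ Finset.range M, -(cexp (2 * π * I * (d * n : ℤ) * b / M) / (2 * π * I)))) := by
    have e1 := tendsto_finsetSum (Finset.range M) fun a ha =>
      tendsto_finsetSum (Finset.range M) fun b _ => tendsto_levelTerm hd hM hτ hu h ha b
    have e2 : ∑ a ∈ Finset.range M, ∑ b ∈ Finset.range M,
        (if a = 0 then -(cexp (2 * π * I * (d * n : ℤ) * b / M) / (2 * π * I)) else 0) =
        ∑ b ∈ Finset.range M, -(cexp (2 * π * I * (d * n : ℤ) * b / M) / (2 * π * I)) := by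
      rw [Finset.sum_eq_single_of_mem 0 (Finset.mem_range.2 hM)]
      · simp
      · intro a _ ha; simp [ha]
    rw [e2] at e1
    refine e1.congr fun w => ?_
    rw [levelSum, Finset.mul_sum]
    exact Finset.sum_congr rfl fun a _ => by rw [Finset.mul_sum]
  have hm := tendsto_mul_nhdsNE (inv_ne_zero hMc) v₀
  rw [inv_mul_eq_div] at hm
  by_cases hdvd : (M : ℤ) ∣ n
  · obtain ⟨k, rfl⟩ := hdvd
    have e1 := (tendsto_residue_phiHat hd hτM (u := u / M) (v₀ := v₀ / M) (p := k) (j := 0) (by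
      rw [show v₀ / M + u / M / 2 = (v₀ + u / 2) / M by ring, h]
      push_cast; field_simp; simp) h2').comp hm
    have e2 := (e1.const_mul (M : ℂ)).sub hsum
    have hone : ∀ w, thetaTerm d (τ / M) w (2 * d * 0) = 1 := by simp [thetaTerm]
    have hexp : ∀ b : ℕ, cexp (2 * π * I * (d * (M * k) : ℤ) * b / M) = 1 := by
      intro b
      refine Complex.exp_eq_one_iff.2 ⟨d * k * b, ?_⟩
      push_cast; field_simp
    have hlim : (M : ℂ) * -(thetaTerm d (τ / M) (u / M) (2 * d * 0) / (2 * π * I)) -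
        ∑ b ∈ Finset.range M,
          -(cexp (2 * π * I * (d * (M * k) : ℤ) * b / M) / (2 * π * I)) = 0 := by
      simp only [hexp, hone, Finset.sum_const, Finset.card_range, nsmul_eq_mul, sub_self]
    rw [hlim] at e2
    refine e2.congr fun w => ?_
    simp only [Function.comp, levelDefect, inv_mul_eq_div]
    field_simp
  · have hnp : v₀ / M ∉ polePoints (τ / M) (u / M) := by
      refine notMem_polePoints.2 ⟨?_, h2'⟩
      rw [show v₀ / M + u / M / 2 = (v₀ + u / 2) / M by ring, h]
      rintro ⟨p, q, hpq⟩
      rw [div_eq_iff hMc] at hpq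
      have hpq' : (n : ℂ) = (p * M : ℤ) + q * τ := by rw [hpq]; push_cast; field_simp
      have him := congrArg Complex.im hpq'
      have h3 : ((q : ℂ) * τ).im = q * τ.im := by simp
      rw [Complex.add_im, Complex.intCast_im, Complex.intCast_im, h3, zero_add] at him
      have hq : (q : ℝ) = 0 := by
        rcases mul_eq_zero.1 him.symm with h | h
        · exact h
        · exact absurd h hτ.ne'
      have hq' : q = 0 := by exact_mod_cast hq
      rw [hq', Int.cast_zero, zero_mul, add_zero] at hpq'
      exact hdvd ⟨p, by rw [mul_comm]; exact_mod_cast hpq'⟩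
    have hc : ContinuousAt (fun w => phiHat d 0 (τ / M) (u / M) (w / M)) v₀ :=
      ContinuousAt.comp (f := fun w => w / (M : ℂ)) (continuousAt_phiHat hd hτM hnp)
        (by fun_prop)
    have e2 := (tendsto_sub_mul_of_continuousAt hc).sub hsum
    have hdvd' : ¬ (M : ℤ) ∣ d * n := fun h => hdvd (hdM.symm.dvd_of_dvd_mul_left h)
    have hlim : (0 : ℂ) - ∑ b ∈ Finset.range M,
        -(cexp (2 * π * I * (d * n : ℤ) * b / M) / (2 * π * I)) = 0 := by
      rw [Finset.sum_neg_distrib, ← Finset.sum_div, sum_range_exp_eq hM hdvd']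
      simp
    rw [hlim] at e2
    refine e2.congr fun w => ?_
    rw [levelDefect]; ring

theorem levelDefect_eq_zero_aux (hd : 0 < d) (hM : 0 < M)
    (hdM : IsCoprime (d : ℤ) (M : ℤ)) (hτ : 0 < τ.im) {u : ℂ} (hu : u ∉ periodLattice τ) :
    ∀ v ∉ polePoints τ u, levelDefect d M τ u v = 0 := by
  have hMr : (0 : ℝ) < M := by exact_mod_cast hM
  have hMc : (M : ℂ) ≠ 0 := by exact_mod_cast hM.ne'
  have hdr : (0 : ℝ) < d := by exact_mod_cast hd
  have hτM : 0 < (τ / M).im := by rw [im_div_natCast]; positivity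
  refine eq_zero_of_quasiPeriodic hτ hM (κ := d / M) (by positivity)
    (fun v hv => differentiableAt_levelDefect hd hM hdM hτ hv) (fun v _ => ?_) (fun v hv => ?_) ?_
  · rw [levelDefect, levelDefect, levelSum_add_natCast hd hM, add_div, div_self hMc,
      phiHat_add_one_right hd]
  · obtain ⟨h1, h2⟩ := notMem_polePoints.1 (div_notMem_polePoints hM hv)
    rw [levelDefect, levelDefect, levelSum_add_tau hd hM hτ hv, add_div,
      phiHat_add_tau_right hd hτM h1 h2, mul_sub]
    have : cexp (2 * π * I * d * (2 * (v / M) + τ / M)) =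
        cexp (2 * π * I * (d / M) * (2 * v + τ)) := by
      congr 1; field_simp
    rw [this]
    push_cast
    ring
  · rintro v n (h | h)
    · exact tendsto_levelDefect hd hM hdM hτ hu h
    · have h' : v + -u / 2 = n := by rw [← h]; ring
      have := (tendsto_levelDefect hd hM hdM hτ (neg_mem_periodLattice.not.2 hu) h').neg
      rw [neg_zero] at this
      refine this.congr' ?_
      filter_upwards [eventually_notMem_polePoints hτ u v] with w hw
      rw [levelDefect, levelDefect, levelSum_neg hd hM hτ hw, neg_div, phiHat_neg hd]
      ring

/-- Continuity in u removes the genericity condition on u. This is indispensable: the application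
has u = -(j + k) + 2ετ, which lies in ℤ + ℤτ. -/
theorem phiHat_div_eq_levelSum (hd : 0 < d) (hM : 0 < M)
    (hdM : IsCoprime (d : ℤ) (M : ℤ)) (hτ : 0 < τ.im) {u v : ℂ} (hv : v ∉ polePoints τ u) :
    phiHat d 0 (τ / M) (u / M) (v / M) = levelSum d M τ u v := by
  have hMr : (0 : ℝ) < M := by exact_mod_cast hM
  have hτM : 0 < (τ / M).im := by rw [im_div_natCast]; positivity
  have hτM' : 0 < (M * τ).im := by rw [im_natCast_mul]; positivity
  have hcont : ContinuousAt (fun u => levelDefect d M τ u v) u := by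
    refine ContinuousAt.sub ?_ ?_
    · obtain ⟨h1, h2⟩ := notMem_polePoints.1 (div_notMem_polePoints hM hv)
      exact ContinuousAt.comp (f := fun u => u / (M : ℂ))
        (differentiableAt_phiHat_left hd hτM h1 h2).continuousAt (by fun_prop)
    · refine tendsto_finsetSum _ fun a _ => tendsto_finsetSum _ fun b _ => ?_
      obtain ⟨h1, h2⟩ := notMem_polePoints.1 (levelTerm_notMem_polePoints (M := M) hv a b)
      refine ContinuousAt.mul (f := fun u => levelFactor d M τ u v a b) ?_ ?_
      · unfold levelFactor; fun_prop
      · exact ContinuousAt.comp (f := fun u => u + ((a : ℤ) + (b : ℤ)) * τ)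
          (differentiableAt_phiHat_left hd hτM' h1 h2).continuousAt (by fun_prop)
  have hz : ∀ᶠ w in 𝓝[≠] u, levelDefect d M τ w v = 0 := by
    have h1 : ∀ᶠ w in 𝓝[≠] u, v + w / 2 ∉ periodLattice τ := by
      have hm := (tendsto_add_nhdsNE (2⁻¹ * u) v).comp
        (tendsto_mul_nhdsNE (c := (2 : ℂ)⁻¹) (by norm_num) u)
      filter_upwards [hm.eventually (eventually_notMem_periodLattice hτ _)] with w hw
      rw [show v + w / 2 = 2⁻¹ * w + v by ring]
      exact hw
    have h2 : ∀ᶠ w in 𝓝[≠] u, v - w / 2 ∉ periodLattice τ := by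
      have hm := (tendsto_add_nhdsNE (-2⁻¹ * u) v).comp
        (tendsto_mul_nhdsNE (c := -(2 : ℂ)⁻¹) (by norm_num) u)
      filter_upwards [hm.eventually (eventually_notMem_periodLattice hτ _)] with w hw
      rw [show v - w / 2 = -2⁻¹ * w + v by ring]
      exact hw
    filter_upwards [h1, h2, eventually_notMem_periodLattice hτ u] with w hw1 hw2 hw3
    exact levelDefect_eq_zero_aux hd hM hdM hτ hw3 v (notMem_polePoints.2 ⟨hw1, hw2⟩)
  have hlim : Tendsto (fun u => levelDefect d M τ u v) (𝓝[≠] u) (𝓝 0) :=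
    tendsto_const_nhds.congr' (hz.mono fun w hw => hw.symm)
  have := tendsto_nhds_unique (hcont.tendsto.mono_left nhdsWithin_le_nhds) hlim
  exact sub_eq_zero.1 this

end

section

/-! ### The denominators -/

variable {τ : ℂ}

theorem thetaChar_eq_jacobiTheta₂ (a b : ℝ) (τ z : ℂ) :
    thetaChar a b τ z = cexp (π * I * τ * a ^ 2 / 4 + π * I * a * (z + b / 2)) *
      jacobiTheta₂ (z + b / 2 + a * τ / 2) τ := by
  rw [thetaChar, jacobiTheta₂, ← tsum_mul_left]
  refine tsum_congr fun n => ?_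
  rw [jacobiTheta₂_term, ← Complex.exp_add]
  congr 1
  ring

theorem differentiable_thetaChar (hτ : 0 < τ.im) (a b : ℝ) : Differentiable ℂ (thetaChar a b τ) := by
  have h : thetaChar a b τ = fun z => cexp (π * I * τ * a ^ 2 / 4 + π * I * a * (z + b / 2)) *
      jacobiTheta₂ (z + b / 2 + a * τ / 2) τ := funext fun z => thetaChar_eq_jacobiTheta₂ a b τ z
  rw [h]
  intro z
  refine DifferentiableAt.mul (by fun_prop) ?_
  exact DifferentiableAt.comp (f := fun z => z + (b : ℂ) / 2 + a * τ / 2) z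
    (differentiableAt_jacobiTheta₂_fst _ hτ) (by fun_prop)

/-- Translation by τ, evenness and translation by 1 together show the value equals its own negative.
-/
theorem jacobiTheta₂_half : jacobiTheta₂ (1 / 2 + τ / 2) τ = 0 := by
  have h1 := jacobiTheta₂_add_left' (1 / 2 - τ / 2) τ
  have h2 := jacobiTheta₂_neg_left (1 / 2 - τ / 2) τ
  have h3 := jacobiTheta₂_add_left (-(1 / 2 - τ / 2)) τ
  rw [show -(1 / 2 - τ / 2) + 1 = 1 / 2 + τ / 2 by ring] at h3
  rw [show 1 / 2 - τ / 2 + τ = 1 / 2 + τ / 2 by ring, ← h2, ← h3,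
    show -(π : ℂ) * I * (τ + 2 * (1 / 2 - τ / 2)) = -(π * I) by ring, Complex.exp_neg,
    Complex.exp_pi_mul_I] at h1
  linear_combination h1 / 2

theorem jacobiTheta₂_add_intCast (z τ : ℂ) (p : ℤ) : jacobiTheta₂ (z + p) τ = jacobiTheta₂ z τ := by
  induction p with
  | zero => simp
  | succ p ih => rw [← ih, ← jacobiTheta₂_add_left (z + (p : ℤ))]; congr 1; push_cast; ring
  | pred p ih =>
    rw [← ih, ← jacobiTheta₂_add_left (z + ((-p - 1 : ℤ) : ℂ))]; congr 1; push_cast; ring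

theorem jacobiTheta₂_add_tau_eq_zero_iff (z τ : ℂ) :
    jacobiTheta₂ (z + τ) τ = 0 ↔ jacobiTheta₂ z τ = 0 := by
  rw [jacobiTheta₂_add_left']
  simp

theorem jacobiTheta₂_add_mul_eq_zero_iff (z τ : ℂ) (q : ℤ) :
    jacobiTheta₂ (z + q * τ) τ = 0 ↔ jacobiTheta₂ z τ = 0 := by
  induction q with
  | zero => simp
  | succ p ih =>
    rw [← ih, ← jacobiTheta₂_add_tau_eq_zero_iff (z + (p : ℤ) * τ)]
    push_cast; rw [add_mul, one_mul, add_assoc]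
  | pred p ih =>
    rw [← ih, ← jacobiTheta₂_add_tau_eq_zero_iff (z + ((-p - 1 : ℤ) : ℂ) * τ)]
    push_cast; rw [sub_mul, one_mul, add_assoc, sub_add_cancel]

theorem thetaChar_eq_zero (ε ε' : ℝ) {z : ℂ} (hz : z ∈ polarSet ε ε' τ) :
    thetaChar (1 - 2 * ε') (1 - 2 * ε) τ z = 0 := by
  obtain ⟨p, q, rfl⟩ := hz
  rw [thetaChar_eq_jacobiTheta₂, mul_eq_zero]
  right
  rw [show (ε : ℂ) + ε' * τ + p + q * τ + ((1 - 2 * ε : ℝ) : ℂ) / 2 +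
    ((1 - 2 * ε' : ℝ) : ℂ) * τ / 2 = 1 / 2 + τ / 2 + p + q * τ by push_cast; ring,
    jacobiTheta₂_add_mul_eq_zero_iff, jacobiTheta₂_add_intCast, jacobiTheta₂_half]

theorem thetaChar_neg_inv (hτ : 0 < τ.im) (a : ℤ) (b : ℝ) (z : ℂ) :
    thetaChar a b (-1 / τ) (z / τ) = (-I * τ) ^ (1 / 2 : ℂ) * cexp (π * I * z ^ 2 / τ) *
      cexp (-(π * I * a * b / 2)) * thetaChar b a τ z := by
  have hτ0 : τ ≠ 0 := by rintro rfl; simp at hτ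
  have hI : (-I * τ) ^ (1 / 2 : ℂ) ≠ 0 := by
    rw [Complex.cpow_ne_zero_iff_of_exponent_ne_zero (by norm_num)]
    simp [hτ0]
  -- Division of this argument by τ gives the argument z/τ + b/2 + a(-1/τ)/2 belonging to -1/τ.
  -- Changing -a/2 to +a/2 is a shift by the integer a.
  have h := jacobiTheta₂_functional_equation (z + b * τ / 2 - a / 2) τ
  rw [thetaChar_eq_jacobiTheta₂, thetaChar_eq_jacobiTheta₂]
  have h1 := jacobiTheta₂_add_intCast (z + b * τ / 2 - a / 2) τ a
  rw [show z + b * τ / 2 - a / 2 + a = z + ((a : ℝ) : ℂ) / 2 + b * τ / 2 by push_cast; ring, h] at h1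
  rw [h1, show (z + b * τ / 2 - a / 2) / τ = z / τ + b / 2 + ((a : ℝ) : ℂ) * (-1 / τ) / 2 by
    push_cast; field_simp; ring]
  have e : (-I * τ) ^ (1 / 2 : ℂ) * cexp (π * I * z ^ 2 / τ) *
      cexp (-(π * I * a * b / 2)) * (cexp (π * I * τ * b ^ 2 / 4 + π * I * b * (z + (a : ℝ) / 2)) *
      (1 / (-I * τ) ^ (1 / 2 : ℂ) * cexp (-π * I * (z + b * τ / 2 - a / 2) ^ 2 / τ) *
        jacobiTheta₂ (z / τ + b / 2 + ((a : ℝ) : ℂ) * (-1 / τ) / 2) (-1 / τ))) =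
      cexp (π * I * z ^ 2 / τ) *
      cexp (-(π * I * a * b / 2)) * cexp (π * I * τ * b ^ 2 / 4 + π * I * b * (z + (a : ℝ) / 2)) *
      cexp (-π * I * (z + b * τ / 2 - a / 2) ^ 2 / τ) *
        jacobiTheta₂ (z / τ + b / 2 + ((a : ℝ) : ℂ) * (-1 / τ) / 2) (-1 / τ) := by
    field_simp
  rw [e, ← Complex.exp_add, ← Complex.exp_add, ← Complex.exp_add]
  congr 2
  push_cast
  field_simp
  ring

theorem exp_pi_mul_I_mul_even (n : ℤ) (h : Even n) : cexp (π * I * n) = 1 := by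
  obtain ⟨k, rfl⟩ := h
  refine Complex.exp_eq_one_iff.2 ⟨k, ?_⟩
  push_cast; ring

theorem thetaChar_zero_tau_add_one (b : ℝ) (τ z : ℂ) :
    thetaChar 0 b (τ + 1) z = thetaChar 0 (b + 1) τ z := by
  refine tsum_congr fun n => ?_
  have h := exp_pi_mul_I_mul_even (n * (n - 1)) (Int.even_mul_pred_self n)
  refine Eq.trans ?_ ((congrArg (_ * ·) h).trans (mul_one _))
  rw [← Complex.exp_add]
  congr 1
  push_cast; ring

theorem thetaChar_zero_add_two (b : ℝ) (τ z : ℂ) :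
    thetaChar 0 (b + 2) τ z = thetaChar 0 b τ z := by
  refine tsum_congr fun n => ?_
  have h := exp_pi_mul_I_mul_even (2 * n) (even_two_mul n)
  refine Eq.trans ?_ ((congrArg (_ * ·) h).trans (mul_one _))
  rw [← Complex.exp_add]
  congr 1
  push_cast; ring

theorem thetaChar_one_tau_add_one (b : ℝ) (τ z : ℂ) :
    thetaChar 1 b (τ + 1) z = cexp (π * I / 4) * thetaChar 1 b τ z := by
  rw [thetaChar, thetaChar, ← tsum_mul_left]
  refine tsum_congr fun n => ?_
  have h := exp_pi_mul_I_mul_even (n * (n + 1)) (Int.even_mul_succ_self n)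
  refine Eq.trans ?_ ((congrArg (_ * ·) h).trans (mul_one _))
  rw [← Complex.exp_add, ← Complex.exp_add]
  congr 1
  push_cast; ring

theorem sqrt_eq_cpow (hτ : 0 < τ.im) : (sqrt I)⁻¹ * sqrt τ = (-I * τ) ^ (1 / 2 : ℂ) := by
  have hτ0 : τ ≠ 0 := by rintro rfl; simp at hτ
  have hx : -I * τ ≠ 0 := by simp [hτ0]
  -- The point -iτ lies in the right half-plane, so adding the argument π/2 of i stays within the
  -- principal branch.
  have h1 : |arg (-I * τ)| < π / 2 := abs_arg_lt_pi_div_two_iff.2 (Or.inl (by simpa using hτ))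
  rw [abs_lt] at h1
  have h2 : τ = I * (-I * τ) := by rw [← mul_assoc, mul_neg, I_mul_I]; ring
  have h3 : log τ = log I + log (-I * τ) := by
    conv_lhs => rw [h2]
    refine (log_mul_eq_add_log_iff I_ne_zero hx).2 ?_
    rw [arg_I]
    constructor <;> linarith [Real.pi_pos]
  rw [sqrt_eq_exp I_ne_zero, sqrt_eq_exp hτ0, ← Complex.exp_neg, ← Complex.exp_add, h3,
    Complex.cpow_def_of_ne_zero hx]
  congr 1
  ring

theorem eta_neg_inv (hτ : 0 < τ.im) :
    ModularForm.eta (-1 / τ) = (-I * τ) ^ (1 / 2 : ℂ) * ModularForm.eta τ := by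
  rw [← sqrt_eq_cpow hτ, mul_assoc]
  simpa using ModularForm.eta_comp_eq_csqrt_I_inv hτ

theorem eta_add_one_pow (τ : ℂ) :
    ModularForm.eta (τ + 1) ^ 3 = cexp (π * I / 4) * ModularForm.eta τ ^ 3 := by
  have h1 : ∀ n, ModularForm.eta_q n (τ + 1) = ModularForm.eta_q n τ := by
    intro n
    rw [ModularForm.eta_q_eq_pow, ModularForm.eta_q_eq_pow, mul_add, mul_one, Complex.exp_add,
      Complex.exp_two_pi_mul_I, mul_one]
  have h2 : Function.Periodic.qParam 24 (τ + 1) =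
      cexp (π * I / 12) * Function.Periodic.qParam 24 τ := by
    rw [Function.Periodic.qParam, Function.Periodic.qParam, ← Complex.exp_add]
    congr 1
    push_cast; ring
  simp only [ModularForm.eta, h1, h2, mul_pow, ← Complex.exp_nat_mul]
  rw [mul_assoc]
  congr 2
  push_cast; ring

theorem N2Quot_eq (M m s : ℕ) (ε ε' j k : ℝ) (τ z : ℂ) :
    N2Quot M m s ε ε' j k τ z = PsiMod M m s ε j k τ (-z) z 0 *
      thetaChar (1 - 2 * ε') (1 - 2 * ε) τ z /
      ((-1 : ℂ) ^ (((1 - 2 * ε) * (1 - 2 * ε') : ℝ) : ℂ) * ModularForm.eta τ ^ 3) := by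
  rw [N2Quot, N2Denom, div_div_eq_mul_div]

/-- Weight 1/2 minus 3/2 leaves (-iτ)⁻¹ = i/τ. Inversion exchanges the two characteristics, that is,
ε and ε'. -/
theorem thetaChar_div_eta_neg_inv (hτ : 0 < τ.im) {ε ε' : ℝ} (hε : ε = 0 ∨ ε = 1 / 2)
    (hε' : ε' = 0 ∨ ε' = 1 / 2) (z : ℂ) :
    thetaChar (1 - 2 * ε') (1 - 2 * ε) (-1 / τ) (z / τ) / ModularForm.eta (-1 / τ) ^ 3 =
      I / τ * cexp (π * I * z ^ 2 / τ) * (-I) ^ (((1 - 2 * ε) * (1 - 2 * ε') : ℝ) : ℂ) *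
        (thetaChar (1 - 2 * ε) (1 - 2 * ε') τ z / ModularForm.eta τ ^ 3) := by
  have hτ0 : τ ≠ 0 := by rintro rfl; simp at hτ
  have hX0 : (-I * τ) ^ (1 / 2 : ℂ) ≠ 0 := by
    rw [Complex.cpow_ne_zero_iff_of_exponent_ne_zero (by norm_num)]
    simp [hτ0]
  have hX : ((-I * τ) ^ (1 / 2 : ℂ)) ^ 2 = -I * τ := by
    rw [← Complex.cpow_nat_mul]; norm_num
  obtain ⟨a, ha⟩ : ∃ a : ℤ, 1 - 2 * ε' = a := by
    rcases hε' with rfl | rfl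
    · exact ⟨1, by norm_num⟩
    · exact ⟨0, by norm_num⟩
  have hph : cexp (-(π * I * a * ((1 - 2 * ε : ℝ) : ℂ) / 2)) =
      (-I) ^ (((1 - 2 * ε) * (1 - 2 * ε') : ℝ) : ℂ) := by
    have hI : cexp (-(π * I / 2)) = -I := by
      rw [Complex.exp_neg, mul_div_right_comm, Complex.exp_pi_div_two_mul_I, Complex.inv_I]
    rcases hε' with rfl | rfl
    · have : a = 1 := by norm_num at ha; exact_mod_cast ha.symm
      subst this
      rcases hε with rfl | rfl
      · norm_num [hI]
      · norm_num
    · have : a = 0 := by norm_num at ha; exact_mod_cast ha.symm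
      subst this
      norm_num
  rw [ha, thetaChar_neg_inv hτ, hph, ha, eta_neg_inv hτ, mul_pow]
  have h3 : I / τ * ((-I * τ) ^ (1 / 2 : ℂ)) ^ 3 = (-I * τ) ^ (1 / 2 : ℂ) := by
    rw [pow_succ, hX]
    field_simp
    rw [I_sq]; ring
  have h4 : (-I * τ) ^ (1 / 2 : ℂ) / ((-I * τ) ^ (1 / 2 : ℂ)) ^ 3 = I / τ := by
    rw [div_eq_iff (pow_ne_zero 3 hX0), h3]
  rw [← h4]
  ring

/-- In the Ramond sector the eighth root of unity of ϑ cancels that of η³. In the Neveu–Schwarz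
sector ϑ₀₀ and ϑ₀₁ are exchanged and the root from η³ survives. -/
theorem thetaChar_div_eta_add_one (τ : ℂ) {ε ε' : ℝ} (hε : ε = 0 ∨ ε = 1 / 2)
    (hε' : ε' = 0 ∨ ε' = 1 / 2) (z : ℂ) :
    thetaChar (1 - 2 * ε') (1 - 2 * ε) (τ + 1) z /
      ((-1 : ℂ) ^ (((1 - 2 * ε) * (1 - 2 * ε') : ℝ) : ℂ) * ModularForm.eta (τ + 1) ^ 3) =
      cexp (-(π * I * ε' / 2)) * (thetaChar (1 - 2 * ε') (1 - 2 * |ε - ε'|) τ z /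
        ((-1 : ℂ) ^ (((1 - 2 * |ε - ε'|) * (1 - 2 * ε') : ℝ) : ℂ) * ModularForm.eta τ ^ 3)) := by
  rw [eta_add_one_pow]
  rcases hε' with rfl | rfl
  · have : |ε - 0| = ε := by rcases hε with rfl | rfl <;> norm_num
    rw [this]
    simp only [mul_zero, sub_zero, thetaChar_one_tau_add_one, Complex.ofReal_zero, zero_div,
      neg_zero, Complex.exp_zero, one_mul]
    rw [mul_left_comm, mul_div_mul_left _ _ (Complex.exp_ne_zero _)]
  · have h0 : (1 : ℝ) - 2 * (1 / 2) = 0 := by norm_num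
    have hb : thetaChar 0 (1 - 2 * ε) (τ + 1) z = thetaChar 0 (1 - 2 * |ε - 1 / 2|) τ z := by
      rw [thetaChar_zero_tau_add_one]
      rcases hε with rfl | rfl
      · rw [← thetaChar_zero_add_two (1 - 2 * |0 - 1 / 2|)]
        congr 1
        norm_num
      · norm_num
    rw [h0, hb, mul_zero, mul_zero, Complex.ofReal_zero, Complex.cpow_zero, one_mul, one_mul,
      show -((π : ℂ) * I * ((1 / 2 : ℝ) : ℂ) / 2) = -(π * I / 4) by push_cast; ring,
      Complex.exp_neg]
    field_simp

end

section

/-! ### Summation over the index sets -/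

/-- Sort the pairs mod M by antidiagonals a + b + e ≡ n. The first n points starting at a = 1 - e
are kept; the other M - n are, mod M, the reflections (a, b) ↦ (-b - e, -a - e) of the points kept
on the antidiagonal M - n. On n = 0 everything vanishes. -/
theorem sum_range_range_eq_fold {M : ℕ} (hM : 0 < M) {f : ℤ → ℤ → ℂ}
    (h1 : ∀ a b, f (a + M) b = f a b) (h2 : ∀ a b, f a (b + M) = f a b) (e : ℤ)
    (h0 : ∀ a b, a + b + e = 0 → f a b = 0) :
    ∑ a ∈ Finset.range M, ∑ b ∈ Finset.range M, f a b =
      ∑ n ∈ Finset.range M, ∑ i ∈ Finset.range n,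
        (f (1 - e + i) (n - 1 - i) + f (-(n - 1 - i) - e) (-(1 - e + i) - e)) := by
  have hper : ∀ n : ℤ, ∀ a, f (a + M) (n - e - (a + M)) = f a (n - e - a) := by
    intro n a
    rw [h1, ← h2 a (n - e - (a + M))]
    congr 1; ring
  have s1 : ∑ a ∈ Finset.range M, ∑ b ∈ Finset.range M, f a b =
      ∑ a ∈ Finset.range M, ∑ n ∈ Finset.range M, f a (n - e - a) := by
    refine Finset.sum_congr rfl fun a _ => ?_
    rw [← sum_range_affine hM (f := f a) (h2 a) (c := 1) isCoprime_one_left (-e - a)]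
    refine Finset.sum_congr rfl fun n _ => ?_
    congr 1; ring
  have s2 : ∀ n : ℕ, ∑ a ∈ Finset.range M, f a (n - e - a) =
      ∑ i ∈ Finset.range M, f (1 - e + i) (n - 1 - i) := by
    intro n
    rw [← sum_range_affine hM (f := fun a => f a (n - e - a)) (hper n) (c := 1)
      isCoprime_one_left (1 - e)]
    refine Finset.sum_congr rfl fun i _ => ?_
    congr 1 <;> ring
  have s3 : ∀ n ∈ Finset.range M, ∑ i ∈ Finset.range M, f (1 - e + i) (n - 1 - i) =
      ∑ i ∈ Finset.range n, f (1 - e + i) (n - 1 - i) +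
        ∑ i ∈ Finset.range (M - n), f (1 - e + n + i) (-1 - i) := by
    intro n hn
    have hn' : n + (M - n) = M := by have := Finset.mem_range.1 hn; omega
    conv_lhs => rw [← hn', Finset.sum_range_add]
    congr 1
    refine Finset.sum_congr rfl fun i _ => ?_
    congr 1 <;> (push_cast; ring)
  rw [s1, Finset.sum_comm, Finset.sum_congr rfl fun n _ => s2 n, Finset.sum_congr rfl s3,
    Finset.sum_add_distrib]
  simp only [Finset.sum_add_distrib]
  congr 1
  obtain ⟨N, rfl⟩ : ∃ N, M = N + 1 := ⟨M - 1, by omega⟩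
  rw [Finset.sum_range_succ', Finset.sum_range_succ']
  have z1 : ∑ i ∈ Finset.range (N + 1 - 0), f (1 - e + (0 : ℕ) + i) (-1 - i) = 0 :=
    Finset.sum_eq_zero fun i _ => h0 _ _ (by push_cast; ring)
  rw [z1, Finset.range_zero, Finset.sum_empty, add_zero, add_zero, ← Finset.sum_range_reflect]
  refine Finset.sum_congr rfl fun n hn => ?_
  have hn' := Finset.mem_range.1 hn
  have e1 : N + 1 - (N - 1 - n + 1) = n + 1 := by omega
  rw [e1]
  refine Finset.sum_congr rfl fun i _ => ?_
  have e2 : ((N - 1 - n + 1 : ℕ) : ℤ) = N - n := by omega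
  rw [e2, ← h1 (-_ - e)]
  congr 1 <;> (push_cast; ring)

/-- Here n is the sum of the two coordinates. The start 1 - ε is the least positive element of ε + ℤ
for either value of ε. -/
theorem sum_Omega_eq {M : ℕ} {ε : ℝ} (hε : ε = 0 ∨ ε = 1 / 2) (F : ℝ × ℝ → ℂ) :
    ∑ p ∈ Omega M ε, F p =
      ∑ n ∈ Finset.range M, ∑ i ∈ Finset.range n, F (1 - ε + i, n - 1 + ε - i) := by
  have hε0 : 0 ≤ ε := by rcases hε with rfl | rfl <;> norm_num
  rw [Finset.sum_sigma']
  symm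
  refine Finset.sum_bij (fun x _ => (1 - ε + (x.2 : ℝ), (x.1 : ℝ) - 1 + ε - x.2)) ?_ ?_ ?_ ?_
  · rintro ⟨n, i⟩ hx
    simp only [Finset.mem_sigma, Finset.mem_range] at hx
    rw [mem_Omega M ε hε0]
    have h1 : (n : ℝ) + 1 ≤ M := by exact_mod_cast hx.1
    have h2 : (0 : ℝ) ≤ i := Nat.cast_nonneg i
    refine ⟨?_, ⟨n - 1 - i, ?_⟩, ?_, ?_⟩
    · rcases hε with rfl | rfl
      · exact ⟨1 + i, by push_cast; ring⟩
      · exact ⟨i, by ring⟩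
    · rw [Nat.cast_sub (by omega), Nat.cast_sub (by omega)]; push_cast; ring
    · linarith
    · rcases hε with rfl | rfl <;> linarith
  · rintro ⟨n, i⟩ _ ⟨n', i'⟩ _ h
    simp only [Prod.mk.injEq] at h
    have h1 : (i : ℝ) = i' := by linarith [h.1]
    have h2 : (n : ℝ) = n' := by linarith [h.2]
    have h1' : i = i' := by exact_mod_cast h1
    have h2' : n = n' := by exact_mod_cast h2
    rw [h1', h2']
  · rintro ⟨j, k⟩ hp
    obtain ⟨⟨a, rfl⟩, ⟨b, rfl⟩, h3, h4⟩ := (mem_Omega M ε hε0 j k).1 hp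
    rcases hε with rfl | rfl
    · have h5 : 0 < a := by simpa using h4
      have h6 : a + b + 1 ≤ M := by
        have : (a : ℝ) + b + 1 ≤ M := by linarith
        exact_mod_cast this
      refine ⟨⟨a + b, a - 1⟩, ?_, ?_⟩
      · simp only [Finset.mem_sigma, Finset.mem_range]; omega
      · rw [Nat.cast_sub h5]; ext <;> (push_cast; ring)
    · have h6 : a + b + 2 ≤ M := by
        have : (a : ℝ) + b + 2 ≤ M := by linarith
        exact_mod_cast this
      refine ⟨⟨a + b + 1, a⟩, ?_, ?_⟩
      · simp only [Finset.mem_sigma, Finset.mem_range]; omega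
      · ext <;> (push_cast; ring)
  · intros; rfl

end

section

/-! ### The numerators and the continuity of the characters -/

variable {d M : ℕ} {τ : ℂ} {ε ε' a b : ℝ}

theorem mem_polarSet_iff {z : ℂ} : z ∈ polarSet ε ε' τ ↔ z - ε - ε' * τ ∈ periodLattice τ := by
  constructor
  · rintro ⟨p, q, rfl⟩
    exact ⟨p, q, by ring⟩
  · rintro ⟨p, q, h⟩
    exact ⟨p, q, by linear_combination h⟩

theorem eventually_notMem_polarSet (hτ : 0 < τ.im) (ε ε' : ℝ) (z : ℂ) :
    ∀ᶠ w in 𝓝[≠] z, w ∉ polarSet ε ε' τ := by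
  have h := (tendsto_add_nhdsNE z (-ε - ε' * τ)).eventually (eventually_notMem_periodLattice hτ _)
  filter_upwards [h] with w hw
  rw [mem_polarSet_iff]
  rwa [show w - ε - ε' * τ = w + (-ε - ε' * τ) by ring]

theorem eventually_nhds_notMem_polarSet (hτ : 0 < τ.im) {z : ℂ} (hz : z ∉ polarSet ε ε' τ) :
    ∀ᶠ w in 𝓝 z, w ∉ polarSet ε ε' τ := by
  have h := eventually_notMem_polarSet hτ ε ε' z
  rw [eventually_nhdsWithin_iff] at h
  filter_upwards [h] with w hw
  by_cases hwz : w = z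
  · rwa [hwz]
  · exact hw hwz

theorem exists_intCast_two_mul (hε : ε = 0 ∨ ε = 1 / 2) : ∃ e : ℤ, 2 * (ε : ℂ) = e := by
  rcases hε with rfl | rfl
  · exact ⟨0, by simp⟩
  · exact ⟨1, by simp⟩

theorem intCast_add_mul_mem_periodLattice (p q : ℤ) : (p : ℂ) + q * τ ∈ periodLattice τ :=
  ⟨p, q, rfl⟩

theorem add_mul_notMem_periodLattice (hτ : 0 < τ.im) {x y : ℝ} (hy : ∀ q : ℤ, y ≠ q * M) :
    (y : ℂ) * τ + x ∉ periodLattice (M * τ) := by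
  rintro ⟨p, q, h⟩
  have him := congrArg Complex.im h
  simp only [Complex.add_im, Complex.im_ofReal_mul, Complex.ofReal_im,
    Complex.intCast_im, add_zero, zero_add] at him
  have h3 : ((q : ℂ) * (M * τ)).im = q * M * τ.im := by simp [mul_assoc]
  rw [h3] at him
  exact hy q (mul_right_cancel₀ hτ.ne' him)

theorem ne_intCast_mul_of_mem_Ioo {y : ℝ} (h : y ∈ Set.Ioo (0 : ℝ) M) (q : ℤ) : y ≠ q * M := by
  rintro rfl
  have hM : (0 : ℝ) < M := h.1.trans h.2
  have h1 : (0 : ℝ) < q := by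
    by_contra! hq
    exact absurd h.1 (not_lt.2 (mul_nonpos_of_nonpos_of_nonneg hq hM.le))
  have h2 : (q : ℝ) < 1 := by
    by_contra! hq
    exact absurd h.2 (not_lt.2 (le_mul_of_one_le_left hM.le hq))
  have h1' : 0 < q := by exact_mod_cast h1
  have h2' : q < 1 := by exact_mod_cast h2
  omega

/-- The function `Ψ~(τ, -z, z, 0)` expressed by `phiHat`. -/
def psiHat (d M : ℕ) (ε a b : ℝ) (τ z : ℂ) : ℂ :=
  cexp (2 * π * I * (d * (a * b) * τ / M + d * (a - b) * z / M)) *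
    phiHat d 0 (M * τ) ((a + b) * τ + 2 * ε) ((a - b) * τ / 2 - z)

theorem notMem_polePoints_of_notMem_polarSet (hε : ε = 0 ∨ ε = 1 / 2) (hε' : ε' = 0 ∨ ε' = 1 / 2)
    (ha : ∃ n : ℤ, a = ε' + n) (hb : ∃ n : ℤ, b = ε' + n) {z : ℂ} (hz : z ∉ polarSet ε ε' τ) :
    (a - b) * τ / 2 - z ∉ polePoints (M * τ) ((a + b) * τ + 2 * ε) := by
  obtain ⟨e, he⟩ := exists_intCast_two_mul hε
  obtain ⟨e', he'⟩ := exists_intCast_two_mul hε'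
  obtain ⟨p, rfl⟩ := ha
  obtain ⟨q, rfl⟩ := hb
  rw [mem_polarSet_iff] at hz
  refine notMem_polePoints.2 ⟨fun h => hz ?_, fun h => hz ?_⟩
  · have h1 := neg_mem_periodLattice.2 (mem_periodLattice_of_natCast_mul h)
    refine (add_mem_periodLattice_iff (mul_self_mem_periodLattice (-p))).1 ?_
    convert h1 using 1
    push_cast; ring
  · have h1 := neg_mem_periodLattice.2 (mem_periodLattice_of_natCast_mul h)
    refine (add_mem_periodLattice_iff (intCast_add_mul_mem_periodLattice e (e' + q))).1 ?_
    convert h1 using 1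
    push_cast
    rw [← he, ← he']; ring

/-- Off the polar set the dependence on s disappears, so all further work concerns s = 0. -/
theorem PsiMod_eq_psiHat (hM : 0 < M) (m s : ℕ) (hτ : 0 < τ.im) (hε : ε = 0 ∨ ε = 1 / 2)
    (hε' : ε' = 0 ∨ ε' = 1 / 2) (ha : ∃ n : ℤ, a = ε' + n) (hb : ∃ n : ℤ, b = ε' + n) {z : ℂ}
    (hz : z ∉ polarSet ε ε' τ) :
    PsiMod M m s ε a b τ (-z) z 0 = psiHat (m + 1) M ε a b τ z := by
  have hMr : (0 : ℝ) < M := by exact_mod_cast hM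
  have hτM' : 0 < (M * τ).im := by rw [im_natCast_mul]; positivity
  obtain ⟨h1, h2⟩ := notMem_polePoints.1
    (notMem_polePoints_of_notMem_polarSet (M := M) hε hε' ha hb hz)
  rw [PsiMod, zero_div, PhiMod_eq_phiHat, psiHat, ← phiHat_eq_zero_index m.succ_pos hτM' s h1 h2,
    qPow, ← Complex.exp_add]
  congr 1
  · congr 1; push_cast; ring
  · congr 1 <;> ring

theorem continuousAt_psiHat (hd : 0 < d) (hM : 0 < M) (hτ : 0 < τ.im) (hε : ε = 0 ∨ ε = 1 / 2)
    (hε' : ε' = 0 ∨ ε' = 1 / 2) (ha : ∃ n : ℤ, a = ε' + n) (hb : ∃ n : ℤ, b = ε' + n) {z : ℂ}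
    (hz : z ∉ polarSet ε ε' τ) : ContinuousAt (psiHat d M ε a b τ) z := by
  have hMr : (0 : ℝ) < M := by exact_mod_cast hM
  have hτM' : 0 < (M * τ).im := by rw [im_natCast_mul]; positivity
  refine ContinuousAt.mul (by fun_prop) ?_
  exact ContinuousAt.comp (f := fun z => ((a : ℂ) - b) * τ / 2 - z)
    (continuousAt_phiHat hd hτM' (notMem_polePoints_of_notMem_polarSet hε hε' ha hb hz))
    (by fun_prop)

/-- The two families of poles meet only if u is a period, so otherwise every pole is at most simple.
-/
theorem exists_tendsto_sub_mul_phiHat (hd : 0 < d) (hτ : 0 < τ.im) {u : ℂ}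
    (hu : u ∉ periodLattice τ) (v₀ : ℂ) :
    ∃ c, Tendsto (fun v => (v - v₀) * phiHat d 0 τ u v) (𝓝[≠] v₀) (𝓝 c) := by
  by_cases h1 : v₀ + u / 2 ∈ periodLattice τ
  · have h2 : v₀ - u / 2 ∉ periodLattice τ := by
      intro h2
      rw [show v₀ + u / 2 = u + (v₀ - u / 2) by ring, add_mem_periodLattice_iff h2] at h1
      exact hu h1
    obtain ⟨p, j, hp⟩ := h1
    exact ⟨_, tendsto_residue_phiHat (j := -j) hd hτ (by rw [hp]; push_cast; ring) h2⟩
  · by_cases h2 : v₀ - u / 2 ∈ periodLattice τ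
    · obtain ⟨p, j, hp⟩ := h2
      exact ⟨_, tendsto_residue_phiHat' (j := -j) hd hτ (by rw [hp]; push_cast; ring) h1⟩
    · exact ⟨0, tendsto_sub_mul_of_continuousAt
        (continuousAt_phiHat hd hτ (notMem_polePoints.2 ⟨h1, h2⟩))⟩

theorem exists_tendsto_sub_mul_psiHat (hd : 0 < d) (hτ : 0 < τ.im)
    (hab : a + b ∈ Set.Ioo (0 : ℝ) M) (z₀ : ℂ) :
    ∃ c, Tendsto (fun z => (z - z₀) * psiHat d M ε a b τ z) (𝓝[≠] z₀) (𝓝 c) := by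
  have hMr : (0 : ℝ) < M := hab.1.trans hab.2
  have hτM' : 0 < (M * τ).im := by rw [im_natCast_mul]; positivity
  -- The inequalities 0 < a + b < M valid on Ω keep u away from ℤ + ℤMτ.
  have hu : ((a : ℂ) + b) * τ + 2 * ε ∉ periodLattice (M * τ) := by
    have := add_mul_notMem_periodLattice hτ (x := 2 * ε) (ne_intCast_mul_of_mem_Ioo hab)
    push_cast at this
    exact this
  obtain ⟨c, hc⟩ := exists_tendsto_sub_mul_phiHat hd hτM' hu ((a - b) * τ / 2 - z₀)
  have hm : Tendsto (fun z : ℂ => ((a : ℂ) - b) * τ / 2 - z) (𝓝[≠] z₀)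
      (𝓝[≠] (((a : ℂ) - b) * τ / 2 - z₀)) := by
    have h := (tendsto_add_nhdsNE (-1 * z₀) (((a : ℂ) - b) * τ / 2)).comp
      (tendsto_mul_nhdsNE (neg_ne_zero.2 one_ne_zero) z₀)
    rw [show -1 * z₀ + ((a : ℂ) - b) * τ / 2 = (a - b) * τ / 2 - z₀ by ring] at h
    refine h.congr fun z => ?_
    simp only [Function.comp]
    ring
  have hf : ContinuousAt (fun z => cexp (2 * π * I * (d * (a * b) * τ / M + d * (a - b) * z / M)))
      z₀ := by fun_prop
  have h := ((hf.tendsto.mono_left (nhdsWithin_le_nhds (s := {z₀}ᶜ))).mul (hc.comp hm)).neg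
  refine ⟨_, h.congr fun z => ?_⟩
  simp only [Function.comp, psiHat]
  ring

theorem N2ChMod_eq_limExt (M m s : ℕ) (ε ε' j k : ℝ) (τ : ℂ) :
    N2ChMod M m s ε ε' j k τ = limExt (polarSet ε ε' τ) (N2Quot M m s ε ε' j k τ) := rfl

theorem mem_Omega_cases (hε' : ε' = 0 ∨ ε' = 1 / 2) {j k : ℝ} (h : (j, k) ∈ Omega M ε') :
    (∃ n : ℤ, j = ε' + n) ∧ (∃ n : ℤ, k = ε' + n) ∧ j + k ∈ Set.Ioo (0 : ℝ) M := by
  have hε0 : 0 ≤ ε' := by rcases hε' with rfl | rfl <;> norm_num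
  obtain ⟨⟨a, rfl⟩, ⟨b, rfl⟩, h3, h4⟩ := (mem_Omega M ε' hε0 j k).1 h
  have hb : (0 : ℝ) ≤ b := Nat.cast_nonneg b
  exact ⟨⟨a, by simp⟩, ⟨b, by simp⟩, by linarith, by linarith⟩

theorem continuous_N2ChMod (hM : 0 < M) (m s : ℕ) (hτ : 0 < τ.im) (hε : ε = 0 ∨ ε = 1 / 2)
    (hε' : ε' = 0 ∨ ε' = 1 / 2) {j k : ℝ} (hjk : (j, k) ∈ Omega M ε') :
    Continuous (N2ChMod M m s ε ε' j k τ) := by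
  obtain ⟨hj, hk, hs⟩ := mem_Omega_cases hε' hjk
  have hquot : ∀ z ∉ polarSet ε ε' τ, N2Quot M m s ε ε' j k τ z =
      psiHat (m + 1) M ε j k τ z * thetaChar (1 - 2 * ε') (1 - 2 * ε) τ z /
      ((-1 : ℂ) ^ (((1 - 2 * ε) * (1 - 2 * ε') : ℝ) : ℂ) * ModularForm.eta τ ^ 3) :=
    fun z hz => by rw [N2Quot_eq, PsiMod_eq_psiHat hM m s hτ hε hε' hj hk hz]
  have hth := differentiable_thetaChar hτ (1 - 2 * ε') (1 - 2 * ε)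
  rw [N2ChMod_eq_limExt]
  refine continuous_limExt (eventually_notMem_polarSet hτ ε ε') (fun z hz => ?_) fun z hz => ?_
  · refine ContinuousAt.congr ?_ ((eventually_nhds_notMem_polarSet hτ hz).mono
      fun w hw => (hquot w hw).symm)
    exact ((continuousAt_psiHat m.succ_pos hM hτ hε hε' hj hk hz).mul
      (hth z).continuousAt).div_const _
  · obtain ⟨c, hc⟩ := exists_tendsto_sub_mul_psiHat (ε := ε) m.succ_pos hτ hs z
    -- The theta function vanishes at z, so its slope there is ϑ(w)/(w - z); multiplied by (w - z)Ψ~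
    -- it gives the limit of the quotient.
    have h1 := (hth z).hasDerivAt.tendsto_slope
    refine ⟨_, ((hc.mul h1).div_const ((-1 : ℂ) ^ (((1 - 2 * ε) * (1 - 2 * ε') : ℝ) : ℂ) *
      ModularForm.eta τ ^ 3)).congr' ?_⟩
    filter_upwards [eventually_notMem_polarSet hτ ε ε' z, self_mem_nhdsWithin] with w hw hwz
    rw [hquot w hw, slope_def_field, thetaChar_eq_zero ε ε' hz, sub_zero]
    have : w - z ≠ 0 := sub_ne_zero.2 hwz
    congr 1
    field_simp

end

section

/-! ### Transformation laws of the numerators -/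

variable {d M : ℕ} {τ : ℂ} {ε ε' a b : ℝ}

theorem phiHat_add_intCast_left (hd : 0 < d) (s : ℕ) (τ u v : ℂ) (p : ℤ) :
    phiHat d s τ (u + p) (v + p / 2) = phiHat d s τ u v := by
  induction p with
  | zero => simp
  | succ p ih =>
    rw [← ih, ← phiHat_add_one hd s τ (u + (p : ℤ))]
    congr 1 <;> (push_cast; ring)
  | pred p ih =>
    rw [← ih, ← phiHat_add_one hd s τ (u + ((-p - 1 : ℤ) : ℂ))]
    congr 1 <;> (push_cast; ring)

theorem phiHat_add_intCast_right (hd : 0 < d) (s : ℕ) (τ u v : ℂ) (p : ℤ) :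
    phiHat d s τ u (v + p) = phiHat d s τ u v := by
  induction p with
  | zero => simp
  | succ p ih =>
    rw [← ih, ← phiHat_add_one_right hd s τ u (v + (p : ℤ))]
    congr 1; push_cast; ring
  | pred p ih =>
    rw [← ih, ← phiHat_add_one_right hd s τ u (v + ((-p - 1 : ℤ) : ℂ))]
    congr 1; push_cast; ring

theorem phiHat_add_intCast (hd : 0 < d) (s : ℕ) (τ u v : ℂ) (p q : ℤ) :
    phiHat d s τ (u + (p + q)) (v + (p - q) / 2) = phiHat d s τ u v := by
  rw [← phiHat_add_intCast_left hd s τ u v (p + q),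
    ← phiHat_add_intCast_right hd s τ (u + (p + q : ℤ)) _ (-q)]
  congr 1 <;> (push_cast; ring)

/-- Oddness of Φ~ in u, combined with an integral translation that restores 2ε from -2ε. -/
theorem psiHat_neg (hd : 0 < d) (hε : ε = 0 ∨ ε = 1 / 2) (a b : ℝ) (z : ℂ) :
    psiHat d M ε (-b) (-a) τ z = -psiHat d M ε a b τ z := by
  obtain ⟨e, he⟩ := exists_intCast_two_mul hε
  rw [psiHat, psiHat, ← mul_neg, ← phiHat_neg hd,
    ← phiHat_add_intCast hd 0 _ (-((a + b) * τ + 2 * ε)) _ e e]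
  congr 1
  · congr 1; push_cast; ring
  · congr 1
    · rw [← he]; push_cast; ring
    · push_cast; ring

/-- The summands of the transformation law of the numerators under `τ ↦ -1 / τ`. -/
def inversionTerm (d M : ℕ) (ε ε' j k : ℝ) (τ z : ℂ) (a b : ℤ) : ℂ :=
  cexp (-(2 * π * I * d * (j * (b + ε) + k * (a + ε)) / M)) *
    psiHat d M ε' (a + ε) (b + ε) τ z

/-- The part 2ετ of u moves a and b into ε + ℤ. The real parts of j and k are integers up to ε', so
integral translations reduce them to the characteristic 2ε' of the transformed function. -/
theorem levelTerm_eq_inversionTerm (hd : 0 < d) (hM : 0 < M) (hε' : ε' = 0 ∨ ε' = 1 / 2) {j k : ℝ}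
    (hj : ∃ n : ℤ, j = ε' + n) (hk : ∃ n : ℤ, k = ε' + n) (z : ℂ) (a b : ℤ) :
    levelTerm d M τ (-(j + k) + 2 * ε * τ) (-(j - k) / 2 - z) a b =
      cexp (2 * π * I * d * (ε * (j + k) - ε ^ 2 * τ) / M) *
        inversionTerm d M ε ε' j k τ z a b := by
  have hMc : (M : ℂ) ≠ 0 := by exact_mod_cast hM.ne'
  obtain ⟨e, he⟩ := exists_intCast_two_mul hε'
  obtain ⟨p, rfl⟩ := hj
  obtain ⟨q, rfl⟩ := hk
  rw [levelTerm, levelFactor, inversionTerm, psiHat, ← mul_assoc (cexp _) (cexp _),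
    ← Complex.exp_add, ← mul_assoc (cexp _) (cexp _), ← Complex.exp_add, ← phiHat_add_intCast hd 0 _ _ _ (p + e) (q + e)]
  congr 1
  · congr 1; push_cast; field_simp; ring
  · congr 1
    · push_cast; rw [← he]; ring
    · push_cast; ring

/-- Here M(-1/τ) = -1/(τ/M), so inversion is applied at modulus τ/M and the result is expanded at
Mτ. The inequality 0 < j + k < M ensures that u/M is not a period of ℤ + ℤτ/M. -/
theorem psiHat_neg_inv (hd : 0 < d) (hM : 0 < M) (hdM : IsCoprime (d : ℤ) (M : ℤ)) (hτ : 0 < τ.im)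
    (hε : ε = 0 ∨ ε = 1 / 2) (hε' : ε' = 0 ∨ ε' = 1 / 2) {j k : ℝ}
    (hj : ∃ n : ℤ, j = ε' + n) (hk : ∃ n : ℤ, k = ε' + n) (hjk : j + k ∈ Set.Ioo (0 : ℝ) M) {z : ℂ}
    (hz : -(j - k) / 2 - z ∉ polePoints τ (-(j + k) + 2 * ε * τ)) :
    psiHat d M ε j k (-1 / τ) (z / τ) = τ / M * cexp (-(2 * π * I * d * z ^ 2 / (M * τ))) *
      ∑ a ∈ Finset.range M, ∑ b ∈ Finset.range M, inversionTerm d M ε ε' j k τ z a b := by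
  have hMr : (0 : ℝ) < M := by exact_mod_cast hM
  have hMc : (M : ℂ) ≠ 0 := by exact_mod_cast hM.ne'
  have hτ0 : τ ≠ 0 := by rintro rfl; simp at hτ
  have hτM : 0 < (τ / M).im := by rw [im_div_natCast]; positivity
  have hu : (-((j : ℂ) + k) + 2 * ε * τ) / M ∉ periodLattice (τ / M) := by
    obtain ⟨e, he⟩ := exists_intCast_two_mul hε
    rintro ⟨p, q, h⟩
    have h1 : (-((j : ℂ) + k) + 2 * ε * τ) = p * M + q * τ := by
      rw [div_eq_iff hMc] at h
      rw [h]; field_simp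
    have him := congrArg Complex.im h1
    rw [he] at h1 him
    simp at him
    have h2 : (e : ℂ) = q := by
      rcases him with h | h
      · exact_mod_cast h
      · exact absurd h hτ.ne'
    rw [h2] at h1
    have h3 : ((j + k : ℝ) : ℂ) = ((((-p : ℤ) : ℝ) * M : ℝ) : ℂ) := by
      push_cast; linear_combination -h1
    exact ne_intCast_mul_of_mem_Ioo hjk _ (by exact_mod_cast h3)
  have h1 := phiHat_S hd hτM hu (div_notMem_polePoints hM hz)
  rw [phiHat_div_eq_levelSum hd hM hdM hτ hz] at h1
  have h2 : levelSum d M τ (-(j + k) + 2 * ε * τ) (-(j - k) / 2 - z) =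
      cexp (2 * π * I * d * (ε * (j + k) - ε ^ 2 * τ) / M) *
        ∑ a ∈ Finset.range M, ∑ b ∈ Finset.range M, inversionTerm d M ε ε' j k τ z a b := by
    rw [levelSum, Finset.mul_sum]
    refine Finset.sum_congr rfl fun a _ => ?_
    rw [Finset.mul_sum]
    exact Finset.sum_congr rfl fun b _ => levelTerm_eq_inversionTerm hd hM hε' hj hk z a b
  have h3 : phiHat d 0 (M * (-1 / τ)) ((j + k) * (-1 / τ) + 2 * ε)
      ((j - k) * (-1 / τ) / 2 - z / τ) = phiHat d 0 (-1 / (τ / M))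
        ((-((j : ℂ) + k) + 2 * ε * τ) / M / (τ / M)) ((-((j : ℂ) - k) / 2 - z) / M / (τ / M)) := by
    congr 1
    · field_simp
    · field_simp
    · field_simp
  rw [psiHat, h3, h1, h2]
  generalize ∑ a ∈ Finset.range M, ∑ b ∈ Finset.range M, inversionTerm d M ε ε' j k τ z a b = S
  have h4 : cexp (2 * π * I * (d * (j * k) * (-1 / τ) / M + d * (j - k) * (z / τ) / M)) *
      (cexp (2 * π * I * d * (((-((j : ℂ) + k) + 2 * ε * τ) / M) ^ 2 / 4 -
        ((-((j : ℂ) - k) / 2 - z) / M) ^ 2) / (τ / M)) *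
      cexp (2 * π * I * d * (ε * (j + k) - ε ^ 2 * τ) / M)) =
      cexp (-(2 * π * I * d * z ^ 2 / (M * τ))) := by
    rw [← Complex.exp_add, ← Complex.exp_add]
    congr 1
    field_simp
    ring
  rw [← h4]
  ring

/-- The pairs (A, B) and (-B, -A) carry opposite values of Ψ~, so their exponential coefficients are
subtracted and form a sine. -/
theorem sum_inversionTerm (hd : 0 < d) (hM : 0 < M) (hτ : 0 < τ.im)
    (hε : ε = 0 ∨ ε = 1 / 2) (hε' : ε' = 0 ∨ ε' = 1 / 2) {j k : ℝ}
    (hj : ∃ n : ℤ, j = ε' + n) (hk : ∃ n : ℤ, k = ε' + n) {z : ℂ}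
    (hz : -(j - k) / 2 - z ∉ polePoints τ (-(j + k) + 2 * ε * τ)) :
    ∑ a ∈ Finset.range M, ∑ b ∈ Finset.range M, inversionTerm d M ε ε' j k τ z a b =
      ∑ p ∈ Omega M ε, -2 * I * (cexp (π * I * d / M * (j - k) * (p.1 - p.2)) *
        (Real.sin (d / M * (j + k) * (p.1 + p.2) * π) : ℂ) * psiHat d M ε' p.1 p.2 τ z) := by
  have hMc : (M : ℂ) ≠ 0 := by exact_mod_cast hM.ne'
  obtain ⟨e, he⟩ : ∃ e : ℤ, 2 * ε = e := by
    rcases hε with rfl | rfl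
    · exact ⟨0, by simp⟩
    · exact ⟨1, by simp⟩
  have hinv : ∀ a b, inversionTerm d M ε ε' j k τ z a b =
      (cexp (2 * π * I * d * (ε * (j + k) - ε ^ 2 * τ) / M))⁻¹ *
        levelTerm d M τ (-(j + k) + 2 * ε * τ) (-(j - k) / 2 - z) a b := by
    intro a b
    rw [levelTerm_eq_inversionTerm hd hM hε' hj hk, inv_mul_cancel_left₀ (Complex.exp_ne_zero _)]
  have h1 : ∀ a b, inversionTerm d M ε ε' j k τ z (a + M) b = inversionTerm d M ε ε' j k τ z a b :=
    fun a b => by rw [hinv, hinv, levelTerm_add_left hd hM hτ hz]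
  have h2 : ∀ a b, inversionTerm d M ε ε' j k τ z a (b + M) = inversionTerm d M ε ε' j k τ z a b :=
    fun a b => by rw [hinv, hinv, levelTerm_add_right hd hM hτ hz]
  have h0 : ∀ a b, a + b + e = 0 → inversionTerm d M ε ε' j k τ z a b = 0 := by
    intro a b hab
    have hab' : (b : ℝ) + ε = -(a + ε) := by
      have : (a : ℝ) + b + e = 0 := by exact_mod_cast hab
      linarith
    have h := psiHat_neg (M := M) (τ := τ) hd hε' (a + ε) (-(a + ε)) z
    rw [neg_neg] at h
    rw [inversionTerm, hab', self_eq_neg.1 h, mul_zero]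
  rw [sum_range_range_eq_fold hM h1 h2 e h0, sum_Omega_eq hε]
  refine Finset.sum_congr rfl fun n _ => Finset.sum_congr rfl fun i _ => ?_
  have e1 : ((1 - e + i : ℤ) : ℝ) + ε = 1 - ε + i := by push_cast; rw [← he]; ring
  have e2 : ((n - 1 - i : ℤ) : ℝ) + ε = n - 1 + ε - i := by push_cast; ring
  have e3 : ((-(n - 1 - i) - e : ℤ) : ℝ) + ε = -(n - 1 + ε - i) := by push_cast; rw [← he]; ring
  have e4 : ((-(1 - e + i) - e : ℤ) : ℝ) + ε = -(1 - ε + i) := by push_cast; rw [← he]; ring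
  have key : ∀ (a b : ℤ) (A B : ℝ), (a : ℝ) + ε = A → (b : ℝ) + ε = B →
      inversionTerm d M ε ε' j k τ z a b =
        cexp (-(2 * π * I * d * (j * B + k * A) / M)) * psiHat d M ε' A B τ z := by
    rintro a b A B rfl rfl
    rw [inversionTerm]; push_cast; rfl
  rw [key _ _ _ _ e1 e2, key _ _ _ _ e3 e4, psiHat_neg hd hε']
  generalize 1 - ε + (i : ℝ) = A
  generalize (n : ℝ) - 1 + ε - i = B
  have hs : cexp (-(2 * π * I * d * (j * B + k * A) / M)) -
      cexp (-(2 * π * I * d * (j * ((-A : ℝ) : ℂ) + k * ((-B : ℝ) : ℂ)) / M)) =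
      -2 * I * (cexp (π * I * d / M * (j - k) * (A - B)) *
        (Real.sin (d / M * (j + k) * (A + B) * π) : ℂ)) := by
    have hx : ∀ x : ℂ, -2 * I * Complex.sin x = cexp (-x * I) - cexp (x * I) := by
      intro x
      rw [Complex.sin]
      linear_combination (-(cexp (-x * I) - cexp (x * I))) * I_sq
    rw [mul_left_comm, Complex.ofReal_sin, hx, mul_sub, ← Complex.exp_add, ← Complex.exp_add]
    congr 1
    · congr 1; push_cast; field_simp; ring
    · congr 1; push_cast; field_simp; ring
  linear_combination psiHat d M ε' A B τ z * hs

/-- Φ~ is invariant under Mτ ↦ Mτ + M. The extra real shift by a and b changes ε to ε + ε', which is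
|ε - ε'| mod 1. -/
theorem psiHat_add_one (hd : 0 < d) (hε : ε = 0 ∨ ε = 1 / 2) (hε' : ε' = 0 ∨ ε' = 1 / 2) {j k : ℝ}
    (hj : ∃ n : ℤ, j = ε' + n) (hk : ∃ n : ℤ, k = ε' + n) (z : ℂ) :
    psiHat d M ε j k (τ + 1) z =
      cexp (2 * π * I * d / M * j * k) * psiHat d M |ε - ε'| j k τ z := by
  obtain ⟨e, he⟩ : ∃ e : ℤ, ε + ε' = |ε - ε'| + e := by
    rcases hε with rfl | rfl <;> rcases hε' with rfl | rfl
    · exact ⟨0, by norm_num⟩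
    · exact ⟨0, by norm_num [abs_of_pos]⟩
    · exact ⟨0, by norm_num [abs_of_pos]⟩
    · exact ⟨1, by norm_num⟩
  have he' : (ε : ℂ) + ε' = (|ε - ε'| : ℝ) + e := by exact_mod_cast congrArg Complex.ofReal he
  obtain ⟨p, rfl⟩ := hj
  obtain ⟨q, rfl⟩ := hk
  rw [psiHat, psiHat, ← mul_assoc (cexp _) (cexp _), ← Complex.exp_add, mul_add (M : ℂ), mul_one,
    phiHat_tau_add_natCast hd, ← phiHat_add_intCast hd 0 _ _ _ (-(p + e)) (-(q + e))]
  congr 1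
  · congr 1; push_cast; ring
  · congr 1
    · push_cast; linear_combination 2 * he'
    · push_cast; ring

/-! ### Transformation laws of the characters -/

theorem div_mem_polarSet_neg_inv (hτ : τ ≠ 0) (hε' : ε' = 0 ∨ ε' = 1 / 2) {z : ℂ} :
    z / τ ∈ polarSet ε ε' (-1 / τ) ↔ z ∈ polarSet ε' ε τ := by
  obtain ⟨e, he⟩ := exists_intCast_two_mul hε'
  rw [mem_polarSet_iff, mem_polarSet_iff, show z / τ - ε - ε' * (-1 / τ) =
    (z - ε' - ε * τ + 2 * ε') / τ by field_simp; ring, div_mem_periodLattice_neg_inv hτ, he,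
    add_mem_periodLattice_iff (intCast_mem_periodLattice τ e)]

theorem mem_polarSet_add_one (hε : ε = 0 ∨ ε = 1 / 2) (hε' : ε' = 0 ∨ ε' = 1 / 2) {z : ℂ} :
    z ∈ polarSet ε ε' (τ + 1) ↔ z ∈ polarSet |ε - ε'| ε' τ := by
  obtain ⟨e, he⟩ : ∃ e : ℤ, ε + ε' = |ε - ε'| + e := by
    rcases hε with rfl | rfl <;> rcases hε' with rfl | rfl
    · exact ⟨0, by norm_num⟩
    · exact ⟨0, by norm_num [abs_of_pos]⟩
    · exact ⟨0, by norm_num [abs_of_pos]⟩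
    · exact ⟨1, by norm_num⟩
  have he' : (ε : ℂ) + ε' = (|ε - ε'| : ℝ) + e := by exact_mod_cast congrArg Complex.ofReal he
  constructor
  · rintro ⟨p, q, rfl⟩
    exact ⟨p + e + q, q, by push_cast; linear_combination he'⟩
  · rintro ⟨p, q, rfl⟩
    exact ⟨p - e - q, q, by push_cast; linear_combination -he'⟩

theorem inversion_notMem_polePoints (hε' : ε' = 0 ∨ ε' = 1 / 2) {j k : ℝ}
    (hj : ∃ n : ℤ, j = ε' + n) (hk : ∃ n : ℤ, k = ε' + n) {z : ℂ} (hz : z ∉ polarSet ε' ε τ)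
    (hε : ε = 0 ∨ ε = 1 / 2) : -(j - k) / 2 - z ∉ polePoints τ (-(j + k) + 2 * ε * τ) := by
  obtain ⟨e, he⟩ := exists_intCast_two_mul hε
  obtain ⟨e', he'⟩ := exists_intCast_two_mul hε'
  obtain ⟨p, rfl⟩ := hj
  obtain ⟨q, rfl⟩ := hk
  rw [mem_polarSet_iff] at hz
  refine notMem_polePoints.2 ⟨fun h => hz ?_, fun h => hz ?_⟩
  · refine (add_mem_periodLattice_iff (intCast_mem_periodLattice τ (p + e'))).1 ?_
    convert neg_mem_periodLattice.2 h using 1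
    push_cast
    rw [← he']; ring
  · refine (add_mem_periodLattice_iff (intCast_add_mul_mem_periodLattice (-q) e)).1 ?_
    convert neg_mem_periodLattice.2 h using 1
    push_cast
    rw [← he]; ring

theorem N2Quot_neg_inv (m s : ℕ) (hM : 0 < M) (hdM : IsCoprime ((m + 1 : ℕ) : ℤ) (M : ℤ))
    (hτ : 0 < τ.im) (hε : ε = 0 ∨ ε = 1 / 2) (hε' : ε' = 0 ∨ ε' = 1 / 2) {j k : ℝ}
    (hjk : (j, k) ∈ Omega M ε') {z : ℂ} (hz : z ∉ polarSet ε' ε τ) :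
    N2Quot M m s ε ε' j k (-1 / τ) (z / τ) =
      cexp (π * I * centralCharge M m / (3 * τ) * z ^ 2) *
        ∑ p ∈ Omega M ε, SMatrix M m ε ε' j k p.1 p.2 * N2Quot M m s ε' ε p.1 p.2 τ z := by
  have hMc : (M : ℂ) ≠ 0 := by exact_mod_cast hM.ne'
  have hτ0 : τ ≠ 0 := by rintro rfl; simp at hτ
  obtain ⟨hj, hk, hs⟩ := mem_Omega_cases hε' hjk
  have hz1 := inversion_notMem_polePoints hε' hj hk hz hε
  rw [N2Quot_eq, PsiMod_eq_psiHat hM m s (im_neg_one_div_pos hτ) hε hε' hj hk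
    ((div_mem_polarSet_neg_inv hτ0 hε').not.2 hz),
    psiHat_neg_inv m.succ_pos hM hdM hτ hε hε' hj hk hs hz1,
    sum_inversionTerm m.succ_pos hM hτ hε hε' hj hk hz1, mul_div_mul_comm,
    thetaChar_div_eta_neg_inv hτ hε hε']
  -- Here c/3 = 1 - 2(m + 1)/M: the 1 comes from the denominator and the rest from the numerator.
  have hexp : cexp (π * I * centralCharge M m / (3 * τ) * z ^ 2) =
      cexp (-(2 * π * I * (m.succ : ℕ) * z ^ 2 / (M * τ))) * cexp (π * I * z ^ 2 / τ) := by
    rw [← Complex.exp_add, centralCharge]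
    congr 1
    push_cast
    field_simp
    ring
  rw [hexp, Finset.mul_sum, Finset.mul_sum, Finset.sum_div, Finset.sum_mul]
  refine Finset.sum_congr rfl fun p hp => ?_
  obtain ⟨hp1, hp2, -⟩ := mem_Omega_cases hε hp
  rw [N2Quot_eq, PsiMod_eq_psiHat hM m s hτ hε' hε hp1 hp2 hz, SMatrix,
    mul_comm (1 - 2 * ε') (1 - 2 * ε)]
  have hc : ((m.succ : ℕ) : ℂ) = m + 1 := by push_cast; rfl
  have hr : ((m.succ : ℕ) : ℝ) = m + 1 := by push_cast; rfl
  rw [hc, hr]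
  generalize cexp (-(2 * π * I * (m + 1) * z ^ 2 / (M * τ))) = E₁
  generalize cexp (π * I * z ^ 2 / τ) = E₂
  generalize (-I) ^ (((1 - 2 * ε) * (1 - 2 * ε') : ℝ) : ℂ) = w
  generalize ((Real.sin _ : ℝ) : ℂ) = σ
  generalize (-1 : ℂ) ^ (((1 - 2 * ε) * (1 - 2 * ε') : ℝ) : ℂ) = sg
  generalize cexp (π * I * (m + 1) / M * (j - k) * (p.1 - p.2)) = c
  generalize ModularForm.eta τ ^ 3 = H
  have hτI : τ * τ⁻¹ = 1 := mul_inv_cancel₀ hτ0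
  -- The constant 2/M of the S-matrix is (τ/M)(i/τ)(-2i).
  linear_combination (E₁ * E₂ * w * c * σ * psiHat (m + 1) M ε' p.1 p.2 τ z *
    thetaChar (1 - 2 * ε) (1 - 2 * ε') τ z / (M * sg * H)) * (-2 * I ^ 2 * hτI - 2 * I_sq)

theorem abs_sub_half (hε : ε = 0 ∨ ε = 1 / 2) (hε' : ε' = 0 ∨ ε' = 1 / 2) :
    |ε - ε'| = 0 ∨ |ε - ε'| = 1 / 2 := by
  rcases hε with rfl | rfl <;> rcases hε' with rfl | rfl <;> norm_num [abs_of_pos]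

theorem N2Quot_add_one (m s : ℕ) (hM : 0 < M)
    (hτ : 0 < τ.im) (hε : ε = 0 ∨ ε = 1 / 2) (hε' : ε' = 0 ∨ ε' = 1 / 2) {j k : ℝ}
    (hjk : (j, k) ∈ Omega M ε') {z : ℂ} (hz : z ∉ polarSet |ε - ε'| ε' τ) :
    N2Quot M m s ε ε' j k (τ + 1) z =
      cexp (2 * π * I * ((m : ℂ) + 1) / M * j * k - π * I * ε' / 2) *
        N2Quot M m s |ε - ε'| ε' j k τ z := by
  obtain ⟨hj, hk, -⟩ := mem_Omega_cases hε' hjk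
  have hδ := abs_sub_half hε hε'
  rw [N2Quot_eq, PsiMod_eq_psiHat hM m s (by simpa using hτ) hε hε' hj hk
    ((mem_polarSet_add_one hε hε').not.2 hz), psiHat_add_one m.succ_pos hε hε' hj hk, mul_div_assoc,
    thetaChar_div_eta_add_one τ hε hε', N2Quot_eq, PsiMod_eq_psiHat hM m s hτ hδ hε' hj hk hz,
    Complex.exp_sub, Complex.exp_neg]
  push_cast
  ring

theorem N2ChMod_neg_inv (m s : ℕ) (hM : 0 < M) (hdM : IsCoprime ((m + 1 : ℕ) : ℤ) (M : ℤ))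
    (hτ : 0 < τ.im) (hε : ε = 0 ∨ ε = 1 / 2) (hε' : ε' = 0 ∨ ε' = 1 / 2) {j k : ℝ}
    (hjk : (j, k) ∈ Omega M ε') (z : ℂ) :
    N2ChMod M m s ε ε' j k (-1 / τ) (z / τ) =
      cexp (π * I * centralCharge M m / (3 * τ) * z ^ 2) *
        ∑ p ∈ Omega M ε, SMatrix M m ε ε' j k p.1 p.2 * N2ChMod M m s ε' ε p.1 p.2 τ z := by
  have hτ0 : τ ≠ 0 := by rintro rfl; simp at hτ
  have h1 : Continuous fun z => N2ChMod M m s ε ε' j k (-1 / τ) (z / τ) :=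
    (continuous_N2ChMod hM m s (im_neg_one_div_pos hτ) hε hε' hjk).comp (by fun_prop)
  have h2 : Continuous fun z => cexp (π * I * centralCharge M m / (3 * τ) * z ^ 2) *
      ∑ p ∈ Omega M ε, SMatrix M m ε ε' j k p.1 p.2 * N2ChMod M m s ε' ε p.1 p.2 τ z := by
    refine Continuous.mul (by fun_prop) (continuous_finsetSum _ fun p hp => ?_)
    exact continuous_const.mul (continuous_N2ChMod hM m s hτ hε' hε hp)
  refine congrFun (h1.ext_on (dense_compl_of_eventually (eventually_notMem_polarSet hτ ε' ε)) h2
    fun z hz => ?_) z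
  dsimp only
  rw [N2ChMod_eq_limExt, limExt_of_notMem ((div_mem_polarSet_neg_inv hτ0 hε').not.2 hz),
    N2Quot_neg_inv m s hM hdM hτ hε hε' hjk hz]
  congr 1
  refine Finset.sum_congr rfl fun p _ => ?_
  rw [N2ChMod_eq_limExt, limExt_of_notMem hz]

theorem N2ChMod_add_one (m s : ℕ) (hM : 0 < M) (hτ : 0 < τ.im) (hε : ε = 0 ∨ ε = 1 / 2)
    (hε' : ε' = 0 ∨ ε' = 1 / 2) {j k : ℝ} (hjk : (j, k) ∈ Omega M ε') (z : ℂ) :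
    N2ChMod M m s ε ε' j k (τ + 1) z =
      cexp (2 * π * I * ((m : ℂ) + 1) / M * j * k - π * I * ε' / 2) *
        N2ChMod M m s |ε - ε'| ε' j k τ z := by
  have h1 := continuous_N2ChMod hM m s (τ := τ + 1) (by simpa using hτ) hε hε' hjk
  have h2 := (continuous_N2ChMod hM m s hτ (abs_sub_half hε hε') hε' hjk).const_mul
    (cexp (2 * π * I * ((m : ℂ) + 1) / M * j * k - π * I * ε' / 2))
  refine congrFun (h1.ext_on
    (dense_compl_of_eventually (eventually_notMem_polarSet hτ |ε - ε'| ε')) h2 fun z hz => ?_) z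
  rw [N2ChMod_eq_limExt, N2ChMod_eq_limExt,
    limExt_of_notMem ((mem_polarSet_add_one hε hε').not.2 hz), limExt_of_notMem hz,
    N2Quot_add_one m s hM hτ hε hε' hjk hz]

theorem isCoprime_of_gcd {M m : ℕ} (hgcd : 0 < m → Nat.gcd M (2 * m + 2) = 1) :
    IsCoprime ((m + 1 : ℕ) : ℤ) (M : ℤ) := by
  rw [Nat.isCoprime_iff_coprime]
  rcases Nat.eq_zero_or_pos m with rfl | hm
  · exact Nat.coprime_one_left M
  · exact (Nat.Coprime.coprime_dvd_right ⟨2, by ring⟩ (hgcd hm)).symm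

end
end KacWakimoto

end

theorem theorem2p11 (M m s : ℕ) (hM : 2 ≤ M) (hgcd : 0 < m → Nat.gcd M (2 * m + 2) = 1)
    (hs : s ≤ m) (ε ε' : ℝ) (hε : ε = 0 ∨ ε = 1 / 2) (hε' : ε' = 0 ∨ ε' = 1 / 2)
    (j k : ℝ) (hjk : (j, k) ∈ KacWakimoto.Omega M ε') (τ : ℂ) (hτ : 0 < τ.im) :
    Continuous (KacWakimoto.N2ChMod M m s ε ε' j k τ) ∧
    ∀ z : ℂ,
      KacWakimoto.N2ChMod M m s ε ε' j k (-1 / τ) (z / τ) =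
          cexp (π * I * KacWakimoto.centralCharge M m / (3 * τ) * z ^ 2) *
            ∑ p ∈ KacWakimoto.Omega M ε,
              KacWakimoto.SMatrix M m ε ε' j k p.1 p.2 *
                KacWakimoto.N2ChMod M m s ε' ε p.1 p.2 τ z ∧
      KacWakimoto.N2ChMod M m s ε ε' j k (τ + 1) z =
          cexp (2 * π * I * ((m : ℂ) + 1) / M * j * k - π * I * ε' / 2) *
            KacWakimoto.N2ChMod M m s |ε - ε'| ε' j k τ z := by
  have hM0 : 0 < M := by omega
  exact ⟨KacWakimoto.continuous_N2ChMod hM0 m s hτ hε hε' hjk, fun z =>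
    ⟨KacWakimoto.N2ChMod_neg_inv m s hM0 (KacWakimoto.isCoprime_of_gcd hgcd) hτ hε hε' hjk z,
      KacWakimoto.N2ChMod_add_one m s hM0 hτ hε hε' hjk z⟩⟩
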